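/- Let $\mathbb{D}=\{z\in\mathbb{C}:|z|<1\}$. Let $\mathcal{C}_3$ be the class of functions $f(z)=z+\sum_{n\ge 2}a_nz^n$ analytic in $\mathbb{D}$ for which there is a convex function $g$ (that is, $g$ is analytic and univalent in $\mathbb{D}$, $g(\mathbb{D})$ is convex, and $g(z)=b_1z+\cdots$ with $\operatorname{Re} b_1>0$) such that $$\operatorname{Re}\left(\frac{\bigl(z(zf'(z))'\bigr)'}{(zg'(z))'}\right)>0\qquad(z\in\mathbb{D}).$$ Let $d(f(0),\partial f(\mathbb{D}))$ denote the Euclidean distance from $f(0)$ to the boundary of $f(\mathbb{D})$. **Theorem.** Let $p\ge 1$ be real. The equation $$\frac{(3-r)r}{3(1-r)}+\sum_{n=2}^{\infty}\frac{r^n}{3n^2}+\sum_{n=2}^{\infty}\left(\frac23+\frac1{3n^2}\right)^p r^{np}-\frac{1}{36}\left(12+\pi^2\right)=0$$ has exactly one root $R_p$ in $(0,1/2)$. For every $f(z)=z+\sum_{n\ge2}a_nz^n\in\mathcal{C}_3$ and every $z$ with $|z|\le R_p$, both series below converge and $$|z|+\sum_{n=2}^{\infty}|a_n||z|^n+\sum_{n=2}^{\infty}|a_n|^p|z|^{np}\le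 d(f(0),\partial f(\mathbb{D})).$$ The radius $R_p$ is sharp: there is $f\in\mathcal{C}_3$ for which equality holds whenever $|z|=R_p$, while for every $z$ with $R_p<|z|<1$ both series converge and the left-hand side is strictly larger than $d(f(0),\partial f(\mathbb{D}))$. -/

import Mathlib

open Metric

/-- A normalized convex function of the unit disc up to a first coefficient of positive real part:
`g` is analytic and univalent in the open unit disc, `g(z) = b₁ z + ⋯` with `Re b₁ > 0`, and it
maps the disc onto a convex domain. -/
structure IsConvexFunction (g : ℂ → ℂ) : Prop where
  analytic : DifferentiableOn ℂ g (ball 0 1)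
  map_zero : g 0 = 0
  re_deriv_pos : 0 < (deriv g 0).re
  univalent : Set.InjOn g (ball 0 1)
  convex_image : Convex ℝ (g '' ball 0 1)

/-- The operator `f ↦ z f'`. -/
noncomputable def zDeriv (f : ℂ → ℂ) : ℂ → ℂ := fun z => z * deriv f z

/-- The class `𝒞₃`: functions `f(z) = z + ∑_{n ≥ 2} aₙ zⁿ`, analytic in the open unit disc, for
which there is a convex function `g` with `Re ((z (z f')')' / (z g')') > 0` in the disc. -/
structure IsClassC3 (f : ℂ → ℂ) : Prop where
  analytic : DifferentiableOn ℂ f (ball 0 1)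
  map_zero : f 0 = 0
  deriv_zero : deriv f 0 = 1
  exists_convex : ∃ g : ℂ → ℂ, IsConvexFunction g ∧
    ∀ z ∈ ball (0 : ℂ) 1, 0 < (deriv (zDeriv (zDeriv f)) z / deriv (zDeriv g) z).re

/-- The `n`-th Taylor coefficient `aₙ` of `f` at the origin. -/
noncomputable def taylorCoeff (f : ℂ → ℂ) (n : ℕ) : ℂ :=
  iteratedDeriv n f 0 / (n.factorial : ℂ)

/-- The `n`-th term `|aₙ| |z|ⁿ`. -/
noncomputable def majorantTerm (f : ℂ → ℂ) (z : ℂ) (n : ℕ) : ℝ :=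
  ‖taylorCoeff f n‖ * ‖z‖ ^ n

/-- The `n`-th term `|aₙ|ᵖ |z|ⁿᵖ`. -/
noncomputable def powerTerm (p : ℝ) (f : ℂ → ℂ) (z : ℂ) (n : ℕ) : ℝ :=
  ‖taylorCoeff f n‖ ^ p * ‖z‖ ^ ((n : ℝ) * p)

/-- `|z| + ∑_{n ≥ 2} |aₙ| |z|ⁿ + ∑_{n ≥ 2} |aₙ|ᵖ |z|ⁿᵖ`; both sums are re-indexed by `n + 2`. -/
noncomputable def bohrSum (p : ℝ) (f : ℂ → ℂ) (z : ℂ) : ℝ :=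
  ‖z‖ + ∑' n : ℕ, majorantTerm f z (n + 2) + ∑' n : ℕ, powerTerm p f z (n + 2)

/-- The distance from `f(0)` to the boundary of the image of the open unit disc. -/
noncomputable def boundaryDist (f : ℂ → ℂ) : ℝ :=
  infDist (f 0) (frontier (f '' ball 0 1))

/-- The left-hand side of the equation that determines the radius; both sums run over `n ≥ 2`. -/
noncomputable def radiusEquation (p r : ℝ) : ℝ :=
  (3 - r) * r / (3 * (1 - r))
    + ∑' n : ℕ, r ^ (n + 2) / (3 * ((n + 2 : ℕ) : ℝ) ^ 2)
    + ∑' n : ℕ, (2 / 3 + 1 / (3 * ((n + 2 : ℕ) : ℝ) ^ 2)) ^ p * r ^ (((n + 2 : ℕ) : ℝ) * p)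
    - 1 / 36 * (12 + Real.pi ^ 2)

/-! One function f₀, given by (z(zf₀')')' = (1+z)²/(1-z)⁴ and with coefficients 2/3 + 1/(3n²), is
extremal for both sides of the inequality. For every f in the class the left side is at most
`extremalSum p ‖z‖` and the distance is at least (12+π²)/36; f₀ attains both. The equation for the
radius says that these two bounds agree, and `extremalSum p` is strictly increasing.

Coefficients. After division of g by b = g'(0), one has (z(zf')')' = P·(zg')' with P(0) = 1 and
Re(λ̄P) > 0, where λ = b/|b|. The coefficients of g are at most 1 in modulus, those of P at most 2
(Carathéodory), and the Cauchy product gives `IsClassC3.norm_taylorCoeff_le`.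

Distance. This is the harder half: it rests on |f(z)| ≥ N₃(|z|) with N₃(r) = -f₀(-r). Put G = zg',
which is starlike, and F = z(zf')', so that F' = PG'. A minimum principle along the flow contracting
the image of G (`IsStarlikeFunction.le_norm_mul_re_div`) bounds |F| from below. The rotation λ
spoils the pointwise bound by `koebeMinor`: what is proved is `koebeMinor t` + (1 - Re λ)(2/5)(t² -
4t⁴), whose correction changes sign. Passing from F to zf' and then to f means dividing by t and
integrating, twice; the correction becomes (1 - Re λ)(t² - t⁴)/10 ≥ 0 and can be dropped.

Each integration (`growth_of_injOn`) needs univalence. It holds because zf' is close-to-convex with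
respect to g, and f with respect to the convex function k with zk' = g (Libera's lemma). The limit
of N₃ at 1 comes from ∑(-1)ⁿ/n² = -π²/12, and is the modulus of a boundary value of f₀ at -1. -/

/-! ### Univalent functions: critical points, inverses, open images. -/

/-- An analytic function that is injective on an open set has no critical point there. -/
theorem deriv_ne_zero_of_injOn {g : ℂ → ℂ} {U : Set ℂ} (hU : IsOpen U)
    (hg : DifferentiableOn ℂ g U) (hinj : Set.InjOn g U) {z₀ : ℂ} (hz₀ : z₀ ∈ U) :
    deriv g z₀ ≠ 0 := by
  intro hd
  have han : AnalyticAt ℂ g z₀ := hg.analyticAt (hU.mem_nhds hz₀)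
  have han' : AnalyticAt ℂ (fun z => g z - g z₀) z₀ := han.sub analyticAt_const
  have hne : ¬ ∀ᶠ z in nhds z₀, g z - g z₀ = 0 := by
    intro h
    have h2 : ∀ᶠ z in nhdsWithin z₀ {z₀}ᶜ, False := by
      filter_upwards [h.filter_mono nhdsWithin_le_nhds,
        Filter.Eventually.filter_mono nhdsWithin_le_nhds (hU.eventually_mem hz₀),
        self_mem_nhdsWithin] with z h1 h2 h3
      exact h3 (hinj h2 hz₀ (sub_eq_zero.mp h1))
    exact (Filter.NeBot.ne inferInstance) (Filter.eventually_false_iff_eq_bot.mp h2)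
  obtain ⟨n, h, hh, hh0, hfac⟩ := (han'.exists_eventuallyEq_pow_smul_nonzero_iff).mpr hne
  have hn0 : n ≠ 0 := by
    rintro rfl
    have := hfac.self_of_nhds
    simp at this
    exact hh0 this.symm
  have hn1 : n ≠ 1 := by
    rintro rfl
    have hd1 : deriv (fun z => g z - g z₀) z₀ = h z₀ := by
      rw [Filter.EventuallyEq.deriv_eq hfac]
      have : HasDerivAt (fun z => (z - z₀) ^ 1 • h z)
          (1 * h z₀ + (z₀ - z₀) * deriv h z₀) z₀ := by
        simpa using ((hasDerivAt_id' z₀).sub_const z₀).fun_mul hh.differentiableAt.hasDerivAt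
      rw [this.deriv]; simp
    rw [deriv_sub_const, hd] at hd1
    exact hh0 hd1.symm
  have hn2 : 2 ≤ n := by omega
  -- an analytic `n`-th root of `g - g z₀` near `z₀`
  set q : ℂ → ℂ := fun z => (z - z₀) * (h z / h z₀) ^ (1 / (n : ℂ)) with hq
  have hslit : h z₀ / h z₀ ∈ Complex.slitPlane := by
    rw [div_self hh0]; exact Complex.one_mem_slitPlane
  have hqan : AnalyticAt ℂ q z₀ :=
    (analyticAt_id.sub analyticAt_const).mul
      ((hh.div_const).cpow analyticAt_const hslit)
  have hqd : deriv q z₀ = 1 := by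
    have h1 : DifferentiableAt ℂ (fun z => (h z / h z₀) ^ (1 / (n : ℂ))) z₀ :=
      ((hh.div_const).cpow analyticAt_const hslit).differentiableAt
    have := ((hasDerivAt_id z₀).sub_const z₀).mul h1.hasDerivAt
    have h2 := this.deriv
    simp only [id] at h2
    rw [show q = ((fun z => z - z₀) * fun z => (h z / h z₀) ^ (1 / (n : ℂ))) from rfl]
    rw [h2, div_self hh0]; simp
  have hpow : ∀ᶠ z in nhds z₀, g z - g z₀ = q z ^ n * h z₀ := by
    have hc : ∀ᶠ z in nhds z₀, h z ≠ 0 := hh.continuousAt.eventually_ne hh0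
    filter_upwards [hfac, hc] with z hz1 hz2
    rw [hz1, hq]
    simp only [mul_pow, smul_eq_mul]
    rw [← Complex.cpow_nat_mul, mul_one_div_cancel (by exact_mod_cast hn0), Complex.cpow_one]
    field_simp
  have hmap : Filter.map q (nhds z₀) = nhds (q z₀) :=
    hqan.hasStrictDerivAt.map_nhds_eq (by rw [hqd]; exact one_ne_zero)
  have hq0 : q z₀ = 0 := by simp [hq]
  rw [hq0] at hmap
  have hset : {z | g z - g z₀ = q z ^ n * h z₀ ∧ z ∈ U} ∈ nhds z₀ := by
    filter_upwards [hpow, hU.mem_nhds hz₀] with z h1 h2 using ⟨h1, h2⟩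
  have himg : q '' {z | g z - g z₀ = q z ^ n * h z₀ ∧ z ∈ U} ∈ nhds (0 : ℂ) := by
    rw [← hmap]; exact Filter.image_mem_map hset
  obtain ⟨ε, hε, hball⟩ := Metric.mem_nhds_iff.mp himg
  -- With n ≥ 2, the root q takes both values ε/2 and ωε/2 in `U`. Their n-th powers agree, so g
  -- takes one value at two points.
  set ω : ℂ := Complex.exp (2 * Real.pi * Complex.I / n) with hω
  have hprim : IsPrimitiveRoot ω n := Complex.isPrimitiveRoot_exp n hn0
  have hωn : ‖ω‖ = 1 := hprim.norm'_eq_one hn0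
  have hω1 : ω ≠ 1 := hprim.ne_one (by omega)
  have ha : ((ε / 2 : ℝ) : ℂ) ∈ ball (0 : ℂ) ε := by
    simp [abs_of_pos hε]; linarith
  have hb : ((ε / 2 : ℝ) : ℂ) * ω ∈ ball (0 : ℂ) ε := by
    simp [abs_of_pos hε, hωn]; linarith
  obtain ⟨a, ⟨ha1, ha2⟩, ha3⟩ := hball ha
  obtain ⟨b, ⟨hb1, hb2⟩, hb3⟩ := hball hb
  have hab : g a = g b := by
    have : g a - g z₀ = g b - g z₀ := by
      rw [ha1, hb1, ha3, hb3, mul_pow, hprim.pow_eq_one, mul_one]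
    exact sub_left_injective this
  have := hinj ha2 hb2 hab
  rw [this, hb3] at ha3
  have he : ((ε / 2 : ℝ) : ℂ) ≠ 0 := by
    exact_mod_cast (half_pos hε).ne'
  exact hω1 (mul_left_cancel₀ he (by rw [ha3, mul_one]))

/-- The inverse of an injective analytic function, with its derivative. -/
theorem exists_leftInverse_hasDerivAt {g : ℂ → ℂ} {U : Set ℂ} (hU : IsOpen U)
    (hg : DifferentiableOn ℂ g U) (hinj : Set.InjOn g U) :
    ∃ ψ : ℂ → ℂ, (∀ z ∈ U, ψ (g z) = z) ∧
      ∀ z ∈ U, HasDerivAt ψ (deriv g z)⁻¹ (g z) := by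
  classical
  refine ⟨Function.invFunOn g U, fun z hz => hinj.leftInvOn_invFunOn hz, fun z hz => ?_⟩
  have hd := deriv_ne_zero_of_injOn hU hg hinj hz
  have hs : HasStrictDerivAt g (deriv g z) z :=
    (hg.analyticAt (hU.mem_nhds hz)).hasStrictDerivAt
  have h2 := (hs.hasStrictFDerivAt_equiv hd).eventually_right_inverse
  have h3 := (hs.to_localInverse hd).hasDerivAt
  have hcont : ContinuousAt (hs.localInverse g (deriv g z) z hd) (g z) := h3.continuousAt
  have hval : hs.localInverse g (deriv g z) z hd (g z) = z :=
    (hs.hasStrictFDerivAt_equiv hd).localInverse_apply_image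
  have hmem : ∀ᶠ w in nhds (g z), hs.localInverse g (deriv g z) z hd w ∈ U := by
    apply hcont.eventually_mem
    rw [hval]; exact hU.mem_nhds hz
  refine h3.congr_of_eventuallyEq ?_
  filter_upwards [h2, hmem] with w hw1 hw2
  have : g (hs.localInverse g (deriv g z) z hd w) = w := hw1
  conv_lhs => rw [← this]
  exact hinj.leftInvOn_invFunOn hw2

/-- A nonconstant analytic function with no critical point maps open sets to open sets. -/
theorem isOpen_image_of_deriv_ne_zero {g : ℂ → ℂ} {U : Set ℂ} (hU : IsOpen U)
    (hg : DifferentiableOn ℂ g U) (hd : ∀ z ∈ U, deriv g z ≠ 0) : IsOpen (g '' U) := by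
  rw [isOpen_iff_mem_nhds]
  rintro _ ⟨z, hz, rfl⟩
  have hs : HasStrictDerivAt g (deriv g z) z :=
    (hg.analyticAt (hU.mem_nhds hz)).hasStrictDerivAt
  rw [← hs.map_nhds_eq (hd z hz)]
  exact Filter.image_mem_map (hU.mem_nhds hz)

/-- Every analytic function of the disc that vanishes at `0` is `z H'` for some analytic `H`. -/
theorem exists_mul_deriv_eq {F : ℂ → ℂ} (hF : DifferentiableOn ℂ F (ball 0 1)) (h0 : F 0 = 0) :
    ∃ H : ℂ → ℂ, DifferentiableOn ℂ H (ball 0 1) ∧ H 0 = 0 ∧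
      (∀ z ∈ ball (0 : ℂ) 1, z * deriv H z = F z) ∧ deriv H 0 = deriv F 0 := by
  have hnh : ball (0 : ℂ) 1 ∈ nhds (0 : ℂ) := ball_mem_nhds 0 one_pos
  have hds : DifferentiableOn ℂ (dslope F 0) (ball 0 1) :=
    (Complex.differentiableOn_dslope hnh).mpr hF
  obtain ⟨H, hH0, hH⟩ := (hds.isExactOn_ball).with_val_at 0 0
  refine ⟨H, fun z hz => (hH z hz).differentiableAt.differentiableWithinAt, hH0,
    fun z hz => ?_, ?_⟩
  · rw [(hH z hz).deriv]
    rcases eq_or_ne z 0 with rfl | hz0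
    · simp [h0]
    · rw [dslope_of_ne _ hz0, slope_def_field, h0]; field_simp; ring
  · rw [(hH 0 (mem_ball_self one_pos)).deriv, dslope_same]

theorem DifferentiableOn.zDeriv {f : ℂ → ℂ} (hf : DifferentiableOn ℂ f (ball 0 1)) :
    DifferentiableOn ℂ (zDeriv f) (ball 0 1) :=
  differentiableOn_id.mul (hf.deriv isOpen_ball)

/-! ### Sign conditions at minima, and the maximum principle. -/

/-- A right-hand minimum forces a nonnegative derivative. -/
theorem HasDerivAt.nonneg_of_eventually_le {m : ℝ → ℝ} {m' : ℝ} (h : HasDerivAt m m' 0)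
    (hle : ∀ᶠ t in nhdsWithin (0 : ℝ) (Set.Ioi 0), m 0 ≤ m t) : 0 ≤ m' := by
  have h1 := (hasDerivAt_iff_tendsto_slope.mp h).mono_left
    (nhdsWithin_mono 0 (fun t (ht : t ∈ Set.Ioi (0 : ℝ)) => (ne_of_gt ht : t ≠ 0)))
  refine ge_of_tendsto h1 ?_
  filter_upwards [hle, self_mem_nhdsWithin] with t ht1 ht2
  rw [slope_def_field]
  exact div_nonneg (by linarith) (by have : (0 : ℝ) < t := ht2; linarith)

/-- The second derivative is nonnegative at a global minimum. -/
theorem HasDerivAt.nonneg_of_second_order_min {S S₁ : ℝ → ℝ} {s : ℝ}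
    (h : ∀ t, HasDerivAt S (S₁ t) t) (h₁ : HasDerivAt S₁ s 0) (hmin : ∀ t, S 0 ≤ S t) :
    0 ≤ s := by
  by_contra! hs
  have h0 : S₁ 0 = 0 := by
    have : IsLocalMin S 0 := Filter.Eventually.of_forall hmin
    exact this.hasDerivAt_eq_zero (h 0)
  have h2 := (hasDerivAt_iff_tendsto_slope.mp h₁).mono_left
    (nhdsWithin_mono 0 (fun t (ht : t ∈ Set.Ioi (0 : ℝ)) => (ne_of_gt ht : t ≠ 0)))
  have h3 : ∀ᶠ t in nhdsWithin (0 : ℝ) (Set.Ioi 0), S₁ t < 0 := by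
    filter_upwards [h2.eventually_lt_const hs, self_mem_nhdsWithin] with t ht1 ht2
    have ht : (0 : ℝ) < t := ht2
    rw [slope_def_field, h0, sub_zero, sub_zero, div_lt_iff₀ ht] at ht1
    linarith
  obtain ⟨δ, hδ, hsub⟩ := (mem_nhdsGT_iff_exists_Ioo_subset).mp h3
  have hδ' : (0 : ℝ) < δ := hδ
  have hanti : StrictAntiOn S (Set.Icc 0 (δ / 2)) := by
    apply strictAntiOn_of_deriv_neg (convex_Icc _ _)
    · exact fun t _ => (h t).continuousAt.continuousWithinAt
    · intro t ht
      rw [interior_Icc] at ht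
      rw [(h t).deriv]
      exact hsub ⟨ht.1, by linarith [ht.2]⟩
  have := hanti (Set.left_mem_Icc.mpr (by linarith)) (Set.right_mem_Icc.mpr (by linarith))
    (by linarith)
  linarith [hmin (δ / 2)]

/-- An analytic function of the disc with nonnegative real part has positive real part as soon as
it does at the origin. -/
theorem re_pos_of_re_nonneg {q : ℂ → ℂ} (hq : DifferentiableOn ℂ q (ball 0 1))
    (hre : ∀ z ∈ ball (0 : ℂ) 1, 0 ≤ (q z).re) (h0 : 0 < (q 0).re) {z : ℂ}
    (hz : z ∈ ball (0 : ℂ) 1) : 0 < (q z).re := by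
  refine lt_of_le_of_ne (hre z hz) fun heq => ?_
  -- A zero of Re q is a maximum of |exp(-q)|, which would then be constant, against Re q(0) > 0.
  have hd : DifferentiableOn ℂ (fun w => Complex.exp (-q w)) (ball 0 1) := hq.neg.cexp
  have hmax : IsMaxOn (norm ∘ fun w => Complex.exp (-q w)) (ball 0 1) z := by
    intro w hw
    simp only [Set.mem_ofPred_eq, Function.comp, Complex.norm_exp, Complex.neg_re, ← heq]
    exact Real.exp_le_exp.mpr (by linarith [hre w hw])
  have := Complex.norm_eqOn_of_isPreconnected_of_isMaxOn (convex_ball (0 : ℂ) 1).isPreconnected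
    isOpen_ball hd hz hmax (mem_ball_self one_pos)
  simp only [Function.comp, Function.const_apply, Complex.norm_exp, Complex.neg_re, ← heq] at this
  have := Real.exp_injective this
  linarith

/-! ### Functions with values in a half-plane. -/

/-- Functions with values in a half-plane whose boundary passes through the origin, written through
the Schwarz lemma. -/
theorem exists_schwarz_of_re_pos {P : ℂ → ℂ} {lam : ℂ} (hlam : ‖lam‖ = 1) (hx : 0 < lam.re)
    (hP : DifferentiableOn ℂ P (ball 0 1)) (hP0 : P 0 = 1)
    (hre : ∀ z ∈ ball (0 : ℂ) 1, 0 < ((starRingEnd ℂ) lam * P z).re) {z : ℂ}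
    (hz : z ∈ ball (0 : ℂ) 1) :
    ∃ w : ℂ, ‖w‖ ≤ ‖z‖ ∧ P z * (1 - w) = 1 + lam ^ 2 * w := by
  have hll : lam.re ^ 2 + lam.im ^ 2 = 1 := by
    have := Complex.sq_norm lam
    rw [hlam, Complex.normSq_apply] at this; nlinarith
  have hcl : (starRingEnd ℂ) lam * lam = 1 := by
    rw [mul_comm, Complex.mul_conj, ← Complex.sq_norm, hlam]; norm_num
  have hne : ∀ z ∈ ball (0 : ℂ) 1, P z + lam ^ 2 ≠ 0 := by
    intro z hz h
    have h1 : (starRingEnd ℂ) lam * P z + lam = 0 := by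
      have : (starRingEnd ℂ) lam * (P z + lam ^ 2) = 0 := by rw [h, mul_zero]
      rw [← this]; linear_combination (-lam) * hcl
    have h2 := congrArg Complex.re h1
    simp only [Complex.add_re, Complex.zero_re] at h2
    linarith [hre z hz]
  -- -λ² is the mirror image of 1 in the boundary line, so this Möbius map takes the half-plane to
  -- the unit disc and 1 to 0.
  set ω : ℂ → ℂ := fun z => (P z - 1) / (P z + lam ^ 2) with hω
  have hωd : DifferentiableOn ℂ ω (ball 0 1) := (hP.sub_const 1).div (hP.add_const _) hne
  have hmaps : Set.MapsTo ω (ball 0 1) (closedBall 0 1) := by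
    intro z hz
    rw [mem_closedBall_zero_iff, hω]
    simp only [norm_div]
    rw [div_le_one (norm_pos_iff.mpr (hne z hz))]
    have h1 := hre z hz
    simp only [Complex.mul_re, Complex.conj_re, Complex.conj_im] at h1
    apply le_of_sq_le_sq _ (norm_nonneg _)
    rw [Complex.sq_norm, Complex.sq_norm, Complex.normSq_apply, Complex.normSq_apply]
    simp only [Complex.sub_re, Complex.sub_im, Complex.add_re, Complex.add_im, Complex.one_re,
      Complex.one_im, pow_two, Complex.mul_re, Complex.mul_im]
    have h2 := mul_pos hx h1
    linear_combination 4 * h2 + (2 * (P z).re - (lam.re ^ 2 + lam.im ^ 2) - 1) * hll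
  have h0 : ω 0 = 0 := by simp [hω, hP0]
  refine ⟨ω z, Complex.norm_le_norm_of_mapsTo_ball hωd hmaps h0 (mem_ball_zero_iff.mp hz), ?_⟩
  have := hne z hz
  simp only [hω]
  field_simp
  ring

/-- The vector on the left is 2(w - ρ²), and |w - ρ²| ≤ ρ|1 - w| is the Apollonius form of |w| ≤ ρ.
-/
theorem norm_disc_of_schwarz {w : ℂ} {ρ : ℝ} (hw : ‖w‖ ≤ ρ) (hρ : ρ < 1) :
    ‖2 * w * (1 - ρ ^ 2) - 2 * ρ ^ 2 * (1 - w)‖ ≤ 2 * ρ * ‖1 - w‖ := by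
  have hρ0 : 0 ≤ ρ := (norm_nonneg w).trans hw
  apply le_of_sq_le_sq _ (by positivity)
  have hw2 : w.re ^ 2 + w.im ^ 2 ≤ ρ ^ 2 := by
    have := Complex.sq_norm w
    rw [Complex.normSq_apply] at this
    nlinarith [norm_nonneg w]
  have e : (2 * w * (1 - (ρ : ℂ) ^ 2) - 2 * (ρ : ℂ) ^ 2 * (1 - w)) = 2 * (w - ((ρ ^ 2 : ℝ) : ℂ)) := by
    push_cast; ring
  rw [e, norm_mul, mul_pow, mul_pow, Complex.sq_norm (w - _), Complex.sq_norm (1 - w),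
    Complex.normSq_apply, Complex.normSq_apply]
  simp only [Complex.sub_re, Complex.sub_im, Complex.ofReal_re, Complex.ofReal_im, Complex.one_re,
    Complex.one_im, Complex.norm_ofNat]
  nlinarith [mul_nonneg (sub_nonneg.mpr hw2) (by nlinarith : (0:ℝ) ≤ 1 - ρ ^ 2)]

section HalfPlane

variable {P : ℂ → ℂ} {lam : ℂ}

/-- With x = Re λ, this places P z in the disc with centre 1 + 2|z|²xλ/(1-|z|²) and radius
2|z|x/(1-|z|²). Projecting the disc on the directions 1 and λ gives the two lower bounds that
follow. -/
theorem exists_disc_of_re_pos (hlam : ‖lam‖ = 1) (hx : 0 < lam.re)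
    (hP : DifferentiableOn ℂ P (ball 0 1)) (hP0 : P 0 = 1)
    (hre : ∀ z ∈ ball (0 : ℂ) 1, 0 < ((starRingEnd ℂ) lam * P z).re) {z : ℂ}
    (hz : z ∈ ball (0 : ℂ) 1) :
    ∃ e : ℂ, ‖e‖ ≤ 2 * ‖z‖ ∧
      (1 - (‖z‖ : ℂ) ^ 2) * P z = (1 - (‖z‖ : ℂ) ^ 2) + lam.re * lam * (2 * (‖z‖ : ℂ) ^ 2 + e) := by
  obtain ⟨w, hw, hPw⟩ := exists_schwarz_of_re_pos hlam hx hP hP0 hre hz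
  have hz1 : ‖z‖ < 1 := mem_ball_zero_iff.mp hz
  have hw1 : 1 - w ≠ 0 := by
    intro h
    have : w = 1 := (sub_eq_zero.mp h).symm
    rw [this] at hw; simp at hw; linarith
  have hcl : (starRingEnd ℂ) lam * lam = 1 := by
    rw [mul_comm, Complex.mul_conj, ← Complex.sq_norm, hlam]; norm_num
  have hl2 : 1 + lam ^ 2 = 2 * lam.re * lam := by
    have : (lam.re : ℂ) = (lam + (starRingEnd ℂ) lam) / 2 := Complex.re_eq_add_conj lam
    rw [this]; linear_combination (-1) * hcl
  refine ⟨(2 * w * (1 - (‖z‖ : ℂ) ^ 2) - 2 * (‖z‖ : ℂ) ^ 2 * (1 - w)) / (1 - w), ?_, ?_⟩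
  · rw [norm_div, div_le_iff₀ (norm_pos_iff.mpr hw1)]
    exact norm_disc_of_schwarz hw hz1
  · field_simp
    linear_combination (1 - (‖z‖ : ℂ) ^ 2) * hPw + (1 - (‖z‖ : ℂ) ^ 2) * w * hl2

theorem re_ge_of_re_pos (hlam : ‖lam‖ = 1) (hx : 0 < lam.re)
    (hP : DifferentiableOn ℂ P (ball 0 1)) (hP0 : P 0 = 1)
    (hre : ∀ z ∈ ball (0 : ℂ) 1, 0 < ((starRingEnd ℂ) lam * P z).re) {z : ℂ}
    (hz : z ∈ ball (0 : ℂ) 1) :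
    1 - ‖z‖ ^ 2 - 2 * ‖z‖ * lam.re * (1 - ‖z‖ * lam.re) ≤ (1 - ‖z‖ ^ 2) * (P z).re := by
  obtain ⟨e, he, h⟩ := exists_disc_of_re_pos hlam hx hP hP0 hre hz
  have h1 := congrArg Complex.re h
  have c1 : (1 - (‖z‖ : ℂ) ^ 2) = ((1 - ‖z‖ ^ 2 : ℝ) : ℂ) := by push_cast; ring
  have c2 : (lam.re : ℂ) * lam * (2 * (‖z‖ : ℂ) ^ 2 + e)
      = ((2 * ‖z‖ ^ 2 * lam.re : ℝ) : ℂ) * lam + (lam.re : ℂ) * (lam * e) := by push_cast; ring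
  rw [c1, c2, Complex.re_ofReal_mul, Complex.add_re, Complex.add_re, Complex.re_ofReal_mul,
    Complex.re_ofReal_mul, Complex.ofReal_re] at h1
  rw [h1]
  have h2 : -(2 * ‖z‖) ≤ (lam * e).re := by
    have := Complex.abs_re_le_norm (lam * e)
    rw [norm_mul, hlam, one_mul] at this
    linarith [neg_abs_le (lam * e).re]
  nlinarith [mul_le_mul_of_nonneg_left h2 hx.le]

theorem re_conj_mul_ge_of_re_pos (hlam : ‖lam‖ = 1) (hx : 0 < lam.re)
    (hP : DifferentiableOn ℂ P (ball 0 1)) (hP0 : P 0 = 1)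
    (hre : ∀ z ∈ ball (0 : ℂ) 1, 0 < ((starRingEnd ℂ) lam * P z).re) {z : ℂ}
    (hz : z ∈ ball (0 : ℂ) 1) :
    lam.re * (1 - ‖z‖) ≤ (1 + ‖z‖) * ((starRingEnd ℂ) lam * P z).re := by
  obtain ⟨e, he, h⟩ := exists_disc_of_re_pos hlam hx hP hP0 hre hz
  have hz1 : ‖z‖ < 1 := mem_ball_zero_iff.mp hz
  have hcl : (starRingEnd ℂ) lam * lam = 1 := by
    rw [mul_comm, Complex.mul_conj, ← Complex.sq_norm, hlam]; norm_num
  have h1 := congrArg (fun v => ((starRingEnd ℂ) lam * v).re) h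
  have c1 : (starRingEnd ℂ) lam * ((1 - (‖z‖ : ℂ) ^ 2) * P z)
      = ((1 - ‖z‖ ^ 2 : ℝ) : ℂ) * ((starRingEnd ℂ) lam * P z) := by push_cast; ring
  have c2 : (starRingEnd ℂ) lam * ((1 - (‖z‖ : ℂ) ^ 2) + lam.re * lam * (2 * (‖z‖ : ℂ) ^ 2 + e))
      = ((1 - ‖z‖ ^ 2 : ℝ) : ℂ) * (starRingEnd ℂ) lam
        + (lam.re : ℂ) * (((2 * ‖z‖ ^ 2 : ℝ) : ℂ) + e) := by
    push_cast
    linear_combination (lam.re : ℂ) * (2 * (‖z‖ : ℂ) ^ 2 + e) * hcl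
  simp only [c1, c2] at h1
  rw [Complex.re_ofReal_mul, Complex.add_re, Complex.re_ofReal_mul, Complex.re_ofReal_mul,
    Complex.add_re, Complex.ofReal_re, Complex.conj_re] at h1
  have h2 : -(2 * ‖z‖) ≤ e.re := by
    have := Complex.abs_re_le_norm e
    linarith [neg_abs_le e.re]
  have h3 : lam.re * (1 - ‖z‖) * (1 - ‖z‖)
      ≤ (1 + ‖z‖) * ((starRingEnd ℂ) lam * P z).re * (1 - ‖z‖) := by
    nlinarith [mul_le_mul_of_nonneg_left h2 hx.le]
  exact le_of_mul_le_mul_right h3 (by linarith)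

/-- The lower Harnack bound in the disc. -/
theorem re_ge_of_re_pos_of_eq_one {q : ℂ → ℂ} (hq : DifferentiableOn ℂ q (ball 0 1))
    (hq0 : q 0 = 1) (hre : ∀ z ∈ ball (0 : ℂ) 1, 0 < (q z).re) {z : ℂ}
    (hz : z ∈ ball (0 : ℂ) 1) : 1 - ‖z‖ ≤ (1 + ‖z‖) * (q z).re := by
  simpa using re_conj_mul_ge_of_re_pos (lam := 1) (by simp) (by simp) hq hq0
    (by simpa using hre) hz

end HalfPlane

/-! ### Starlike functions. -/

/-- Normalized starlike functions of the disc. -/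
structure IsStarlikeFunction (D : ℂ → ℂ) : Prop where
  analytic : DifferentiableOn ℂ D (ball 0 1)
  map_zero : D 0 = 0
  deriv_zero : deriv D 0 = 1
  ne_zero : ∀ z ∈ ball (0 : ℂ) 1, z ≠ 0 → D z ≠ 0
  re_pos : ∀ z ∈ ball (0 : ℂ) 1, z ≠ 0 → 0 < (z * deriv D z / D z).re

namespace IsStarlikeFunction

variable {D : ℂ → ℂ}

theorem dslope_ne_zero (hD : IsStarlikeFunction D) {z : ℂ} (hz : z ∈ ball (0 : ℂ) 1) :
    dslope D 0 z ≠ 0 := by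
  rcases eq_or_ne z 0 with rfl | h
  · simp [hD.deriv_zero]
  · rw [dslope_of_ne _ h, slope_def_field, hD.map_zero]
    exact div_ne_zero (by simpa using hD.ne_zero z hz h) (by simpa using h)

theorem mul_dslope (hD : IsStarlikeFunction D) (z : ℂ) : z * dslope D 0 z = D z := by
  have := sub_smul_dslope D 0 z
  simpa [hD.map_zero] using this

theorem differentiableOn_dslope (hD : IsStarlikeFunction D) :
    DifferentiableOn ℂ (dslope D 0) (ball 0 1) :=
  (Complex.differentiableOn_dslope (ball_mem_nhds 0 one_pos)).mpr hD.analytic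

theorem mul_deriv_div (hD : IsStarlikeFunction D) {z : ℂ} (h : z ≠ 0) :
    z * deriv D z / D z = deriv D z / dslope D 0 z := by
  rw [← hD.mul_dslope z, mul_div_mul_left _ _ h]

theorem re_deriv_div_dslope_pos (hD : IsStarlikeFunction D) {z : ℂ} (hz : z ∈ ball (0 : ℂ) 1) :
    0 < (deriv D z / dslope D 0 z).re := by
  rcases eq_or_ne z 0 with rfl | h
  · simp [hD.deriv_zero]
  · rw [← hD.mul_deriv_div h]; exact hD.re_pos z hz h

theorem deriv_ne_zero (hD : IsStarlikeFunction D) {z : ℂ} (hz : z ∈ ball (0 : ℂ) 1) :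
    deriv D z ≠ 0 := by
  intro h
  have := hD.re_deriv_div_dslope_pos hz
  rw [h] at this; simp at this

theorem harnack (hD : IsStarlikeFunction D) {z : ℂ} (hz : z ∈ ball (0 : ℂ) 1) :
    1 - ‖z‖ ≤ (1 + ‖z‖) * (deriv D z / dslope D 0 z).re :=
  re_ge_of_re_pos_of_eq_one (q := fun z => deriv D z / dslope D 0 z)
    ((hD.analytic.deriv isOpen_ball).div hD.differentiableOn_dslope
      (fun _ h => hD.dslope_ne_zero h)) (by simp [hD.deriv_zero])
    (fun _ h => hD.re_deriv_div_dslope_pos h) hz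

/-- The lower growth bound for starlike functions. -/
theorem growth (hD : IsStarlikeFunction D) {z : ℂ} (hz : z ∈ ball (0 : ℂ) 1) :
    ‖z‖ ≤ ‖D z‖ * (1 + ‖z‖) ^ 2 := by
  rcases eq_or_ne z 0 with rfl | hz0
  · simp
  have hρ0 : 0 < ‖z‖ := norm_pos_iff.mpr hz0
  have hρ1 : ‖z‖ < 1 := mem_ball_zero_iff.mp hz
  set e : ℂ := z / ‖z‖ with he
  have hen : ‖e‖ = 1 := by rw [he, norm_div, Complex.norm_real, norm_norm, div_self hρ0.ne']
  set E := dslope D 0 with hE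
  have hmem : ∀ t : ℝ, 0 ≤ t → t < 1 → (t : ℂ) * e ∈ ball (0 : ℂ) 1 := by
    intro t h0 h1
    rw [mem_ball_zero_iff, norm_mul, hen, mul_one, Complex.norm_real, Real.norm_of_nonneg h0]
    exact h1
  have hder : ∀ t : ℝ, 0 ≤ t → t < 1 → HasDerivAt
      (fun t : ℝ => ‖E (t * e)‖ ^ 2 * (1 + t) ^ 4)
      (2 * inner ℝ (E (t * e)) (e * deriv E (t * e)) * (1 + t) ^ 4
        + ‖E (t * e)‖ ^ 2 * (4 * (1 + t) ^ 3)) t := by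
    intro t h0 h1
    have hEd : HasDerivAt E (deriv E (t * e)) ((t : ℂ) * e) :=
      (hD.differentiableOn_dslope.differentiableAt
        (isOpen_ball.mem_nhds (hmem t h0 h1))).hasDerivAt
    have hl : HasDerivAt (fun s : ℝ => (s : ℂ) * e) (1 * e) t :=
      (Complex.ofRealCLM.hasDerivAt (x := t)).mul_const e
    have hc : HasDerivAt (fun s : ℝ => E (s * e)) (e * deriv E (t * e)) t := by
      have := hEd.comp_of_eq t hl rfl
      convert! this using 1
      ring
    have h2 : HasDerivAt (fun s : ℝ => (1 + s) ^ 4) (4 * (1 + t) ^ 3) t := by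
      have := ((hasDerivAt_id' t).const_add 1).fun_pow 4
      simpa using this
    exact hc.norm_sq.mul h2
  -- Harnack's bound for zD'/D = 1 + zE'/E is exactly the statement that this function does not
  -- decrease along the ray; it starts at E(0) = 1.
  have hmono : MonotoneOn (fun t : ℝ => ‖E (t * e)‖ ^ 2 * (1 + t) ^ 4) (Set.Icc 0 ‖z‖) := by
    apply monotoneOn_of_deriv_nonneg (convex_Icc _ _)
    · exact fun t ht => (hder t ht.1 (ht.2.trans_lt hρ1)).continuousAt.continuousWithinAt
    · intro t ht
      rw [interior_Icc] at ht
      exact (hder t ht.1.le (ht.2.trans hρ1)).differentiableAt.differentiableWithinAt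
    · intro t ht
      rw [interior_Icc] at ht
      have ht1 := ht.2.trans hρ1
      rw [(hder t ht.1.le ht1).deriv]
      have hm := hmem t ht.1.le ht1
      set ζ : ℂ := t * e with hζ
      have hζn : ‖ζ‖ = t := by
        rw [hζ, norm_mul, hen, mul_one, Complex.norm_real, Real.norm_of_nonneg ht.1.le]
      have hEne : E ζ ≠ 0 := hD.dslope_ne_zero hm
      have hh := hD.harnack hm
      rw [hζn] at hh
      have hprod : deriv D ζ = E ζ + ζ * deriv E ζ := by
        have h1 : D = fun w => w * E w := funext fun w => (hD.mul_dslope w).symm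
        have h2 : HasDerivAt E (deriv E ζ) ζ :=
          (hD.differentiableOn_dslope.differentiableAt (isOpen_ball.mem_nhds hm)).hasDerivAt
        have h3 := ((hasDerivAt_id' ζ).fun_mul h2).deriv
        rw [← h1] at h3
        rw [h3]; ring
      have hq : deriv D ζ / E ζ = 1 + (t : ℂ) * (e * deriv E ζ / E ζ) := by
        rw [hprod, add_div, div_self hEne]; simp only [hζ]; ring
      have hin : inner ℝ (E ζ) (e * deriv E ζ) = ‖E ζ‖ ^ 2 * (e * deriv E ζ / E ζ).re := by
        rw [Complex.inner, Complex.sq_norm, ← Complex.re_ofReal_mul, Complex.normSq_eq_conj_mul_self]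
        congr 1
        field_simp
      rw [hq, Complex.add_re, Complex.re_ofReal_mul, Complex.one_re] at hh
      rw [hin]
      set y := (e * deriv E ζ / E ζ).re
      have hy : 0 ≤ (1 + t) * y + 2 := by
        have : 0 ≤ t * ((1 + t) * y + 2) := by nlinarith
        exact nonneg_of_mul_nonneg_right this ht.1
      have : 2 * (‖E ζ‖ ^ 2 * y) * (1 + t) ^ 4 + ‖E ζ‖ ^ 2 * (4 * (1 + t) ^ 3)
          = 2 * ‖E ζ‖ ^ 2 * (1 + t) ^ 3 * ((1 + t) * y + 2) := by ring
      rw [this]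
      have := ht.1
      positivity
  have h1 := hmono (Set.left_mem_Icc.mpr hρ0.le) (Set.right_mem_Icc.mpr hρ0.le) hρ0.le
  have hze : (‖z‖ : ℂ) * e = z := by
    have : (‖z‖ : ℂ) ≠ 0 := by exact_mod_cast hρ0.ne'
    rw [he]; field_simp
  have hE0 : E 0 = 1 := by rw [hE, dslope_same, hD.deriv_zero]
  simp only [Complex.ofReal_zero, zero_mul, hE0, norm_one, hze] at h1
  have h2 : 1 ≤ ‖E z‖ * (1 + ‖z‖) ^ 2 := by
    apply le_of_sq_le_sq _ (by positivity)
    calc (1 : ℝ) ^ 2 = 1 ^ 2 * (1 + 0) ^ 4 := by norm_num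
      _ ≤ _ := h1
      _ = _ := by ring
  rw [← hD.mul_dslope z, norm_mul, mul_assoc]
  nlinarith

end IsStarlikeFunction

/-! ### Convex functions: supporting lines and starlikeness. -/

namespace IsConvexFunction

variable {g : ℂ → ℂ}

theorem ne_zero (hg : IsConvexFunction g) {z : ℂ} (hz : z ∈ ball (0 : ℂ) 1) (h : z ≠ 0) :
    g z ≠ 0 := fun h' =>
  h (hg.univalent hz (mem_ball_self one_pos) (by rw [h', hg.map_zero]))

theorem deriv_ne_zero (hg : IsConvexFunction g) {z : ℂ} (hz : z ∈ ball (0 : ℂ) 1) :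
    deriv g z ≠ 0 :=
  deriv_ne_zero_of_injOn isOpen_ball hg.analytic hg.univalent hz

/-- The disc of radius `‖z‖` is mapped into the half-plane supported at `g z`. -/
theorem support (hg : IsConvexFunction g) {z ζ : ℂ} (hz : z ∈ ball (0 : ℂ) 1) (h0 : z ≠ 0)
    (hζ : ‖ζ‖ ≤ ‖z‖) : 0 ≤ ((g z - g ζ) / (z * deriv g z)).re := by
  obtain ⟨ψ, hψ, hψ'⟩ := exists_leftInverse_hasDerivAt isOpen_ball hg.analytic hg.univalent
  have hz1 : ‖z‖ < 1 := mem_ball_zero_iff.mp hz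
  have hρ0 : 0 < ‖z‖ := norm_pos_iff.mpr h0
  have hquot : ‖ζ / z‖ ≤ 1 := by rw [norm_div, div_le_one hρ0]; exact hζ
  have hmem : ∀ w ∈ ball (0 : ℂ) 1, w * (ζ / z) ∈ ball (0 : ℂ) 1 := by
    intro w hw
    rw [mem_ball_zero_iff] at hw ⊢
    rw [norm_mul]
    nlinarith [norm_nonneg w]
  -- Subordination: φ(w) = (1-t)g(w) + t g(wζ/z) stays in the convex image and φ(0) = g(0), so the
  -- Schwarz lemma applies to ψ ∘ φ and is used at w = z.
  have key : ∀ t ∈ Set.Icc (0 : ℝ) 1, ‖ψ (g z + t * (g ζ - g z))‖ ≤ ‖z‖ := by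
    intro t ht
    set φ : ℂ → ℂ := fun w => g w + t * (g (w * (ζ / z)) - g w) with hφ
    have hφm : ∀ w ∈ ball (0 : ℂ) 1, φ w ∈ g '' ball 0 1 := by
      intro w hw
      have := hg.convex_image (Set.mem_image_of_mem g hw) (Set.mem_image_of_mem g (hmem w hw))
        (sub_nonneg.mpr ht.2) ht.1 (by ring)
      convert this using 1
      simp only [hφ, Complex.real_smul]; push_cast; ring
    have hφd : DifferentiableOn ℂ φ (ball 0 1) := by
      have h2 : DifferentiableOn ℂ (fun w => g (w * (ζ / z))) (ball 0 1) :=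
        hg.analytic.comp (differentiableOn_id.mul_const _) hmem
      exact hg.analytic.add ((h2.sub hg.analytic).const_mul _)
    have hωd : DifferentiableOn ℂ (fun w => ψ (φ w)) (ball 0 1) := by
      intro w hw
      obtain ⟨v, hv, hv2⟩ := hφm w hw
      have h1 : DifferentiableAt ℂ ψ (φ w) := by
        rw [← hv2]; exact (hψ' v hv).differentiableAt
      exact (h1.comp w (hφd.differentiableAt (isOpen_ball.mem_nhds hw))).differentiableWithinAt
    have hmaps : Set.MapsTo (fun w => ψ (φ w)) (ball 0 1) (closedBall 0 1) := by
      intro w hw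
      obtain ⟨v, hv, hv2⟩ := hφm w hw
      simp only
      rw [← hv2, hψ v hv]
      exact ball_subset_closedBall hv
    have h00 : ψ (φ 0) = 0 := by
      have : φ 0 = g 0 := by simp [hφ]
      rw [this, hψ 0 (mem_ball_self one_pos)]
    have := Complex.norm_le_norm_of_mapsTo_ball hωd hmaps h00 hz1
    have hzz : z * (ζ / z) = ζ := by field_simp
    simpa [hφ, hzz] using this
  have hc : HasDerivAt (fun t : ℝ => ψ (g z + t * (g ζ - g z)))
      ((g ζ - g z) * (deriv g z)⁻¹) 0 := by
    have hl : HasDerivAt (fun t : ℝ => g z + (t : ℂ) * (g ζ - g z)) (g ζ - g z) 0 := by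
      have := ((Complex.ofRealCLM.hasDerivAt (x := (0 : ℝ))).mul_const (g ζ - g z)).const_add (g z)
      simpa using this
    have h1 : HasDerivAt ψ (deriv g z)⁻¹ (g z + ((0 : ℝ) : ℂ) * (g ζ - g z)) := by
      simpa using hψ' z hz
    have := h1.comp_of_eq (0 : ℝ) hl rfl
    convert! this using 1
    ring
  -- The squared modulus is largest at t = 0, so its derivative there is at most 0; up to the factor
  -- |z|² this is the claim.
  have hn := hc.norm_sq.neg
  have hneg := hn.nonneg_of_eventually_le (by
    filter_upwards [Ioo_mem_nhdsGT (zero_lt_one' ℝ)] with t ht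
    have h1 := key t ⟨ht.1.le, ht.2.le⟩
    have h2 : ψ (g z + ((0 : ℝ) : ℂ) * (g ζ - g z)) = z := by simpa using hψ z hz
    simp only [Pi.neg_apply, h2, neg_le_neg_iff]
    exact pow_le_pow_left₀ (norm_nonneg _) h1 2)
  have h2 : ψ (g z + ((0 : ℝ) : ℂ) * (g ζ - g z)) = z := by simpa using hψ z hz
  rw [h2, Complex.inner, mul_comm _ ((starRingEnd ℂ) z)] at hneg
  have hd := hg.deriv_ne_zero hz
  have hfin : (g z - g ζ) / (z * deriv g z)
      = (((‖z‖ ^ 2)⁻¹ : ℝ) : ℂ) * (-((starRingEnd ℂ) z * ((g ζ - g z) * (deriv g z)⁻¹))) := by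
    have : ((‖z‖ ^ 2 : ℝ) : ℂ) = (starRingEnd ℂ) z * z := by
      rw [Complex.sq_norm, Complex.normSq_eq_conj_mul_self]
    rw [Complex.ofReal_inv, this]
    have hcz : (starRingEnd ℂ) z ≠ 0 := by simpa using h0
    field_simp
    ring
  rw [hfin, Complex.re_ofReal_mul, Complex.neg_re]
  have : 0 ≤ (‖z‖ ^ 2)⁻¹ := by positivity
  apply mul_nonneg this
  linarith

theorem zDeriv_hasDerivAt (hg : IsConvexFunction g) {z : ℂ} (hz : z ∈ ball (0 : ℂ) 1) :
    HasDerivAt (zDeriv g) (deriv (zDeriv g) z) z :=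
  (hg.analytic.zDeriv.differentiableAt (isOpen_ball.mem_nhds hz)).hasDerivAt

theorem deriv_zDeriv_zero (hg : IsConvexFunction g) : deriv (zDeriv g) 0 = deriv g 0 := by
  have h : HasDerivAt (deriv g) (deriv (deriv g) 0) 0 :=
    ((hg.analytic.deriv isOpen_ball).differentiableAt (ball_mem_nhds 0 one_pos)).hasDerivAt
  have := ((hasDerivAt_id' (0 : ℂ)).fun_mul h).deriv
  rw [show zDeriv g = fun z => z * deriv g z from rfl, this]; simp

/-- The quotient is 1 + zg''/g'. By `support`, the distance of g(ζ) to the supporting line at g(z)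
has a minimum at ζ = z along the circle through z, and its second derivative there is the real part
in question. The value 1 at the origin makes the inequality strict. -/
theorem re_deriv_zDeriv_div_pos (hg : IsConvexFunction g) {z : ℂ} (hz : z ∈ ball (0 : ℂ) 1) :
    0 < (deriv (zDeriv g) z / deriv g z).re := by
  refine re_pos_of_re_nonneg (q := fun z => deriv (zDeriv g) z / deriv g z)
    ((hg.analytic.zDeriv.deriv isOpen_ball).div (hg.analytic.deriv isOpen_ball)
      (fun _ h => hg.deriv_ne_zero h)) ?_ ?_ hz
  swap
  · simp only [hg.deriv_zDeriv_zero, div_self (hg.deriv_ne_zero (mem_ball_self one_pos)),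
      Complex.one_re, zero_lt_one]
  intro z hz
  rcases eq_or_ne z 0 with rfl | h0
  · simp [hg.deriv_zDeriv_zero, div_self (hg.deriv_ne_zero (mem_ball_self one_pos))]
  have hd := hg.deriv_ne_zero hz
  set ζ : ℝ → ℂ := fun θ => z * Complex.exp (θ * Complex.I) with hζ
  have hζn : ∀ θ, ‖ζ θ‖ = ‖z‖ := fun θ => by
    simp [hζ, Complex.norm_exp_ofReal_mul_I]
  have hζm : ∀ θ, ζ θ ∈ ball (0 : ℂ) 1 := fun θ => by
    rw [mem_ball_zero_iff, hζn]; exact mem_ball_zero_iff.mp hz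
  have hζ0 : ζ 0 = z := by simp [hζ]
  have hζd : ∀ θ, HasDerivAt ζ (ζ θ * Complex.I) θ := by
    intro θ
    have h1 : HasDerivAt (fun s : ℝ => (s : ℂ) * Complex.I) (1 * Complex.I) θ :=
      (Complex.ofRealCLM.hasDerivAt (x := θ)).mul_const _
    have := (h1.cexp).const_mul z
    convert! this using 1
    simp only [hζ]; ring
  set S : ℝ → ℝ := fun θ => ((g z - g (ζ θ)) / (z * deriv g z)).re with hS
  set S₁ : ℝ → ℝ := fun θ => (-(Complex.I * zDeriv g (ζ θ)) / (z * deriv g z)).re with hS₁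
  have hSd : ∀ θ, HasDerivAt S (S₁ θ) θ := by
    intro θ
    have h1 : HasDerivAt g (deriv g (ζ θ)) (ζ θ) :=
      (hg.analytic.differentiableAt (isOpen_ball.mem_nhds (hζm θ))).hasDerivAt
    have h2 := ((h1.comp_of_eq θ (hζd θ) rfl).const_sub (g z)).div_const (z * deriv g z)
    have h3 := Complex.reCLM.hasFDerivAt.comp_hasDerivAt θ h2
    convert! h3 using 1
    simp only [hS₁, Complex.reCLM_apply, zDeriv]
    congr 2; ring
  have hS1d : HasDerivAt S₁ ((deriv (zDeriv g) z / deriv g z).re) 0 := by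
    have h1 : HasDerivAt (zDeriv g) (deriv (zDeriv g) z) (ζ 0) := by
      rw [hζ0]; exact hg.zDeriv_hasDerivAt hz
    have h2 := (((h1.comp_of_eq (0 : ℝ) (hζd 0) rfl).const_mul Complex.I).neg).div_const
      (z * deriv g z)
    have h3 := Complex.reCLM.hasFDerivAt.comp_hasDerivAt (0 : ℝ) h2
    convert! h3 using 1
    simp only [Complex.reCLM_apply, hζ0]
    congr 1
    field_simp
    linear_combination (deriv (zDeriv g) z) * Complex.I_sq
  refine HasDerivAt.nonneg_of_second_order_min hSd hS1d fun θ => ?_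
  have h1 : S 0 = 0 := by simp [hS, hζ0]
  rw [h1]
  exact hg.support hz h0 (hζn θ).le

/-- `support` with ζ = 0 says Re(g/(zg')) ≥ 0, and inversion preserves the sign of the real part. -/
theorem isStarlike (hg : IsConvexFunction g) (h1 : deriv g 0 = 1) : IsStarlikeFunction g where
  analytic := hg.analytic
  map_zero := hg.map_zero
  deriv_zero := h1
  ne_zero _ := hg.ne_zero
  re_pos := by
    have hds : DifferentiableOn ℂ (dslope g 0) (ball 0 1) :=
      (Complex.differentiableOn_dslope (ball_mem_nhds 0 one_pos)).mpr hg.analytic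
    have heq : ∀ z, z ≠ 0 → z * deriv g z / g z = deriv g z / dslope g 0 z := by
      intro z h
      have := sub_smul_dslope g 0 z
      simp only [sub_zero, hg.map_zero, smul_eq_mul] at this
      rw [← this, mul_div_mul_left _ _ h]
    have hne : ∀ z ∈ ball (0 : ℂ) 1, dslope g 0 z ≠ 0 := by
      intro z hz
      rcases eq_or_ne z 0 with rfl | h
      · simp [h1]
      · rw [dslope_of_ne _ h, slope_def_field, hg.map_zero]
        exact div_ne_zero (by simpa using hg.ne_zero hz h) (by simpa using h)
    intro z hz h
    rw [heq z h]
    refine re_pos_of_re_nonneg (q := fun z => deriv g z / dslope g 0 z)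
      ((hg.analytic.deriv isOpen_ball).div hds hne) ?_ (by simp [h1]) hz
    intro z hz
    rcases eq_or_ne z 0 with rfl | h
    · simp [h1]
    · rw [← heq z h]
      have := hg.support hz h (ζ := 0) (by simp)
      rw [hg.map_zero, sub_zero] at this
      rw [← inv_div, Complex.inv_re]
      exact div_nonneg this (Complex.normSq_nonneg _)

/-- Alexander's theorem: for D = zg' the quotient zD'/D is (zg')'/g'. -/
theorem isStarlike_zDeriv (hg : IsConvexFunction g) (h1 : deriv g 0 = 1) :
    IsStarlikeFunction (zDeriv g) where
  analytic := hg.analytic.zDeriv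
  map_zero := by simp [zDeriv]
  deriv_zero := by rw [hg.deriv_zDeriv_zero, h1]
  ne_zero _ hz h := mul_ne_zero h (hg.deriv_ne_zero hz)
  re_pos z hz h := by
    have := hg.re_deriv_zDeriv_div_pos hz
    rwa [zDeriv, mul_div_mul_left _ _ h]

/-- Rescaling by the first coefficient. -/
theorem normalize (hg : IsConvexFunction g) :
    IsConvexFunction (fun z => (deriv g 0)⁻¹ * g z) ∧
      deriv (fun z => (deriv g 0)⁻¹ * g z) 0 = 1 := by
  have hd := hg.deriv_ne_zero (mem_ball_self one_pos)
  have h1 : deriv (fun z => (deriv g 0)⁻¹ * g z) 0 = 1 := by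
    rw [deriv_const_mul_field, inv_mul_cancel₀ hd]
  refine ⟨⟨hg.analytic.const_mul _, by simp [hg.map_zero], by rw [h1]; simp, ?_, ?_⟩, h1⟩
  · intro a ha b hb hab
    exact hg.univalent ha hb (mul_left_cancel₀ (inv_ne_zero hd) hab)
  · have := hg.convex_image.linear_image
      ((LinearMap.mulLeft ℂ (deriv g 0)⁻¹).restrictScalars ℝ)
    rw [Set.image_image] at this
    exact this

end IsConvexFunction

/-! ### A minimum principle for quotients with starlike denominator. -/

/-- The derivative of the modulus along a curve. -/
theorem HasDerivAt.norm_of_ne_zero {c : ℝ → ℂ} {c' : ℂ} {t : ℝ} (hc : HasDerivAt c c' t)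
    (h0 : c t ≠ 0) : HasDerivAt (fun s => ‖c s‖) (‖c t‖ * (c' / c t).re) t := by
  have hn : ‖c t‖ ≠ 0 := norm_ne_zero_iff.mpr h0
  have h1 := hc.norm_sq.sqrt (by positivity)
  have h2 : (fun s => Real.sqrt (‖c s‖ ^ 2)) = fun s => ‖c s‖ :=
    funext fun s => Real.sqrt_sq (norm_nonneg _)
  rw [h2, Real.sqrt_sq (norm_nonneg _)] at h1
  convert! h1 using 1
  have h3 : (starRingEnd ℂ) (c t) * c' = ((‖c t‖ ^ 2 : ℝ) : ℂ) * (c' / c t) := by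
    rw [Complex.sq_norm, Complex.normSq_eq_conj_mul_self]; field_simp
  rw [Complex.inner, mul_comm c', h3, Complex.re_ofReal_mul]
  field_simp

namespace IsStarlikeFunction

variable {D : ℂ → ℂ}

theorem re_inv_pos (hD : IsStarlikeFunction D) {z : ℂ} (hz : z ∈ ball (0 : ℂ) 1) (h0 : z ≠ 0) :
    0 < (D z / (z * deriv D z)).re := by
  rw [← inv_div, Complex.inv_re]
  have h := hD.re_pos z hz h0
  refine div_pos h (Complex.normSq_pos.mpr fun h' => ?_)
  rw [h'] at h; simp at h

/-- A minimum principle along the flow that contracts the image of a starlike function. -/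
theorem le_norm_mul_re_div (hD : IsStarlikeFunction D) {N : ℂ → ℂ}
    (hN : DifferentiableOn ℂ N (ball 0 1)) (hN0 : N 0 = 0) {r : ℝ} (hr : r < 1)
    {Φ Φ' : ℝ → ℝ} (hΦ0 : Φ 0 = 0) (hΦc : ContinuousOn Φ (Set.Icc 0 r))
    (hΦ : ∀ t, 0 < t → t ≤ r → HasDerivAt Φ (Φ' t) t)
    (hle : ∀ z : ℂ, z ≠ 0 → ‖z‖ ≤ r →
      Φ' ‖z‖ * (‖z‖ * (D z / (z * deriv D z)).re) ≤ ‖D z‖ * (deriv N z / deriv D z).re)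
    {z : ℂ} (hz0 : z ≠ 0) (hz : ‖z‖ ≤ r) : Φ ‖z‖ ≤ ‖D z‖ * (N z / D z).re := by
  have hr0 : 0 ≤ r := (norm_nonneg z).trans hz
  have hsub : closedBall (0 : ℂ) r ⊆ ball 0 1 := closedBall_subset_ball hr
  set U : ℂ → ℝ := fun w => (dslope N 0 w / dslope D 0 w).re with hU
  have hUeq : ∀ w, w ≠ 0 → U w = (N w / D w).re := by
    intro w hw
    have h1 := sub_smul_dslope N 0 w
    simp only [sub_zero, hN0, smul_eq_mul] at h1
    simp only [hU]
    rw [← h1, ← hD.mul_dslope w, mul_div_mul_left _ _ hw]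
  have hUc : ContinuousOn U (closedBall 0 r) := by
    have h1 : DifferentiableOn ℂ (dslope N 0) (ball 0 1) :=
      (Complex.differentiableOn_dslope (ball_mem_nhds 0 one_pos)).mpr hN
    exact Complex.continuous_re.comp_continuousOn
      (((h1.div hD.differentiableOn_dslope fun _ h => hD.dslope_ne_zero h).continuousOn).mono hsub)
  have key : ∀ ε : ℝ, 0 < ε → Φ ‖z‖ ≤ ‖D z‖ * (U z + ε) := by
    intro ε hε
    -- A negative minimum of W would lie at some w ≠ 0, and there the term ε makes W strictly
    -- decrease along the flow.
    set W : ℂ → ℝ := fun w => ‖D w‖ * (U w + ε) - Φ ‖w‖ with hW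
    have hWc : ContinuousOn W (closedBall 0 r) := by
      refine (((hD.analytic.continuousOn.mono hsub).norm).mul (hUc.add continuousOn_const)).sub ?_
      exact hΦc.comp continuous_norm.continuousOn
        (fun w hw => ⟨norm_nonneg w, mem_closedBall_zero_iff.mp hw⟩)
    obtain ⟨w, hw, hmin⟩ := (isCompact_closedBall (0 : ℂ) r).exists_isMinOn
      ⟨0, mem_closedBall_self hr0⟩ hWc
    have hwr : ‖w‖ ≤ r := mem_closedBall_zero_iff.mp hw
    by_cases hWw : 0 ≤ W w
    · have := hmin (mem_closedBall_zero_iff.mpr hz)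
      simp only [Set.mem_ofPred_eq] at this
      have h2 : 0 ≤ W z := hWw.trans this
      simp only [hW] at h2
      linarith
    exfalso
    have hw0 : w ≠ 0 := by
      rintro rfl
      apply hWw
      simp [hW, hD.map_zero, hΦ0]
    have hwb := hsub hw
    have hDw := hD.ne_zero w hwb hw0
    have hD'w := hD.deriv_ne_zero hwb
    set v : ℂ := D w / (w * deriv D w) with hv
    have hvre : 0 < v.re := hD.re_inv_pos hwb hw0
    have hwn : 0 < ‖w‖ := norm_pos_iff.mpr hw0
    -- To first order D(c(t)) = (1-t)D(w), so the curve is tangent to the flow contracting the image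
    -- of D. As Re v > 0 it moves inward, hence stays where w is minimal.
    set c : ℝ → ℂ := fun t => w - t * (w * v) with hc
    have hc0 : c 0 = w := by simp [hc]
    have hcd : HasDerivAt c (-(w * v)) 0 := by
      have := ((Complex.ofRealCLM.hasDerivAt (x := (0 : ℝ))).mul_const (w * v)).const_sub w
      simpa using this
    have hcn : HasDerivAt (fun s => ‖c s‖) (-(‖w‖ * v.re)) 0 := by
      have := hcd.norm_of_ne_zero (by rw [hc0]; exact hw0)
      convert! this using 1
      rw [hc0, show -(w * v) / w = -v by field_simp]; simp
    have hDd : HasDerivAt D (deriv D w) (c 0) := by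
      rw [hc0]; exact (hD.analytic.differentiableAt (isOpen_ball.mem_nhds hwb)).hasDerivAt
    have hNd : HasDerivAt N (deriv N w) (c 0) := by
      rw [hc0]; exact (hN.differentiableAt (isOpen_ball.mem_nhds hwb)).hasDerivAt
    have hwv : deriv D w * -(w * v) = -D w := by rw [hv]; field_simp
    have hDc : HasDerivAt (fun t => D (c t)) (-D w) 0 := by
      have := hDd.comp_of_eq (0 : ℝ) hcd rfl
      rwa [hwv] at this
    have hNc : HasDerivAt (fun t => N (c t)) (-(deriv N w / deriv D w * D w)) 0 := by
      have := hNd.comp_of_eq (0 : ℝ) hcd rfl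
      convert! this using 1
      rw [hv]; field_simp
    have hDn : HasDerivAt (fun t => ‖D (c t)‖) (-‖D w‖) 0 := by
      have := hDc.norm_of_ne_zero (by rw [hc0]; exact hDw)
      convert! this using 1
      rw [hc0, neg_div, div_self hDw]; simp
    have hq : HasDerivAt (fun t => (N (c t) / D (c t)).re)
        ((N w / D w).re - (deriv N w / deriv D w).re) 0 := by
      have h1 := hNc.div hDc (by rw [hc0]; exact hDw)
      have h2 := Complex.reCLM.hasFDerivAt.comp_hasDerivAt (0 : ℝ) h1
      convert! h2 using 1
      rw [Complex.reCLM_apply, ← Complex.sub_re, hc0]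
      congr 1
      field_simp
      ring
    have hUd : HasDerivAt (fun t => U (c t)) ((N w / D w).re - (deriv N w / deriv D w).re) 0 := by
      refine hq.congr_of_eventuallyEq ?_
      have : ∀ᶠ t in nhds (0 : ℝ), c t ≠ 0 :=
        hcd.continuousAt.eventually_ne (by rw [hc0]; exact hw0)
      filter_upwards [this] with t ht using hUeq _ ht
    have hΦd : HasDerivAt (fun t => Φ ‖c t‖) (Φ' ‖w‖ * -(‖w‖ * v.re)) 0 := by
      have h1 : HasDerivAt Φ (Φ' ‖w‖) ‖c 0‖ := by rw [hc0]; exact hΦ _ hwn hwr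
      exact h1.comp_of_eq (0 : ℝ) hcn rfl
    have hWd := (hDn.mul (hUd.add_const ε)).sub hΦd
    have hev : ∀ᶠ t in nhdsWithin (0 : ℝ) (Set.Ioi 0), ‖c t‖ ≤ ‖w‖ := by
      by_contra hcon
      have hneg : 0 < ‖w‖ * v.re := mul_pos hwn hvre
      have h2 := (hasDerivAt_iff_tendsto_slope.mp hcn).mono_left
        (nhdsWithin_mono 0 (fun t (ht : t ∈ Set.Ioi (0 : ℝ)) => (ne_of_gt ht : t ≠ 0)))
      apply hcon
      filter_upwards [h2.eventually_lt_const (show -(‖w‖ * v.re) < 0 by linarith),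
        self_mem_nhdsWithin] with t ht1 ht2
      have ht : (0 : ℝ) < t := ht2
      rw [slope_def_field, sub_zero, hc0, div_lt_iff₀ ht] at ht1
      linarith
    have hfin := hWd.nonneg_of_eventually_le (by
      filter_upwards [hev] with t ht
      have := hmin (mem_closedBall_zero_iff.mpr (ht.trans hwr))
      simp only [Set.mem_ofPred_eq, hW] at this
      simpa [hc0] using this)
    rw [hc0, hUeq w hw0] at hfin
    have h3 := hle w hw0 hwr
    rw [← hv] at h3
    have h4 : 0 < ε * ‖D w‖ := mul_pos hε (norm_pos_iff.mpr hDw)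
    linarith
  rw [← hUeq z hz0]
  refine le_of_forall_pos_le_add fun δ hδ => ?_
  have h := key (δ / (‖D z‖ + 1)) (by positivity)
  have h2 : ‖D z‖ * (δ / (‖D z‖ + 1)) ≤ δ := by
    rw [mul_div_assoc', div_le_iff₀ (by positivity)]
    nlinarith [norm_nonneg (D z)]
  linarith

/-- Libera's lemma: the half-plane condition passes from `N' / D'` to `N / D`. -/
theorem re_div_nonneg (hD : IsStarlikeFunction D) {N : ℂ → ℂ}
    (hN : DifferentiableOn ℂ N (ball 0 1)) (hN0 : N 0 = 0)
    (hre : ∀ z ∈ ball (0 : ℂ) 1, 0 ≤ (deriv N z / deriv D z).re) {z : ℂ}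
    (hz : z ∈ ball (0 : ℂ) 1) (h0 : z ≠ 0) : 0 ≤ (N z / D z).re := by
  have hz1 : ‖z‖ < 1 := mem_ball_zero_iff.mp hz
  have h := hD.le_norm_mul_re_div hN hN0 hz1 (Φ := fun _ => 0) (Φ' := fun _ => 0) rfl
    continuousOn_const (fun t _ _ => hasDerivAt_const t 0) (fun w _ hw => by
      rw [zero_mul]
      exact mul_nonneg (norm_nonneg _) (hre w (mem_ball_zero_iff.mpr (hw.trans_lt hz1)))) h0 le_rfl
  exact nonneg_of_mul_nonneg_right h (norm_pos_iff.mpr (hD.ne_zero z hz h0))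

/-- Since Re q · Re(1/q) ≤ 1, Harnack's bound gives Re(D/(zD')) ≤ (1+|z|)/(1-|z|); the growth bound
then replaces |z| by |D z|. This is the part of the hypothesis of `le_norm_mul_re_div` that depends
on D alone. -/
theorem flow_bound (hD : IsStarlikeFunction D) {z : ℂ} (hz : z ∈ ball (0 : ℂ) 1) (h0 : z ≠ 0) :
    (1 - ‖z‖) * (‖z‖ * (D z / (z * deriv D z)).re) ≤ (1 + ‖z‖) ^ 3 * ‖D z‖ := by
  have hz1 : ‖z‖ < 1 := mem_ball_zero_iff.mp hz
  have hz0 : 0 < ‖z‖ := norm_pos_iff.mpr h0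
  have h1 := hD.harnack hz
  rw [← hD.mul_deriv_div h0] at h1
  set q := z * deriv D z / D z with hq
  have hqp : 0 < q.re := hD.re_pos z hz h0
  have h2 : (D z / (z * deriv D z)).re * q.re ≤ 1 := by
    rw [← inv_div, ← hq, Complex.inv_re, div_mul_eq_mul_div, div_le_one]
    · rw [Complex.normSq_apply]; nlinarith [mul_self_nonneg q.im]
    · exact Complex.normSq_pos.mpr fun h => by rw [h] at hqp; simp at hqp
  have hs := hD.re_inv_pos hz h0
  set s := (D z / (z * deriv D z)).re
  have h3 : (1 - ‖z‖) * s ≤ 1 + ‖z‖ := by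
    calc (1 - ‖z‖) * s ≤ (1 + ‖z‖) * q.re * s := by gcongr
      _ = (1 + ‖z‖) * (s * q.re) := by ring
      _ ≤ (1 + ‖z‖) * 1 := by gcongr
      _ = _ := by ring
  calc (1 - ‖z‖) * (‖z‖ * s) = ‖z‖ * ((1 - ‖z‖) * s) := by ring
    _ ≤ (‖D z‖ * (1 + ‖z‖) ^ 2) * (1 + ‖z‖) := by
      gcongr
      exact hD.growth hz
    _ = _ := by ring

end IsStarlikeFunction

/-! ### Lower bounds for F when F' = PG'. -/

/-- `∫₀ᵗ (1 - s)² / (1 + s)⁴ ds`. -/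
noncomputable def koebeMinor (t : ℝ) : ℝ := t * (3 + t ^ 2) / (3 * (1 + t) ^ 3)

theorem hasDerivAt_koebeMinor {t : ℝ} (ht : 0 ≤ t) :
    HasDerivAt koebeMinor ((1 - t) ^ 2 / (1 + t) ^ 4) t := by
  have h1 : HasDerivAt (fun s : ℝ => s * (3 + s ^ 2)) (1 * (3 + t ^ 2) + t * (2 * t)) t := by
    have h := ((hasDerivAt_id' t).fun_pow 2).const_add 3
    simpa using (hasDerivAt_id' t).fun_mul h
  have h2 : HasDerivAt (fun s : ℝ => 3 * (1 + s) ^ 3) (3 * (3 * (1 + t) ^ 2)) t := by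
    have := (((hasDerivAt_id' t).const_add 1).fun_pow 3).const_mul 3
    simpa using this
  have h3 : (1 + t) ≠ 0 := by positivity
  convert! h1.fun_div h2 (by positivity) using 1
  field_simp
  ring

section MeanBounds

variable {G F P : ℂ → ℂ} {lam : ℂ}

/-- The density is the Harnack factor x(1-t)/(1+t) of λ̄P times the factor (1-t)/(1+t)³ of
`flow_bound`. The bound holds in the whole disc and is positive, so it also puts λ̄F/G in the right
half-plane. -/
theorem re_mul_koebeMinor_le (hG : IsStarlikeFunction G) (hF : DifferentiableOn ℂ F (ball 0 1))
    (hF0 : F 0 = 0) (hP : DifferentiableOn ℂ P (ball 0 1)) (hP0 : P 0 = 1)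
    (hFP : ∀ z ∈ ball (0 : ℂ) 1, deriv F z = P z * deriv G z)
    (hlam : ‖lam‖ = 1) (hx : 0 < lam.re)
    (hre : ∀ z ∈ ball (0 : ℂ) 1, 0 < ((starRingEnd ℂ) lam * P z).re) {z : ℂ}
    (hz : z ∈ ball (0 : ℂ) 1) (h0 : z ≠ 0) :
    lam.re * koebeMinor ‖z‖ ≤ ‖G z‖ * ((starRingEnd ℂ) lam * F z / G z).re := by
  have hz1 : ‖z‖ < 1 := mem_ball_zero_iff.mp hz
  refine hG.le_norm_mul_re_div (N := fun z => (starRingEnd ℂ) lam * F z) (hF.const_mul _)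
    (by simp [hF0]) hz1 (Φ := fun t => lam.re * koebeMinor t)
    (Φ' := fun t => lam.re * ((1 - t) ^ 2 / (1 + t) ^ 4)) (by simp [koebeMinor])
    (fun t ht => ((hasDerivAt_koebeMinor ht.1).const_mul _).continuousAt.continuousWithinAt)
    (fun t ht _ => (hasDerivAt_koebeMinor ht.le).const_mul _) ?_ h0 le_rfl
  intro w hw0 hw
  have hwb : w ∈ ball (0 : ℂ) 1 := mem_ball_zero_iff.mpr (hw.trans_lt hz1)
  have hw1 : ‖w‖ < 1 := hw.trans_lt hz1
  have h1 := hG.flow_bound hwb hw0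
  have h2 := re_conj_mul_ge_of_re_pos hlam hx hP hP0 hre hwb
  have h3 : deriv (fun z => (starRingEnd ℂ) lam * F z) w / deriv G w
      = (starRingEnd ℂ) lam * P w := by
    rw [deriv_const_mul_field, hFP w hwb]
    have := hG.deriv_ne_zero hwb
    field_simp
  rw [h3]
  set k := ((starRingEnd ℂ) lam * P w).re
  set s := ‖w‖ * (G w / (w * deriv G w)).re
  have h4 : lam.re * ((1 - ‖w‖) ^ 2 / (1 + ‖w‖) ^ 4) * s
      = (lam.re * (1 - ‖w‖)) * ((1 - ‖w‖) * s) / (1 + ‖w‖) ^ 4 := by ring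
  rw [h4, div_le_iff₀ (by positivity)]
  have h5 : 0 ≤ lam.re * (1 - ‖w‖) := mul_nonneg hx.le (by linarith)
  calc lam.re * (1 - ‖w‖) * ((1 - ‖w‖) * s)
      ≤ lam.re * (1 - ‖w‖) * ((1 + ‖w‖) ^ 3 * ‖G w‖) := by gcongr
    _ ≤ (1 + ‖w‖) * k * ((1 + ‖w‖) ^ 3 * ‖G w‖) := by gcongr
    _ = _ := by ring

theorem hasDerivAt_realPartMinor (x : ℝ) {t : ℝ} (ht : 0 ≤ t) :
    HasDerivAt (fun t => koebeMinor t
        + (1 - x) * ((t ^ 2 * (3 + t) - 2 * (1 + x) * t ^ 3) / (3 * (1 + t) ^ 3)))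
      ((1 - t ^ 2 - 2 * t * x * (1 - t * x)) / (1 + t) ^ 4) t := by
  have h0 : HasDerivAt (fun s : ℝ => s ^ 2 * (3 + s) - 2 * (1 + x) * s ^ 3)
      (2 * t * (3 + t) + t ^ 2 - 2 * (1 + x) * (3 * t ^ 2)) t := by
    have h := ((hasDerivAt_id' t).fun_pow 2).fun_mul ((hasDerivAt_id' t).const_add 3)
    have h' := ((hasDerivAt_id' t).fun_pow 3).const_mul (2 * (1 + x))
    simpa using h.fun_sub h'
  have h2 : HasDerivAt (fun s : ℝ => 3 * (1 + s) ^ 3) (3 * (3 * (1 + t) ^ 2)) t := by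
    have := (((hasDerivAt_id' t).const_add 1).fun_pow 3).const_mul 3
    simpa using this
  have h3 : (1 + t) ≠ 0 := by positivity
  convert! (hasDerivAt_koebeMinor ht).fun_add
    ((h0.fun_div h2 (by positivity)).const_mul (1 - x)) using 1
  field_simp
  ring

/-- Using Re P in place of Re(λ̄P) avoids the loss of a factor Re λ for small |z|. The density must
be nonnegative for all Re λ, which holds because (7/10)² < 1/2. -/
theorem realPartMinor_le (hG : IsStarlikeFunction G) (hF : DifferentiableOn ℂ F (ball 0 1))
    (hF0 : F 0 = 0) (hP : DifferentiableOn ℂ P (ball 0 1)) (hP0 : P 0 = 1)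
    (hFP : ∀ z ∈ ball (0 : ℂ) 1, deriv F z = P z * deriv G z)
    (hlam : ‖lam‖ = 1) (hx : 0 < lam.re)
    (hre : ∀ z ∈ ball (0 : ℂ) 1, 0 < ((starRingEnd ℂ) lam * P z).re) {z : ℂ}
    (hz : ‖z‖ ≤ 7 / 10) (h0 : z ≠ 0) :
    koebeMinor ‖z‖ + (1 - lam.re) * ((‖z‖ ^ 2 * (3 + ‖z‖) - 2 * (1 + lam.re) * ‖z‖ ^ 3)
      / (3 * (1 + ‖z‖) ^ 3)) ≤ ‖G z‖ * (F z / G z).re := by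
  refine hG.le_norm_mul_re_div hF hF0 (by linarith) (Φ := fun t => koebeMinor t
        + (1 - lam.re) * ((t ^ 2 * (3 + t) - 2 * (1 + lam.re) * t ^ 3) / (3 * (1 + t) ^ 3)))
    (Φ' := fun t => (1 - t ^ 2 - 2 * t * lam.re * (1 - t * lam.re)) / (1 + t) ^ 4)
    (by simp [koebeMinor])
    (fun t ht => (hasDerivAt_realPartMinor _ ht.1).continuousAt.continuousWithinAt)
    (fun t ht _ => hasDerivAt_realPartMinor _ ht.le) ?_ h0 le_rfl
  intro w hw0 hw
  have hw1 : ‖w‖ < 1 := by linarith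
  have hwb : w ∈ ball (0 : ℂ) 1 := mem_ball_zero_iff.mpr hw1
  have h1 := hG.flow_bound hwb hw0
  have h2 := re_ge_of_re_pos hlam hx hP hP0 hre hwb
  have h3 : deriv F w / deriv G w = P w := by
    rw [hFP w hwb]
    exact mul_div_cancel_right₀ _ (hG.deriv_ne_zero hwb)
  rw [h3]
  set k := (P w).re
  set s := ‖w‖ * (G w / (w * deriv G w)).re
  set T := 1 - ‖w‖ ^ 2 - 2 * ‖w‖ * lam.re * (1 - ‖w‖ * lam.re) with hT
  have hT0 : 0 ≤ T := by
    have : T = 1 / 2 - ‖w‖ ^ 2 + 2 * (‖w‖ * lam.re - 1 / 2) ^ 2 := by rw [hT]; ring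
    have h4 : ‖w‖ ^ 2 ≤ (7 / 10) ^ 2 := pow_le_pow_left₀ (norm_nonneg w) (hw.trans hz) 2
    rw [this]; nlinarith [sq_nonneg (‖w‖ * lam.re - 1 / 2)]
  rw [div_mul_eq_mul_div, div_le_iff₀ (by positivity)]
  have h6 : 0 < 1 - ‖w‖ := by linarith
  refine le_of_mul_le_mul_right ?_ h6
  calc T * s * (1 - ‖w‖) = T * ((1 - ‖w‖) * s) := by ring
    _ ≤ T * ((1 + ‖w‖) ^ 3 * ‖G w‖) := by gcongr
    _ ≤ (1 - ‖w‖ ^ 2) * k * ((1 + ‖w‖) ^ 3 * ‖G w‖) := by gcongr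
    _ = _ := by ring

theorem norm_mul_re_div_le {a b : ℂ} : ‖b‖ * (a / b).re ≤ ‖a‖ := by
  rcases eq_or_ne b 0 with rfl | hb
  · simp
  · calc ‖b‖ * (a / b).re ≤ ‖b‖ * ‖a / b‖ := by gcongr; exact Complex.re_le_norm _
      _ = ‖a‖ := by rw [norm_div, mul_div_cancel₀ _ (norm_ne_zero_iff.mpr hb)]

/-- The bound by Re P serves up to 7/10 and the bound by Re(λ̄P) beyond. The polynomial correction
lies below what each leaves on its range, and its second iterated integral against dt/t is
nonnegative. -/
theorem koebeMinor_add_le_norm (hG : IsStarlikeFunction G) (hF : DifferentiableOn ℂ F (ball 0 1))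
    (hF0 : F 0 = 0) (hP : DifferentiableOn ℂ P (ball 0 1)) (hP0 : P 0 = 1)
    (hFP : ∀ z ∈ ball (0 : ℂ) 1, deriv F z = P z * deriv G z)
    (hlam : ‖lam‖ = 1) (hx : 0 < lam.re)
    (hre : ∀ z ∈ ball (0 : ℂ) 1, 0 < ((starRingEnd ℂ) lam * P z).re) {z : ℂ}
    (hz : z ∈ ball (0 : ℂ) 1) (h0 : z ≠ 0) :
    koebeMinor ‖z‖ + (1 - lam.re) * (2 / 5 * (‖z‖ ^ 2 - 4 * ‖z‖ ^ 4)) ≤ ‖F z‖ := by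
  have hz1 : ‖z‖ < 1 := mem_ball_zero_iff.mp hz
  have hz0 : 0 < ‖z‖ := norm_pos_iff.mpr h0
  have hx1 : lam.re ≤ 1 := hlam ▸ Complex.re_le_norm lam
  rcases le_or_gt ‖z‖ (7 / 10) with hle | hgt
  · refine le_trans ?_ ((realPartMinor_le hG hF hF0 hP hP0 hFP hlam hx hre hle h0).trans
      norm_mul_re_div_le)
    set t := ‖z‖
    gcongr
    rw [le_div_iff₀ (by positivity)]
    have h1 : 2 / 5 * (1 - 4 * t ^ 2) * (1 + t) ^ 3 ≤ 1 - t := by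
      have := hz0.le
      rcases le_or_gt t (1 / 2) with h | h
      · have a1 : (1 + t) ^ 2 ≤ 9 / 4 := by nlinarith
        have a2 : (1 - 4 * t ^ 2) * (1 + t) ≤ 1 + t := by nlinarith [mul_nonneg this (sq_nonneg t)]
        have a3 : 0 ≤ (1 - 4 * t ^ 2) := by nlinarith
        have a4 : (1 - 4 * t ^ 2) * (1 + t) * (1 + t) ^ 2 ≤ (1 - 4 * t ^ 2) * (1 + t) * (9 / 4) := by
          gcongr
        nlinarith [mul_nonneg this (sq_nonneg t), sq_nonneg (t - 3 / 10), sq_nonneg (t - 2 / 5)]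
      · have : (1 - 4 * t ^ 2) * (1 + t) ^ 3 ≤ 0 :=
          mul_nonpos_of_nonpos_of_nonneg (by nlinarith) (by positivity)
        linarith
    have h2 : 2 / 5 * (t ^ 2 - 4 * t ^ 4) * (3 * (1 + t) ^ 3)
        = 3 * t ^ 2 * (2 / 5 * (1 - 4 * t ^ 2) * (1 + t) ^ 3) := by ring
    rw [h2]
    have h3 : 3 * t ^ 2 * (2 / 5 * (1 - 4 * t ^ 2) * (1 + t) ^ 3) ≤ 3 * t ^ 2 * (1 - t) := by gcongr
    -- From t²(3+t) - 2(1+x)t³ = 3t²(1-t) + 2(1-x)t³, with x = Re λ.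
    have h4 : 0 ≤ (1 - lam.re) * t ^ 3 := mul_nonneg (by linarith) (by positivity)
    nlinarith
  · have hc : ‖(starRingEnd ℂ) lam * F z‖ = ‖F z‖ := by
      rw [norm_mul, RCLike.norm_conj, hlam, one_mul]
    refine le_trans ?_ (((re_mul_koebeMinor_le hG hF hF0 hP hP0 hFP hlam hx hre hz h0).trans
      norm_mul_re_div_le).trans_eq hc)
    set t := ‖z‖
    -- With m = `koebeMinor t`, the available bound is xm = m - (1-x)m, so the correction has to be
    -- at most -m.
    have h1 : koebeMinor t ≤ 2 / 5 * (4 * t ^ 4 - t ^ 2) := by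
      rw [koebeMinor, div_le_iff₀ (by positivity)]
      have h2 : (24 / 25 : ℝ) ≤ 4 * t ^ 2 - 1 := by nlinarith
      have h3 : (49 / 10 : ℝ) ≤ (1 + t) ^ 3 := by
        have : (17 / 10 : ℝ) ^ 3 ≤ (1 + t) ^ 3 := by gcongr; linarith
        linarith
      have h4 : 3 + t ^ 2 ≤ 2 / 5 * t * (4 * t ^ 2 - 1) * (3 * (1 + t) ^ 3) := by
        have h5 : (24 / 25 : ℝ) * (49 / 10) ≤ (4 * t ^ 2 - 1) * (1 + t) ^ 3 := by gcongr
        have h6 : t * ((24 / 25 : ℝ) * (49 / 10)) ≤ t * ((4 * t ^ 2 - 1) * (1 + t) ^ 3) := by gcongr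
        nlinarith
      calc t * (3 + t ^ 2) ≤ t * (2 / 5 * t * (4 * t ^ 2 - 1) * (3 * (1 + t) ^ 3)) := by gcongr
        _ = _ := by ring
    nlinarith
end MeanBounds

/-! ### Close-to-convex univalence and integration of derivative bounds. -/

/-- Close-to-convex functions are univalent. -/
theorem injOn_of_re_deriv_div_pos {f g : ℂ → ℂ} {U : Set ℂ} (hU : IsOpen U)
    (hg : DifferentiableOn ℂ g U) (hinj : Set.InjOn g U) (hconv : Convex ℝ (g '' U))
    (hf : DifferentiableOn ℂ f U) {μ : ℂ}
    (hre : ∀ z ∈ U, 0 < (μ * (deriv f z / deriv g z)).re) : Set.InjOn f U := by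
  obtain ⟨ψ, hψ, hψ'⟩ := exists_leftInverse_hasDerivAt hU hg hinj
  intro a ha b hb hab
  by_contra hne
  have hgab : g b - g a ≠ 0 := fun h => hne (hinj ha hb (sub_eq_zero.mp h).symm)
  set c : ℝ → ℂ := fun t => g a + t * (g b - g a) with hc
  have hcm : ∀ t ∈ Set.Icc (0 : ℝ) 1, ∃ z ∈ U, g z = c t := by
    intro t ht
    have := hconv (Set.mem_image_of_mem g ha) (Set.mem_image_of_mem g hb)
      (sub_nonneg.mpr ht.2) ht.1 (by ring)
    obtain ⟨z, hz, hz2⟩ := this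
    refine ⟨z, hz, hz2.trans ?_⟩
    simp only [hc, Complex.real_smul]; push_cast; ring
  have hcd : ∀ t, HasDerivAt c (g b - g a) t := by
    intro t
    have := ((Complex.ofRealCLM.hasDerivAt (x := t)).mul_const (g b - g a)).const_add (g a)
    simpa [hc] using this
  -- Along the segment from g(a) to g(b) in the convex image, f ∘ ψ has derivative (f'/g')·(g(b) -
  -- g(a)), so S has derivative Re(μf'/g') > 0.
  set S : ℝ → ℝ := fun t => (μ * (f (ψ (c t)) / (g b - g a))).re with hS
  have hSd : ∀ t ∈ Set.Icc (0 : ℝ) 1, ∃ s, 0 < s ∧ HasDerivAt S s t := by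
    intro t ht
    obtain ⟨z, hz, hzc⟩ := hcm t ht
    refine ⟨_, hre z hz, ?_⟩
    have h1 : HasDerivAt ψ (deriv g z)⁻¹ (c t) := by rw [← hzc]; exact hψ' z hz
    have h2 : HasDerivAt f (deriv f z) (ψ (c t)) := by
      rw [← hzc, hψ z hz]; exact (hf.differentiableAt (hU.mem_nhds hz)).hasDerivAt
    have h3 := ((h2.comp_of_eq t (h1.comp_of_eq t (hcd t) rfl) rfl).div_const
      (g b - g a)).const_mul μ
    have h4 := Complex.reCLM.hasFDerivAt.comp_hasDerivAt t h3
    convert! h4 using 1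
    rw [Complex.reCLM_apply]
    congr 2
    field_simp
  have hmono : StrictMonoOn S (Set.Icc 0 1) := by
    apply strictMonoOn_of_deriv_pos (convex_Icc _ _)
    · intro t ht
      obtain ⟨s, _, hs⟩ := hSd t ht
      exact hs.continuousAt.continuousWithinAt
    · intro t ht
      obtain ⟨s, hs0, hs⟩ := hSd t (interior_subset ht)
      rw [hs.deriv]; exact hs0
  have h01 := hmono (Set.left_mem_Icc.mpr zero_le_one) (Set.right_mem_Icc.mpr zero_le_one)
    zero_lt_one
  have e0 : ψ (c 0) = a := by simpa [hc] using hψ a ha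
  have e1 : ψ (c 1) = b := by simpa [hc] using hψ b hb
  simp only [hS, e0, e1, hab, lt_irrefl] at h01

theorem frontier_image_ball_subset {φ : ℂ → ℂ} (hφ : DifferentiableOn ℂ φ (ball 0 1))
    (hinj : Set.InjOn φ (ball 0 1)) {r : ℝ} (hr : r < 1) {w : ℂ}
    (hw : w ∈ frontier (φ '' ball 0 r)) : ∃ z, ‖z‖ = r ∧ φ z = w := by
  have hsub : closedBall (0 : ℂ) r ⊆ ball 0 1 := closedBall_subset_ball hr
  have hsub' : ball (0 : ℂ) r ⊆ ball 0 1 := ball_subset_closedBall.trans hsub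
  have hopen : IsOpen (φ '' ball 0 r) :=
    isOpen_image_of_deriv_ne_zero isOpen_ball (hφ.mono hsub')
      fun z hz => deriv_ne_zero_of_injOn isOpen_ball hφ hinj (hsub' hz)
  have hcl : IsClosed (φ '' closedBall 0 r) :=
    ((isCompact_closedBall _ _).image_of_continuousOn (hφ.continuousOn.mono hsub)).isClosed
  rw [hopen.frontier_eq] at hw
  obtain ⟨z, hz, rfl⟩ := closure_minimal (Set.image_mono ball_subset_closedBall) hcl hw.1
  refine ⟨z, le_antisymm (mem_closedBall_zero_iff.mp hz) ?_, rfl⟩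
  by_contra! h
  exact hw.2 (Set.mem_image_of_mem φ (mem_ball_zero_iff.mpr h))

theorem IsPreconnected.subset_or_exists_mem_frontier {s t : Set ℂ} (hs : IsPreconnected s)
    (hst : (s ∩ t).Nonempty) : s ⊆ t ∨ ∃ w ∈ s, w ∈ frontier t := by
  by_cases h : s ⊆ t
  · exact Or.inl h
  · right
    obtain ⟨x, hx, hxt⟩ := Set.not_subset.mp h
    by_contra! hno
    have hcov : s ⊆ interior t ∪ (closure t)ᶜ := by
      intro w hw
      by_contra hw2
      simp only [Set.mem_union, Set.mem_compl_iff, not_or, not_not] at hw2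
      exact hno w hw ⟨hw2.2, hw2.1⟩
    obtain ⟨y, hy, hyt⟩ := hst
    have hy2 : y ∈ interior t := (hcov hy).resolve_right fun h => h (subset_closure hyt)
    have hx2 : x ∈ (closure t)ᶜ := (hcov hx).resolve_left fun h => hxt (interior_subset h)
    obtain ⟨w, _, hw1, hw2⟩ := hs _ _ isOpen_interior isClosed_closure.isOpen_compl hcov
      ⟨y, hy, hy2⟩ ⟨x, hx, hx2⟩
    exact hw2 (subset_closure (interior_subset hw1))

/-- A lower bound for the derivative of a univalent function integrates to a growth bound. -/
theorem growth_of_injOn {φ : ℂ → ℂ} (hφ : DifferentiableOn ℂ φ (ball 0 1))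
    (hinj : Set.InjOn φ (ball 0 1)) (h0 : φ 0 = 0) {N N' : ℝ → ℝ} (hN0 : N 0 = 0)
    (hNc : ContinuousOn N (Set.Ico 0 1)) (hN : ∀ t ∈ Set.Ioo (0 : ℝ) 1, HasDerivAt N (N' t) t)
    (hN' : ∀ t ∈ Set.Ioo (0 : ℝ) 1, 0 ≤ N' t)
    (hle : ∀ z ∈ ball (0 : ℂ) 1, z ≠ 0 → N' ‖z‖ ≤ ‖deriv φ z‖) {z : ℂ}
    (hz : z ∈ ball (0 : ℂ) 1) : N ‖z‖ ≤ ‖φ z‖ := by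
  rcases eq_or_ne z 0 with rfl | hz0
  · simp [hN0]
  obtain ⟨ψ, hψ, hψ'⟩ := exists_leftInverse_hasDerivAt isOpen_ball hφ hinj
  set r := ‖z‖ with hr
  have hr1 : r < 1 := mem_ball_zero_iff.mp hz
  have hr0 : 0 < r := norm_pos_iff.mpr hz0
  have hsub : closedBall (0 : ℂ) r ⊆ ball 0 1 := closedBall_subset_ball hr1
  obtain ⟨z₀, hz₀, hmin⟩ := (isCompact_sphere (0 : ℂ) r).exists_isMinOn
    ⟨z, mem_sphere_zero_iff_norm.mpr rfl⟩
    ((hφ.continuousOn.mono (sphere_subset_closedBall.trans hsub)).norm)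
  set m := ‖φ z₀‖ with hm
  have hz₀r : ‖z₀‖ = r := mem_sphere_zero_iff_norm.mp hz₀
  have hball : ball (0 : ℂ) m ⊆ φ '' ball 0 r := by
    rcases (ball (0 : ℂ) m).eq_empty_or_nonempty with he | hne
    · rw [he]; exact Set.empty_subset _
    have hm0 : 0 < m := nonempty_ball.mp hne
    rcases (convex_ball (0 : ℂ) m).isPreconnected.subset_or_exists_mem_frontier (t := φ '' ball 0 r)
      ⟨0, mem_ball_self hm0, 0, mem_ball_self hr0, h0⟩ with h | ⟨w, hw1, hw2⟩
    · exact h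
    · obtain ⟨ζ, hζ, rfl⟩ := frontier_image_ball_subset hφ hinj hr1 hw2
      have h1 : m ≤ ‖φ ζ‖ := hmin (mem_sphere_zero_iff_norm.mpr hζ)
      exact absurd (mem_ball_zero_iff.mp hw1) (not_lt.mpr h1)
  suffices h : N r ≤ m from h.trans (hmin (mem_sphere_zero_iff_norm.mpr rfl))
  have key : ∀ δ : ℝ, 0 < δ → N r ≤ (1 + δ) * m := by
    intro δ hδ
    -- Pulling φ(ζ) radially towards 0 lowers |φ| at rate |φ(ζ)|, and N(|ζ|) at no greater rate; the
    -- factor 1 + δ makes the comparison strict, so Y has no negative minimum.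
    set Y : ℂ → ℝ := fun ζ => (1 + δ) * ‖φ ζ‖ - N ‖ζ‖ with hY
    have hYc : ContinuousOn Y (closedBall 0 r) := by
      refine ((hφ.continuousOn.mono hsub).norm.const_mul _).sub ?_
      exact hNc.comp continuous_norm.continuousOn
        (fun w hw => ⟨norm_nonneg w, (mem_closedBall_zero_iff.mp hw).trans_lt hr1⟩)
    -- This set is kept by the radial flow: the disc of radius m is covered by φ(`ball 0 r`). The
    -- closed disc alone need not be.
    set A : Set ℂ := closedBall 0 r ∩ (fun ζ => ‖φ ζ‖) ⁻¹' Set.Iic m with hA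
    have hAc : IsCompact A := by
      refine (isCompact_closedBall (0 : ℂ) r).of_isClosed_subset ?_ Set.inter_subset_left
      exact ((hφ.continuousOn.mono hsub).norm).preimage_isClosed_of_isClosed
        isClosed_closedBall isClosed_Iic
    have hz₀A : z₀ ∈ A := ⟨sphere_subset_closedBall hz₀, le_refl m⟩
    obtain ⟨ζ, hζA, hζmin⟩ := hAc.exists_isMinOn ⟨z₀, hz₀A⟩ (hYc.mono Set.inter_subset_left)
    by_cases hYζ : 0 ≤ Y ζ
    · have h1 : Y ζ ≤ Y z₀ := hζmin hz₀A
      have h2 := hYζ.trans h1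
      simp only [hY, hz₀r] at h2
      linarith
    exfalso
    have hζ0 : ζ ≠ 0 := by
      rintro rfl
      exact hYζ (by simp [hY, h0, hN0])
    have hζb := hsub hζA.1
    have hζn : ‖ζ‖ ∈ Set.Ioo (0 : ℝ) 1 := ⟨norm_pos_iff.mpr hζ0, mem_ball_zero_iff.mp hζb⟩
    have hφζ : φ ζ ≠ 0 := fun h => hζ0 (hinj hζb (mem_ball_self one_pos) (by rw [h, h0]))
    have hφn : 0 < ‖φ ζ‖ := norm_pos_iff.mpr hφζ
    have hd : deriv φ ζ ≠ 0 := deriv_ne_zero_of_injOn isOpen_ball hφ hinj hζb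
    set c : ℝ → ℂ := fun t => ψ (φ ζ - t * φ ζ) with hc
    have hc0 : c 0 = ζ := by simpa [hc] using hψ ζ hζb
    have hcd : HasDerivAt c (-(φ ζ / deriv φ ζ)) 0 := by
      have h1 : HasDerivAt (fun t : ℝ => φ ζ - (t : ℂ) * φ ζ) (-φ ζ) 0 := by
        have := ((Complex.ofRealCLM.hasDerivAt (x := (0 : ℝ))).mul_const (φ ζ)).const_sub (φ ζ)
        simpa using this
      have h2 : HasDerivAt ψ (deriv φ ζ)⁻¹ (φ ζ - ((0 : ℝ) : ℂ) * φ ζ) := by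
        simpa using hψ' ζ hζb
      have := h2.comp_of_eq (0 : ℝ) h1 rfl
      convert! this using 1
      field_simp
    have hcA : ∀ t ∈ Set.Ioo (0 : ℝ) 1, c t ∈ A := by
      intro t ht
      have h1 : ‖φ ζ - t * φ ζ‖ = (1 - t) * ‖φ ζ‖ := by
        rw [show φ ζ - t * φ ζ = ((1 - t : ℝ) : ℂ) * φ ζ by push_cast; ring, norm_mul,
          Complex.norm_real, Real.norm_of_nonneg (by linarith [ht.2])]
      have h2 : ‖φ ζ‖ ≤ m := hζA.2
      have h3 : ‖φ ζ - t * φ ζ‖ < m := by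
        rw [h1]; nlinarith [ht.1]
      obtain ⟨v, hv, hv2⟩ := hball (mem_ball_zero_iff.mpr h3)
      have h4 : c t = v := by
        simp only [hc]; rw [← hv2]; exact hψ v (hsub (ball_subset_closedBall hv))
      rw [h4]
      refine ⟨ball_subset_closedBall hv, ?_⟩
      simp only [Set.mem_preimage, Set.mem_Iic]
      rw [hv2]; exact h3.le
    have hcn := hcd.norm_of_ne_zero (by rw [hc0]; exact hζ0)
    rw [hc0] at hcn
    have hNd : HasDerivAt (fun t => N ‖c t‖) _ 0 :=
      HasDerivAt.comp_of_eq (h₂ := N) (h₂' := N' ‖ζ‖) (y := ‖c 0‖) (0 : ℝ) (by rw [hc0]; exact hN _ hζn) hcn rfl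
    have hφd : HasDerivAt (fun t => φ (c t)) (-φ ζ) 0 := by
      have h1 : HasDerivAt φ (deriv φ ζ) (c 0) := by
        rw [hc0]; exact (hφ.differentiableAt (isOpen_ball.mem_nhds hζb)).hasDerivAt
      have := h1.comp_of_eq (0 : ℝ) hcd rfl
      convert! this using 1
      field_simp
    have hφnd := hφd.norm_of_ne_zero (by rw [hc0]; exact hφζ)
    rw [hc0, neg_div, div_self hφζ] at hφnd
    have hYd := (hφnd.const_mul (1 + δ)).sub hNd
    have hfin := hYd.nonneg_of_eventually_le (by
      filter_upwards [Ioo_mem_nhdsGT (zero_lt_one' ℝ)] with t ht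
      have h1 : Y ζ ≤ Y (c t) := hζmin (hcA t ht)
      simp only [hY] at h1
      simpa [hc0] using h1)
    have h1 : -(N' ‖ζ‖ * (‖ζ‖ * (-(φ ζ / deriv φ ζ) / ζ).re)) ≤ ‖φ ζ‖ := by
      have h2 : -(‖ζ‖ * (-(φ ζ / deriv φ ζ) / ζ).re) ≤ ‖φ ζ / deriv φ ζ‖ := by
        rw [neg_div, Complex.neg_re, mul_neg, neg_neg]
        exact norm_mul_re_div_le
      have h3 := hN' _ hζn
      calc -(N' ‖ζ‖ * (‖ζ‖ * (-(φ ζ / deriv φ ζ) / ζ).re))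
          = N' ‖ζ‖ * (-(‖ζ‖ * (-(φ ζ / deriv φ ζ) / ζ).re)) := by ring
        _ ≤ N' ‖ζ‖ * ‖φ ζ / deriv φ ζ‖ := by gcongr
        _ ≤ ‖deriv φ ζ‖ * ‖φ ζ / deriv φ ζ‖ := by gcongr; exact hle ζ hζb hζ0
        _ = ‖φ ζ‖ := by rw [norm_div, mul_div_cancel₀ _ (norm_ne_zero_iff.mpr hd)]
    simp only [Complex.neg_re, Complex.one_re] at hfin
    nlinarith [mul_pos hδ hφn]
  refine le_of_forall_pos_le_add fun δ hδ => ?_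
  have h := key (δ / (m + 1)) (by positivity)
  have h2 : δ / (m + 1) * m ≤ δ := by
    rw [div_mul_eq_mul_div, div_le_iff₀ (by positivity)]
    nlinarith [norm_nonneg (φ z₀)]
  linarith

/-! ### The convex function k with zk' = g. -/

namespace IsConvexFunction

variable {g k : ℂ → ℂ}

/-- On each ray from the origin the modulus of the preimage increases. -/
theorem norm_lt_of_eq_mul (hg : IsConvexFunction g) (h1 : deriv g 0 = 1) {z ζ : ℂ}
    (hz : z ∈ ball (0 : ℂ) 1) (hζ : ζ ∈ ball (0 : ℂ) 1) (h0 : z ≠ 0) {τ : ℝ} (hτ0 : 0 < τ)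
    (hτ1 : τ < 1) (h : g ζ = τ * g z) : ‖ζ‖ < ‖z‖ := by
  obtain ⟨ψ, hψ, hψ'⟩ := exists_leftInverse_hasDerivAt isOpen_ball hg.analytic hg.univalent
  have hst := hg.isStarlike h1
  have hmem : ∀ s ∈ Set.Icc (0 : ℝ) 1, ∃ v ∈ ball (0 : ℂ) 1, g v = s * g z := by
    intro s hs
    have := hg.convex_image (Set.mem_image_of_mem g hz)
      (Set.mem_image_of_mem g (mem_ball_self one_pos : (0 : ℂ) ∈ ball 0 1)) hs.1
      (sub_nonneg.mpr hs.2) (by ring)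
    simpa [hg.map_zero] using this
  have hder : ∀ s ∈ Set.Icc τ 1, ∃ d, 0 < d ∧ HasDerivAt (fun s : ℝ => ‖ψ (s * g z)‖) d s := by
    intro s hs
    have hs0 : 0 < s := hτ0.trans_le hs.1
    obtain ⟨v, hv, hvs⟩ := hmem s ⟨hs0.le, hs.2⟩
    have hv0 : v ≠ 0 := by
      rintro rfl
      rw [hg.map_zero] at hvs
      have hs' : (s : ℂ) ≠ 0 := by exact_mod_cast hs0.ne'
      exact (mul_ne_zero hs' (hg.ne_zero hz h0)) hvs.symm
    have hl : HasDerivAt (fun s : ℝ => (s : ℂ) * g z) (g z) s := by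
      simpa using (Complex.ofRealCLM.hasDerivAt (x := s)).mul_const (g z)
    have h2 : HasDerivAt ψ (deriv g v)⁻¹ (s * g z) := by rw [← hvs]; exact hψ' v hv
    have h3 : ψ (s * g z) = v := by rw [← hvs]; exact hψ v hv
    have h4 := (h2.comp_of_eq s hl rfl).norm_of_ne_zero (by
      simp only [Function.comp]; rw [h3]; exact hv0)
    refine ⟨_, ?_, h4⟩
    simp only [Function.comp]
    rw [h3]
    refine mul_pos (norm_pos_iff.mpr hv0) ?_
    -- The logarithmic derivative of |ψ(s g(z))| is s⁻¹ Re(g(v)/(vg'(v))), positive because g is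
    -- starlike.
    have h5 : (deriv g v)⁻¹ * g z / v = ((s⁻¹ : ℝ) : ℂ) * (g v / (v * deriv g v)) := by
      have hs' : (s : ℂ) ≠ 0 := by exact_mod_cast hs0.ne'
      have := hg.deriv_ne_zero hv
      rw [hvs]; push_cast; field_simp
    rw [h5, Complex.re_ofReal_mul]
    exact mul_pos (inv_pos.mpr hs0) (hst.re_inv_pos hv hv0)
  have hmono : StrictMonoOn (fun s : ℝ => ‖ψ (s * g z)‖) (Set.Icc τ 1) := by
    apply strictMonoOn_of_deriv_pos (convex_Icc _ _)
    · intro t ht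
      obtain ⟨s, _, hs⟩ := hder t ht
      exact hs.continuousAt.continuousWithinAt
    · intro t ht
      obtain ⟨s, hs0, hs⟩ := hder t (interior_subset ht)
      rw [hs.deriv]; exact hs0
  have := hmono (Set.left_mem_Icc.mpr hτ1.le) (Set.right_mem_Icc.mpr hτ1.le) hτ1
  simp only [Complex.ofReal_one, one_mul, ← h, hψ z hz, hψ ζ hζ] at this
  exact this

/-- If `z k' = g` with `g` convex, then `k` maps each disc to one side of its tangent lines. -/
theorem support_of_mul_deriv_eq (hg : IsConvexFunction g) (h1 : deriv g 0 = 1)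
    (hk : DifferentiableOn ℂ k (ball 0 1)) (hk1 : deriv k 0 = 1)
    (hkg : ∀ z ∈ ball (0 : ℂ) 1, z * deriv k z = g z) {z ζ : ℂ} (hz : z ∈ ball (0 : ℂ) 1)
    (hζ : ‖ζ‖ ≤ ‖z‖) (hne : ζ ≠ z) :
    ((starRingEnd ℂ) (g z) * k ζ).re < ((starRingEnd ℂ) (g z) * k z).re := by
  have hz0 : z ≠ 0 := by
    rintro rfl
    exact hne (norm_le_zero_iff.mp (by simpa using hζ))
  have hr1 : ‖z‖ < 1 := mem_ball_zero_iff.mp hz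
  have hsub : closedBall (0 : ℂ) ‖z‖ ⊆ ball 0 1 := closedBall_subset_ball hr1
  set b := (starRingEnd ℂ) (g z) with hb
  have hgz := hg.ne_zero hz hz0
  have hb0 : b ≠ 0 := by simpa [hb] using hgz
  set u : ℂ → ℝ := fun w => (b * k w).re with hu
  have huc : ContinuousOn u (closedBall 0 ‖z‖) :=
    Complex.continuous_re.comp_continuousOn
      (continuousOn_const.mul (hk.continuousOn.mono hsub))
  have hud : ∀ {c : ℝ → ℂ} {c' : ℂ} {t : ℝ}, c t ∈ ball (0 : ℂ) 1 → HasDerivAt c c' t →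
      HasDerivAt (fun s => u (c s)) ((b * (deriv k (c t) * c')).re) t := by
    intro c c' t hct hc
    have h2 := ((hk.differentiableAt (isOpen_ball.mem_nhds hct)).hasDerivAt.comp_of_eq t hc
      rfl).const_mul b
    exact Complex.reCLM.hasFDerivAt.comp_hasDerivAt t h2
  -- A maximum lies on the circle because k' ≠ 0. There the tangential and radial first-order
  -- conditions make the conjugate of g(z) times g(w) real and nonnegative, so g(w) is on the ray
  -- through g(z); that ray meets the image of the circle only once.
  have huniq : ∀ w ∈ closedBall (0 : ℂ) ‖z‖, IsMaxOn u (closedBall 0 ‖z‖) w → w = z := by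
    intro w hw hmax
    have hwb := hsub hw
    have hwn : ‖w‖ ≤ ‖z‖ := mem_closedBall_zero_iff.mp hw
    have hdir : ∀ v : ℂ, (∀ᶠ t : ℝ in nhdsWithin (0 : ℝ) (Set.Ioi 0), ‖w + t * v‖ ≤ ‖z‖) →
        (b * (deriv k w * v)).re ≤ 0 := by
      intro v hv
      have hl : HasDerivAt (fun t : ℝ => w + (t : ℂ) * v) v 0 := by
        simpa using ((Complex.ofRealCLM.hasDerivAt (x := (0 : ℝ))).mul_const v).const_add w
      have h2 := (hud (by simpa using hwb) hl).neg
      have h3 := h2.nonneg_of_eventually_le (by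
        filter_upwards [hv] with t ht
        have h4 : u (w + t * v) ≤ u w := hmax (mem_closedBall_zero_iff.mpr ht)
        simpa using h4)
      simpa using h3
    have hint : ‖w‖ < ‖z‖ → ∀ v : ℂ,
        ∀ᶠ t : ℝ in nhdsWithin (0 : ℝ) (Set.Ioi 0), ‖w + t * v‖ ≤ ‖z‖ := by
      intro hlt v
      have hcont : ContinuousAt (fun t : ℝ => ‖w + (t : ℂ) * v‖) 0 := by fun_prop
      have := hcont.eventually_lt continuousAt_const (by simpa using hlt)
      exact (Filter.Eventually.filter_mono nhdsWithin_le_nhds this).mono fun t ht => ht.le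
    have hk'w : deriv k w ≠ 0 := by
      rcases eq_or_ne w 0 with rfl | hw0
      · rw [hk1]; exact one_ne_zero
      · intro h
        have := hkg w hwb
        rw [h, mul_zero] at this
        exact hg.ne_zero hwb hw0 this.symm
    have hwz : ‖w‖ = ‖z‖ := by
      refine le_antisymm hwn (not_lt.mp fun hlt => ?_)
      have h2 := hdir ((starRingEnd ℂ) (b * deriv k w)) (hint hlt _)
      rw [← mul_assoc, Complex.mul_conj, Complex.ofReal_re] at h2
      exact absurd h2 (not_le.mpr (Complex.normSq_pos.mpr (mul_ne_zero hb0 hk'w)))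
    have hw0 : w ≠ 0 := norm_pos_iff.mp (hwz ▸ norm_pos_iff.mpr hz0)
    have hre : 0 ≤ (b * g w).re := by
      have h2 := hdir (-w) (by
        filter_upwards [Ioo_mem_nhdsGT (zero_lt_one' ℝ)] with t ht
        rw [show w + t * -w = ((1 - t : ℝ) : ℂ) * w by push_cast; ring, norm_mul,
          Complex.norm_real, Real.norm_of_nonneg (by linarith [ht.2]), hwz]
        nlinarith [ht.1, norm_nonneg z])
      rw [show b * (deriv k w * -w) = -(b * (w * deriv k w)) by ring, hkg w hwb,
        Complex.neg_re] at h2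
      linarith
    have him : (b * g w).im = 0 := by
      set c : ℝ → ℂ := fun θ => w * Complex.exp (θ * Complex.I) with hc
      have hc0 : c 0 = w := by simp [hc]
      have hcd : HasDerivAt c (w * Complex.I) 0 := by
        have h2 : HasDerivAt (fun s : ℝ => (s : ℂ) * Complex.I) (1 * Complex.I) 0 :=
          (Complex.ofRealCLM.hasDerivAt (x := (0 : ℝ))).mul_const _
        have := (h2.cexp).const_mul w
        simpa using this
      have h2 := hud (by rw [hc0]; exact hwb) hcd
      have h3 : IsLocalMax (fun s => u (c s)) 0 := Filter.Eventually.of_forall fun θ => by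
        simp only [hc0]
        exact hmax (mem_closedBall_zero_iff.mpr (by
          simp [hc, Complex.norm_exp_ofReal_mul_I, hwz]))
      have h4 := h3.hasDerivAt_eq_zero h2
      rw [hc0, show b * (deriv k w * (w * Complex.I)) = (b * (w * deriv k w)) * Complex.I by ring,
        hkg w hwb, Complex.mul_I_re] at h4
      linarith
    have hgw := hg.ne_zero hwb hw0
    set τ : ℝ := (b * g w).re / Complex.normSq (g z) with hτ
    have hbg : b * g w = ((b * g w).re : ℂ) := Complex.ext (by simp) (by simpa using him)
    have hnz : 0 < Complex.normSq (g z) := Complex.normSq_pos.mpr hgz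
    have hpos : 0 < (b * g w).re := lt_of_le_of_ne hre fun h => by
      rw [← h] at hbg
      exact (mul_ne_zero hb0 hgw) (by simpa using hbg)
    have hτ0 : 0 < τ := div_pos hpos hnz
    have hgwτ : g w = τ * g z := by
      have h5 : ((Complex.normSq (g z) : ℝ) : ℂ) ≠ 0 := by exact_mod_cast hnz.ne'
      have h6 : ((Complex.normSq (g z) : ℝ) : ℂ) = b * g z := Complex.normSq_eq_conj_mul_self
      rw [hτ, Complex.ofReal_div, ← hbg, h6]
      field_simp
    rcases lt_trichotomy τ 1 with h | h | h
    · exact absurd (hg.norm_lt_of_eq_mul h1 hz hwb hz0 hτ0 h hgwτ) (by rw [hwz]; exact lt_irrefl _)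
    · rw [h, Complex.ofReal_one, one_mul] at hgwτ
      exact hg.univalent hwb hz hgwτ
    · have h7 : g z = ((τ⁻¹ : ℝ) : ℂ) * g w := by
        have : (τ : ℂ) ≠ 0 := by exact_mod_cast hτ0.ne'
        rw [hgwτ]; push_cast; field_simp
      exact absurd (hg.norm_lt_of_eq_mul h1 hwb hz hw0 (inv_pos.mpr hτ0) (inv_lt_one_of_one_lt₀ h)
        h7) (by rw [hwz]; exact lt_irrefl _)
  obtain ⟨w, hw, hmax⟩ := (isCompact_closedBall (0 : ℂ) ‖z‖).exists_isMaxOn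
    ⟨z, mem_closedBall_zero_iff.mpr le_rfl⟩ huc
  have hwz := huniq w hw hmax
  rw [hwz] at hmax
  refine lt_of_le_of_ne (hmax (mem_closedBall_zero_iff.mpr hζ)) fun heq => hne ?_
  refine huniq ζ (mem_closedBall_zero_iff.mpr hζ) fun v hv => ?_
  have h2 : u v ≤ u z := hmax hv
  exact h2.trans_eq heq.symm

/-- If `z k' = g` with `g` convex, then `k` is convex. -/
theorem of_mul_deriv_eq (hg : IsConvexFunction g) (h1 : deriv g 0 = 1)
    (hk : DifferentiableOn ℂ k (ball 0 1)) (hk0 : k 0 = 0) (hk1 : deriv k 0 = 1)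
    (hkg : ∀ z ∈ ball (0 : ℂ) 1, z * deriv k z = g z) : IsConvexFunction k := by
  have hinj : Set.InjOn k (ball 0 1) := by
    intro a ha b hb hab
    by_contra hne
    rcases le_total ‖a‖ ‖b‖ with h | h
    · have := hg.support_of_mul_deriv_eq h1 hk hk1 hkg hb h hne
      rw [hab] at this; exact lt_irrefl _ this
    · have := hg.support_of_mul_deriv_eq h1 hk hk1 hkg ha h (Ne.symm hne)
      rw [hab] at this; exact lt_irrefl _ this
  refine ⟨hk, hk0, by rw [hk1]; simp, hinj, ?_⟩
  rw [convex_iff_segment_subset]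
  rintro _ ⟨a, ha, rfl⟩ _ ⟨b, hb, rfl⟩
  obtain ⟨r, hr, hr1⟩ := exists_between (max_lt (mem_ball_zero_iff.mp ha) (mem_ball_zero_iff.mp hb))
  have har : a ∈ ball (0 : ℂ) r := mem_ball_zero_iff.mpr ((le_max_left _ _).trans_lt hr)
  have hbr : b ∈ ball (0 : ℂ) r := mem_ball_zero_iff.mpr ((le_max_right _ _).trans_lt hr)
  -- A segment leaving the image would meet its frontier at some k(z) with |z| = r, yet both
  -- endpoints are strictly on one side of the supporting line there.
  have hseg : segment ℝ (k a) (k b) ⊆ k '' ball 0 r := by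
    rcases (convex_segment (k a) (k b)).isPreconnected.subset_or_exists_mem_frontier
      (t := k '' ball 0 r) ⟨k a, left_mem_segment ℝ _ _, a, har, rfl⟩ with h | ⟨w, hw1, hw2⟩
    · exact h
    exfalso
    obtain ⟨z, hz, rfl⟩ := frontier_image_ball_subset hk hinj hr1 hw2
    have hzb : z ∈ ball (0 : ℂ) 1 := mem_ball_zero_iff.mpr (hz ▸ hr1)
    have key : ∀ v ∈ ball (0 : ℂ) r,
        ((starRingEnd ℂ) (g z) * k v).re < ((starRingEnd ℂ) (g z) * k z).re := by
      intro v hv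
      have hv' := mem_ball_zero_iff.mp hv
      refine hg.support_of_mul_deriv_eq h1 hk hk1 hkg hzb (by rw [hz]; exact hv'.le) ?_
      rintro rfl
      exact absurd hz hv'.ne
    have ka := key a har
    have kb := key b hbr
    obtain ⟨s, t, hs, ht, hst, hw⟩ := hw1
    have h2 : (starRingEnd ℂ) (g z) * k z
        = (s : ℂ) * ((starRingEnd ℂ) (g z) * k a) + (t : ℂ) * ((starRingEnd ℂ) (g z) * k b) := by
      rw [← hw]; simp only [Complex.real_smul]; ring
    have h3 := congrArg Complex.re h2
    rw [Complex.add_re, Complex.re_ofReal_mul, Complex.re_ofReal_mul] at h3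
    have hs1 : s = 1 - t := by linarith
    subst hs1
    nlinarith [mul_le_mul_of_nonneg_left ka.le hs, mul_le_mul_of_nonneg_left kb.le ht]
  exact hseg.trans (Set.image_mono (ball_subset_ball hr1.le))

end IsConvexFunction

/-! ### Univalence, growth and boundary distance for the class. -/

theorem deriv_zDeriv_zero {f : ℂ → ℂ} (hf : DifferentiableOn ℂ f (ball 0 1)) :
    deriv (zDeriv f) 0 = deriv f 0 := by
  have h : HasDerivAt (deriv f) (deriv (deriv f) 0) 0 :=
    ((hf.deriv isOpen_ball).differentiableAt (ball_mem_nhds 0 one_pos)).hasDerivAt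
  have := ((hasDerivAt_id' (0 : ℂ)).fun_mul h).deriv
  rw [show zDeriv f = fun z => z * deriv f z from rfl, this]; simp

/-- Normalization of the data attached to a function of the class. -/
theorem IsClassC3.exists_normalized {f : ℂ → ℂ} (hf : IsClassC3 f) :
    ∃ (g P : ℂ → ℂ) (lam : ℂ), IsConvexFunction g ∧ deriv g 0 = 1 ∧ ‖lam‖ = 1 ∧ 0 < lam.re ∧
      DifferentiableOn ℂ P (ball 0 1) ∧ P 0 = 1 ∧
      (∀ z ∈ ball (0 : ℂ) 1, deriv (zDeriv (zDeriv f)) z = P z * deriv (zDeriv g) z) ∧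
      ∀ z ∈ ball (0 : ℂ) 1, 0 < ((starRingEnd ℂ) lam * P z).re := by
  obtain ⟨g, hg, hre⟩ := hf.exists_convex
  set b := deriv g 0 with hb
  have hb0 : b ≠ 0 := hg.deriv_ne_zero (mem_ball_self one_pos)
  have hbn : (‖b‖ : ℂ) ≠ 0 := by exact_mod_cast (norm_ne_zero_iff.mpr hb0)
  have hGne : ∀ z ∈ ball (0 : ℂ) 1, deriv (zDeriv g) z ≠ 0 := by
    intro z hz h
    have := hre z hz
    rw [h] at this; simp at this
  have hzg : zDeriv (fun z => b⁻¹ * g z) = fun z => b⁻¹ * zDeriv g z := by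
    funext z
    simp only [zDeriv]
    rw [deriv_const_mul_field]; ring
  refine ⟨fun z => b⁻¹ * g z, fun z => b * (deriv (zDeriv (zDeriv f)) z / deriv (zDeriv g) z),
    b / ‖b‖, hg.normalize.1, hg.normalize.2, ?_, ?_, ?_, ?_, ?_, ?_⟩
  · rw [norm_div, Complex.norm_real, norm_norm, div_self (norm_ne_zero_iff.mpr hb0)]
  · rw [Complex.div_ofReal_re]
    exact div_pos hg.re_deriv_pos (norm_pos_iff.mpr hb0)
  · exact ((hf.analytic.zDeriv.zDeriv.deriv isOpen_ball).div
      (hg.analytic.zDeriv.deriv isOpen_ball) hGne).const_mul b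
  · have h1 : deriv (zDeriv (zDeriv f)) 0 = 1 := by
      rw [deriv_zDeriv_zero hf.analytic.zDeriv, deriv_zDeriv_zero hf.analytic, hf.deriv_zero]
    simp only [h1, hg.deriv_zDeriv_zero, ← hb]
    field_simp
  · intro z hz
    have := hGne z hz
    rw [hzg, deriv_const_mul_field]
    field_simp
  · intro z hz
    have h1 : (starRingEnd ℂ) (b / ‖b‖) * (b * (deriv (zDeriv (zDeriv f)) z / deriv (zDeriv g) z))
        = (‖b‖ : ℂ) * (deriv (zDeriv (zDeriv f)) z / deriv (zDeriv g) z) := by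
      have h2 : (starRingEnd ℂ) b * b = (‖b‖ : ℂ) * ‖b‖ := by
        rw [← Complex.normSq_eq_conj_mul_self, Complex.normSq_eq_norm_sq]; push_cast; ring
      rw [map_div₀, Complex.conj_ofReal]
      field_simp
      linear_combination (deriv (zDeriv (zDeriv f)) z / deriv (zDeriv g) z) * h2
    rw [h1, Complex.re_ofReal_mul]
    exact mul_pos (norm_pos_iff.mpr hb0) (hre z hz)

/-- The left side is the tangent at t = 1 of (3+t²)/(3(1+t)³). -/
theorem koebeMinor_div_ge {t : ℝ} (ht : t ∈ Set.Ioo (0 : ℝ) 1) :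
    1 / 3 - t / 6 ≤ koebeMinor t / t := by
  obtain ⟨h0, h1⟩ := ht
  have h : koebeMinor t / t = (3 + t ^ 2) / (3 * (1 + t) ^ 3) := by
    rw [koebeMinor]; field_simp
  rw [h, le_div_iff₀ (by positivity)]
  nlinarith [mul_pos h0 (sub_pos.mpr h1), mul_pos (mul_pos h0 h0) (sub_pos.mpr h1),
    mul_pos (mul_pos (mul_pos h0 h0) h0) (sub_pos.mpr h1), sq_nonneg (1 - t)]

section Growth

variable {N₂ N₃ : ℝ → ℝ}

/-- This leaves room to absorb the negative part of the correction, so that the density of the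
second integration is nonnegative. -/
theorem minor_two_ge (h20 : N₂ 0 = 0) (h2c : ContinuousOn N₂ (Set.Ico 0 1))
    (h2 : ∀ t ∈ Set.Ioo (0 : ℝ) 1, HasDerivAt N₂ (koebeMinor t / t) t) {t : ℝ}
    (ht : t ∈ Set.Ico (0 : ℝ) 1) : t / 3 - t ^ 2 / 12 ≤ N₂ t := by
  have hmono : MonotoneOn (fun t => N₂ t - (t / 3 - t ^ 2 / 12)) (Set.Ico 0 1) := by
    have hd : ∀ t ∈ Set.Ioo (0 : ℝ) 1, HasDerivAt (fun t => N₂ t - (t / 3 - t ^ 2 / 12))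
        (koebeMinor t / t - (1 / 3 - t / 6)) t := by
      intro t ht
      have h3 := (((hasDerivAt_id' t).div_const 3).sub (((hasDerivAt_id' t).fun_pow 2).div_const 12))
      convert! (h2 t ht).sub h3 using 2
      simp; ring
    apply monotoneOn_of_deriv_nonneg (convex_Ico _ _)
    · exact h2c.sub (by fun_prop)
    · intro t ht
      rw [interior_Ico] at ht
      exact (hd t ht).differentiableAt.differentiableWithinAt
    · intro t ht
      rw [interior_Ico] at ht
      rw [(hd t ht).deriv]
      linarith [koebeMinor_div_ge ht]
  have := hmono (Set.left_mem_Ico.mpr zero_lt_one) ht ht.1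
  simp only [h20] at this
  linarith

/-- The first integration, from z(zf')' to zf'. -/
theorem norm_zDeriv_ge {f : ℂ → ℂ} {x : ℝ} (hf : DifferentiableOn ℂ f (ball 0 1))
    (hH : Set.InjOn (zDeriv f) (ball 0 1))
    (hF : ∀ z ∈ ball (0 : ℂ) 1, z ≠ 0 →
      koebeMinor ‖z‖ + (1 - x) * (2 / 5 * (‖z‖ ^ 2 - 4 * ‖z‖ ^ 4)) ≤ ‖zDeriv (zDeriv f) z‖)
    (h20 : N₂ 0 = 0) (h2c : ContinuousOn N₂ (Set.Ico 0 1))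
    (h2 : ∀ t ∈ Set.Ioo (0 : ℝ) 1, HasDerivAt N₂ (koebeMinor t / t) t) {z : ℂ}
    (hz : z ∈ ball (0 : ℂ) 1) :
    N₂ ‖z‖ + (1 - x) * (‖z‖ ^ 2 / 5 - 2 * ‖z‖ ^ 4 / 5) ≤ ‖zDeriv f z‖ := by
  -- `growth_of_injOn` asks for a nonnegative density, which the correction may violate; truncation
  -- at 0 only raises the integral. The |t| makes the density continuous on the whole line.
  set b : ℝ → ℝ := fun t => max ((3 + t ^ 2) / (3 * (1 + |t|) ^ 3)
    + (1 - x) * (2 / 5 * (t - 4 * t ^ 3))) 0 with hb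
  have hbc : Continuous b := by
    have : ∀ t : ℝ, 3 * (1 + |t|) ^ 3 ≠ 0 := fun t => by positivity
    fun_prop (disch := assumption)
  set N : ℝ → ℝ := fun r => ∫ t in (0 : ℝ)..r, b t with hN
  have hNd : ∀ t, HasDerivAt N (b t) t := fun t =>
    intervalIntegral.integral_hasDerivAt_right (hbc.intervalIntegrable _ _)
      (hbc.stronglyMeasurableAtFilter _ _) hbc.continuousAt
  have hN0 : N 0 = 0 := by simp [hN]
  have hbt : ∀ t ∈ Set.Ioo (0 : ℝ) 1,
      b t = max (koebeMinor t / t + (1 - x) * (2 / 5 * (t - 4 * t ^ 3))) 0 := by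
    intro t ht
    have h0 := ht.1
    simp only [hb, abs_of_pos h0, koebeMinor]
    congr 2
    field_simp
  have hg : N ‖z‖ ≤ ‖zDeriv f z‖ := by
    refine growth_of_injOn hf.zDeriv hH (by simp [zDeriv]) hN0
      (fun t _ => (hNd t).continuousAt.continuousWithinAt) (fun t _ => hNd t)
      (fun t _ => le_max_right _ _) ?_ hz
    intro w hw hw0
    have hwn : 0 < ‖w‖ := norm_pos_iff.mpr hw0
    rw [hbt _ ⟨hwn, mem_ball_zero_iff.mp hw⟩]
    refine max_le ?_ (norm_nonneg _)
    have h1 := hF w hw hw0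
    rw [zDeriv, norm_mul] at h1
    refine le_of_mul_le_mul_left ?_ hwn
    calc ‖w‖ * (koebeMinor ‖w‖ / ‖w‖ + (1 - x) * (2 / 5 * (‖w‖ - 4 * ‖w‖ ^ 3)))
        = koebeMinor ‖w‖ + (1 - x) * (2 / 5 * (‖w‖ ^ 2 - 4 * ‖w‖ ^ 4)) := by field_simp
      _ ≤ _ := h1
  refine le_trans ?_ hg
  have hmono : MonotoneOn (fun t => N t - (N₂ t + (1 - x) * (t ^ 2 / 5 - 2 * t ^ 4 / 5)))
      (Set.Ico 0 1) := by
    have hd : ∀ t ∈ Set.Ioo (0 : ℝ) 1,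
        HasDerivAt (fun t => N t - (N₂ t + (1 - x) * (t ^ 2 / 5 - 2 * t ^ 4 / 5)))
        (b t - (koebeMinor t / t + (1 - x) * (2 / 5 * (t - 4 * t ^ 3)))) t := by
      intro t ht
      have h3 := ((((hasDerivAt_id' t).fun_pow 2).div_const 5).fun_sub
        ((((hasDerivAt_id' t).fun_pow 4).const_mul 2).div_const 5)).const_mul (1 - x)
      convert! (hNd t).fun_sub ((h2 t ht).fun_add h3) using 1
      push_cast; ring
    apply monotoneOn_of_deriv_nonneg (convex_Ico _ _)
    · have : ContinuousOn N (Set.Ico 0 1) := fun t _ => (hNd t).continuousAt.continuousWithinAt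
      exact this.sub (h2c.add (by fun_prop))
    · intro t ht
      rw [interior_Ico] at ht
      exact (hd t ht).differentiableAt.differentiableWithinAt
    · intro t ht
      rw [interior_Ico] at ht
      rw [(hd t ht).deriv, hbt t ht]
      linarith [le_max_left (koebeMinor t / t + (1 - x) * (2 / 5 * (t - 4 * t ^ 3))) 0]
  have := hmono (Set.left_mem_Ico.mpr zero_lt_one) ⟨norm_nonneg z, mem_ball_zero_iff.mp hz⟩
    (norm_nonneg z)
  simp only [hN0, h20] at this
  linarith

theorem deriv_eq_div {f : ℂ → ℂ} {z : ℂ} (h0 : z ≠ 0) : deriv f z = zDeriv f z / z := by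
  rw [zDeriv]; field_simp

/-- Functions of the class are univalent and satisfy a sharp lower growth bound. -/
theorem IsClassC3.injOn_and_growth {f : ℂ → ℂ} (hf : IsClassC3 f) (h20 : N₂ 0 = 0)
    (h2c : ContinuousOn N₂ (Set.Ico 0 1))
    (h2 : ∀ t ∈ Set.Ioo (0 : ℝ) 1, HasDerivAt N₂ (koebeMinor t / t) t) (h30 : N₃ 0 = 0)
    (h3c : ContinuousOn N₃ (Set.Ico 0 1))
    (h3 : ∀ t ∈ Set.Ioo (0 : ℝ) 1, HasDerivAt N₃ (N₂ t / t) t) :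
    Set.InjOn f (ball 0 1) ∧ ∀ z ∈ ball (0 : ℂ) 1, N₃ ‖z‖ ≤ ‖f z‖ := by
  obtain ⟨g, P, lam, hg, hg1, hlam, hx, hP, hP0, hFP, hre⟩ := hf.exists_normalized
  have hx1 : lam.re ≤ 1 := hlam ▸ Complex.re_le_norm lam
  have hG := hg.isStarlike_zDeriv hg1
  have hFd := hf.analytic.zDeriv.zDeriv
  have hF0 : zDeriv (zDeriv f) 0 = 0 := by simp [zDeriv]
  have hHd := hf.analytic.zDeriv
  -- `z f'` is close-to-convex with respect to `g`
  have hH : ∀ z ∈ ball (0 : ℂ) 1,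
      0 < ((starRingEnd ℂ) lam * (deriv (zDeriv f) z / deriv g z)).re := by
    intro z hz
    rcases eq_or_ne z 0 with rfl | h0
    · rw [deriv_zDeriv_zero hf.analytic, hf.deriv_zero, hg1]; simpa using hx
    · have h1 := re_mul_koebeMinor_le hG hFd hF0 hP hP0 hFP hlam hx hre hz h0
      have h2 : 0 < koebeMinor ‖z‖ := by
        have := norm_pos_iff.mpr h0
        rw [koebeMinor]; positivity
      have h4 := pos_of_mul_pos_right ((mul_pos hx h2).trans_le h1) (norm_nonneg _)
      rwa [mul_div_assoc, zDeriv, zDeriv, mul_div_mul_left _ _ h0] at h4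
  have hHinj := injOn_of_re_deriv_div_pos isOpen_ball hg.analytic hg.univalent hg.convex_image
    hHd hH
  have hHg : ∀ z ∈ ball (0 : ℂ) 1,
      N₂ ‖z‖ + (1 - lam.re) * (‖z‖ ^ 2 / 5 - 2 * ‖z‖ ^ 4 / 5) ≤ ‖zDeriv f z‖ := fun z hz =>
    norm_zDeriv_ge hf.analytic hHinj (fun z hz h0 =>
      koebeMinor_add_le_norm hG hFd hF0 hP hP0 hFP hlam hx hre hz h0) h20 h2c h2 hz
  -- `f` is close-to-convex with respect to the convex function `k` with `z k' = g`
  obtain ⟨k, hk, hk0, hkg, hk1⟩ := exists_mul_deriv_eq hg.analytic hg.map_zero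
  rw [hg1] at hk1
  have hkc := hg.of_mul_deriv_eq hg1 hk hk0 hk1 hkg
  have hq0 : 0 < ((starRingEnd ℂ) lam * (deriv f 0 / deriv k 0)).re := by
    rw [hf.deriv_zero, hk1]; simpa using hx
  have hfk : ∀ z ∈ ball (0 : ℂ) 1, 0 < ((starRingEnd ℂ) lam * (deriv f z / deriv k z)).re := by
    intro z hz
    refine re_pos_of_re_nonneg (q := fun z => (starRingEnd ℂ) lam * (deriv f z / deriv k z))
      (((hf.analytic.deriv isOpen_ball).div (hk.deriv isOpen_ball)
        fun w hw => hkc.deriv_ne_zero hw).const_mul _) ?_ hq0 hz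
    intro w hw
    rcases eq_or_ne w 0 with rfl | h0
    · exact hq0.le
    · have h1 := (hg.isStarlike hg1).re_div_nonneg
        (N := fun w => (starRingEnd ℂ) lam * zDeriv f w) (hHd.const_mul _) (by simp [zDeriv])
        (fun v hv => by
          rw [deriv_const_mul_field, mul_div_assoc]
          exact (hH v hv).le) hw h0
      rwa [mul_div_assoc, zDeriv, ← hkg w hw, mul_div_mul_left _ _ h0] at h1
  have hfinj := injOn_of_re_deriv_div_pos isOpen_ball hk hkc.univalent hkc.convex_image
    hf.analytic hfk
  refine ⟨hfinj, fun z hz => ?_⟩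
  -- The second integration turns the correction into (1 - Re λ)(t² - t⁴)/10, which is nonnegative
  -- on [0,1] and can be dropped.
  have hg := growth_of_injOn hf.analytic hfinj hf.map_zero
    (N := fun t => N₃ t + (1 - lam.re) * ((t ^ 2 - t ^ 4) / 10))
    (N' := fun t => (N₂ t + (1 - lam.re) * (t ^ 2 / 5 - 2 * t ^ 4 / 5)) / t) (by simp [h30])
    (h3c.add (by fun_prop)) ?_ ?_ ?_ hz
  · refine le_trans ?_ hg
    have hz1 := mem_ball_zero_iff.mp hz
    have h4 : ‖z‖ ^ 4 ≤ ‖z‖ ^ 2 :=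
      pow_le_pow_of_le_one (norm_nonneg z) hz1.le (by norm_num)
    have : 0 ≤ (1 - lam.re) * ((‖z‖ ^ 2 - ‖z‖ ^ 4) / 10) :=
      mul_nonneg (by linarith) (by linarith)
    linarith
  · intro t ht
    have h4 := (((hasDerivAt_id' t).fun_pow 2).sub ((hasDerivAt_id' t).fun_pow 4)).div_const 10
    have h5 := (h3 t ht).add (h4.const_mul (1 - lam.re))
    have h0 := ht.1.ne'
    convert! h5 using 1
    push_cast
    field_simp
    ring
  · intro t ht
    refine div_nonneg ?_ ht.1.le
    have h4 := minor_two_ge h20 h2c h2 ⟨ht.1.le, ht.2⟩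
    obtain ⟨ht0, ht1⟩ := ht
    have h5 : t ^ 4 ≤ t ^ 2 := pow_le_pow_of_le_one ht0.le ht1.le (by norm_num)
    have h6 : t ^ 2 ≤ t := by nlinarith
    have h7 : -(t ^ 2 / 5) ≤ t ^ 2 / 5 - 2 * t ^ 4 / 5 := by linarith
    have h8 : (1 - lam.re) * -(t ^ 2 / 5) ≤ (1 - lam.re) * (t ^ 2 / 5 - 2 * t ^ 4 / 5) :=
      mul_le_mul_of_nonneg_left h7 (by linarith)
    nlinarith [mul_pos hx (pow_pos ht0 2)]
  · intro w hw h0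
    have hwn := norm_pos_iff.mpr h0
    rw [deriv_eq_div h0, norm_div]
    gcongr
    exact hHg w hw

/-- Liouville's theorem for the inverse. It makes the frontier nonempty; `infDist` to the empty set
would be 0. -/
theorem image_ne_univ_of_injOn {f : ℂ → ℂ} (hf : DifferentiableOn ℂ f (ball 0 1))
    (hinj : Set.InjOn f (ball 0 1)) : f '' ball 0 1 ≠ Set.univ := by
  intro hU
  obtain ⟨ψ, hψ, hψ'⟩ := exists_leftInverse_hasDerivAt isOpen_ball hf hinj
  have hsur : ∀ w, ∃ z ∈ ball (0 : ℂ) 1, f z = w := fun w => by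
    have : w ∈ f '' ball 0 1 := hU ▸ Set.mem_univ w
    exact this
  have hd : Differentiable ℂ ψ := by
    intro w
    obtain ⟨z, hz, rfl⟩ := hsur w
    exact (hψ' z hz).differentiableAt
  have hbd : Bornology.IsBounded (Set.range ψ) := by
    refine isBounded_ball.subset (t := ball (0 : ℂ) 1) ?_
    rintro _ ⟨w, rfl⟩
    obtain ⟨z, hz, rfl⟩ := hsur w
    rw [hψ z hz]; exact hz
  have hhalf : (1 / 2 : ℂ) ∈ ball (0 : ℂ) 1 := by
    rw [mem_ball_zero_iff]; norm_num
  have h := hd.apply_eq_apply_of_bounded hbd (f 0) (f (1 / 2))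
  rw [hψ 0 (mem_ball_self one_pos), hψ _ hhalf] at h
  norm_num at h

/-- For c < J, values of modulus below c come from one closed disc, whose image is closed; so no
frontier point has modulus below J. -/
theorem le_boundaryDist_of_growth {f : ℂ → ℂ} (hf : DifferentiableOn ℂ f (ball 0 1))
    (hf0 : f 0 = 0) (hinj : Set.InjOn f (ball 0 1)) {J : ℝ}
    (hg : ∀ z ∈ ball (0 : ℂ) 1, N₃ ‖z‖ ≤ ‖f z‖)
    (hJ : Filter.Tendsto N₃ (nhdsWithin 1 (Set.Iio 1)) (nhds J)) : J ≤ boundaryDist f := by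
  have hopen : IsOpen (f '' ball 0 1) :=
    isOpen_image_of_deriv_ne_zero isOpen_ball hf
      fun z hz => deriv_ne_zero_of_injOn isOpen_ball hf hinj hz
  have hne : (frontier (f '' ball 0 1)).Nonempty :=
    nonempty_frontier_iff.mpr ⟨⟨f 0, 0, mem_ball_self one_pos, rfl⟩,
      image_ne_univ_of_injOn hf hinj⟩
  rw [boundaryDist, le_infDist hne, hf0]
  intro w hw
  rw [dist_zero_left]
  by_contra! hlt
  obtain ⟨c, hc1, hc2⟩ := exists_between hlt
  obtain ⟨r, hr, hsub⟩ := (mem_nhdsLT_iff_exists_Ioo_subset).mp (hJ.eventually_const_lt hc2)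
  have hr1 : r < 1 := hr
  rw [hopen.frontier_eq] at hw
  have hcl : IsClosed (f '' closedBall 0 r) :=
    ((isCompact_closedBall _ _).image_of_continuousOn
      (hf.continuousOn.mono (closedBall_subset_ball hr1))).isClosed
  have hmem : w ∈ f '' closedBall 0 r := by
    by_contra hno
    have hO : IsOpen ((f '' closedBall 0 r)ᶜ ∩ ball 0 c) := hcl.isOpen_compl.inter isOpen_ball
    obtain ⟨v, ⟨hv1, hv2⟩, z, hz, rfl⟩ := mem_closure_iff.mp hw.1 _ hO
      ⟨hno, mem_ball_zero_iff.mpr hc1⟩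
    have hzr : r < ‖z‖ := by
      by_contra! h
      exact hv1 ⟨z, mem_closedBall_zero_iff.mpr h, rfl⟩
    have h1 : c < N₃ ‖z‖ := hsub ⟨hzr, mem_ball_zero_iff.mp hz⟩
    have h2 := hg z hz
    have h3 := mem_ball_zero_iff.mp hv2
    linarith
  exact hw.2 (Set.image_mono (closedBall_subset_ball hr1) hmem)

end Growth

/-! ### Taylor coefficients and their bounds. -/

theorem circleAverage_inv_pow_mul {q : ℂ → ℂ} {r : ℝ} (hr : 0 < r)
    (hq : DiffContOnCl ℂ q (ball 0 r)) (n : ℕ) :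
    Real.circleAverage (fun z => z⁻¹ ^ n * q z) 0 r = taylorCoeff q n := by
  rw [Real.circleAverage_eq_circleIntegral hr.ne', taylorCoeff]
  have h := DiffContOnCl.circleIntegral_one_div_sub_center_pow_smul hr n hq
  have h2 : (∮ z in C(0, r), (z - 0)⁻¹ • (z⁻¹ ^ n * q z))
      = ∮ z in C(0, r), (1 / (z - 0) ^ (n + 1)) • q z := by
    congr 1; ext z; simp only [sub_zero, smul_eq_mul]
    rw [one_div, pow_succ, mul_inv, inv_pow]; ring
  rw [h2, h]
  have : (2 * Real.pi * Complex.I : ℂ) ≠ 0 := Complex.two_pi_I_ne_zero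
  simp only [smul_eq_mul]
  field_simp

theorem norm_circleAverage_le {q : ℂ → ℂ} {c : ℂ} {r : ℝ} :
    ‖Real.circleAverage q c r‖ ≤ Real.circleAverage (fun z => ‖q z‖) c r := by
  rw [Real.circleAverage, Real.circleAverage, norm_smul, smul_eq_mul, Real.norm_of_nonneg
    (by positivity)]
  gcongr
  exact intervalIntegral.norm_integral_le_integral_norm (by positivity)

/-- Carathéodory's bound for the Taylor coefficients of a function of positive real part. -/
theorem norm_taylorCoeff_le_of_re_pos {q : ℂ → ℂ} (hq : DifferentiableOn ℂ q (ball 0 1))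
    (hre : ∀ z ∈ ball (0 : ℂ) 1, 0 < (q z).re) {n : ℕ} (hn : n ≠ 0) :
    ‖taylorCoeff q n‖ ≤ 2 * (q 0).re := by
  have key : ∀ r ∈ Set.Ioo (0 : ℝ) 1, ‖taylorCoeff q n‖ * r ^ n ≤ 2 * (q 0).re := by
    rintro r ⟨h0, h1⟩
    have hsub : closedBall (0 : ℂ) r ⊆ ball 0 1 := closedBall_subset_ball h1
    have hd : DiffContOnCl ℂ q (ball 0 r) := (hq.mono hsub).diffContOnCl_ball subset_rfl
    have hcs : ContinuousOn q (sphere 0 r) :=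
      hq.continuousOn.mono (sphere_subset_closedBall.trans hsub)
    have hinv : ContinuousOn (fun z : ℂ => z⁻¹ ^ n) (sphere 0 r) :=
      (continuousOn_inv₀.mono fun z hz => by
        have : ‖z‖ = r := by simpa using hz
        rintro rfl
        simp [← this] at h0).pow n
    have hsph : ∀ z ∈ sphere (0 : ℂ) |r|, ‖z‖ = r := fun z hz => by
      simpa [abs_of_pos h0] using hz
    have e1 := circleAverage_inv_pow_mul h0 hd n
    -- On |z| = r the conjugate of z is r²/z, so this average is a multiple of the conjugate mean of
    -- zⁿq, which vanishes at n ≠ 0. Adding it replaces q by 2 Re q in the coefficient formula.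
    have e2 : Real.circleAverage (fun z => z⁻¹ ^ n * (starRingEnd ℂ) (q z)) 0 r = 0 := by
      have hz : Real.circleAverage (fun z => z ^ n * q z) 0 r = 0 := by
        rw [DiffContOnCl.circleAverage]
        · simp [hn]
        · rw [abs_of_pos h0]
          exact DiffContOnCl.smul (𝕜 := ℂ) (c := fun z : ℂ => z ^ n)
            (Differentiable.diffContOnCl (by fun_prop)) hd
      have hci : CircleIntegrable (fun z => z ^ n * q z) 0 r :=
        ContinuousOn.circleIntegrable h0.le ((continuous_pow n).continuousOn.mul hcs)
      have h3 := Complex.conjCLE.toContinuousLinearMap.circleAverage_comp_comm hci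
      rw [hz, map_zero] at h3
      have h4 : Real.circleAverage (⇑Complex.conjCLE.toContinuousLinearMap ∘ fun z => z ^ n * q z)
          0 r = Real.circleAverage
            (fun z => ((r : ℂ) ^ (2 * n)) • (z⁻¹ ^ n * (starRingEnd ℂ) (q z))) 0 r := by
        refine Real.circleAverage_congr_sphere fun z hz => ?_
        have hzr := hsph z hz
        have hz0 : z ≠ 0 := by rintro rfl; simp at hzr; linarith
        have h5 : (starRingEnd ℂ) z = (r : ℂ) ^ 2 * z⁻¹ := by
          rw [eq_mul_inv_iff_mul_eq₀ hz0, ← Complex.normSq_eq_conj_mul_self,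
            Complex.normSq_eq_norm_sq, hzr]
          push_cast; ring
        simp only [Function.comp_apply, ContinuousLinearEquiv.coe_coe, Complex.conjCLE_apply,
          map_mul, map_pow, h5, smul_eq_mul]
        ring
      rw [h4, Real.circleAverage_fun_smul, smul_eq_zero] at h3
      exact h3.resolve_left (pow_ne_zero _ (by exact_mod_cast h0.ne'))
    have i1 : CircleIntegrable (fun z => z⁻¹ ^ n * q z) 0 r :=
      ContinuousOn.circleIntegrable h0.le (hinv.mul hcs)
    have i2 : CircleIntegrable (fun z => z⁻¹ ^ n * (starRingEnd ℂ) (q z)) 0 r :=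
      ContinuousOn.circleIntegrable h0.le
        (hinv.mul (Complex.continuous_conj.comp_continuousOn hcs))
    have e3 := Real.circleAverage_fun_add i1 i2
    rw [e1, e2, add_zero] at e3
    have i3 : CircleIntegrable q 0 r := ContinuousOn.circleIntegrable h0.le hcs
    have e4 : Real.circleAverage (fun z => (q z).re) 0 r = (q 0).re := by
      have h3 := Complex.reCLM.circleAverage_comp_comm i3
      rw [DiffContOnCl.circleAverage (by rwa [abs_of_pos h0])] at h3
      exact h3
    have e5 : Real.circleAverage (fun z => ‖z⁻¹ ^ n * q z + z⁻¹ ^ n * (starRingEnd ℂ) (q z)‖) 0 r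
        = Real.circleAverage (fun z => ((r⁻¹) ^ n * 2) • (q z).re) 0 r := by
      refine Real.circleAverage_congr_sphere fun z hz => ?_
      have hzr := hsph z hz
      have hz1 : z ∈ ball (0 : ℂ) 1 := by simpa [hzr] using h1
      simp only [smul_eq_mul]
      rw [← mul_add, Complex.add_conj, norm_mul, norm_pow, norm_inv, hzr, Complex.norm_real,
        Real.norm_of_nonneg (by linarith [hre z hz1])]
      ring
    have h6 : ‖taylorCoeff q n‖ ≤ ((r⁻¹) ^ n * 2) * (q 0).re := by
      rw [← e3]
      refine norm_circleAverage_le.trans_eq ?_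
      rw [e5, Real.circleAverage_fun_smul, e4, smul_eq_mul]
    calc ‖taylorCoeff q n‖ * r ^ n ≤ ((r⁻¹) ^ n * 2) * (q 0).re * r ^ n := by gcongr
      _ = 2 * (q 0).re := by rw [inv_pow]; field_simp
  have hc : Filter.Tendsto (fun r : ℝ => ‖taylorCoeff q n‖ * r ^ n) (nhdsWithin 1 (Set.Iio 1))
      (nhds (‖taylorCoeff q n‖ * 1 ^ n)) :=
    Filter.Tendsto.mono_left (Continuous.tendsto (by fun_prop) 1) nhdsWithin_le_nhds
  rw [one_pow, mul_one] at hc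
  exact le_of_tendsto hc (Filter.eventually_of_mem (Ioo_mem_nhdsLT zero_lt_one) key)

theorem taylorCoeff_congr {f g : ℂ → ℂ} (h : ∀ z ∈ ball (0 : ℂ) 1, f z = g z) (n : ℕ) :
    taylorCoeff f n = taylorCoeff g n := by
  rw [taylorCoeff, taylorCoeff, Filter.EventuallyEq.iteratedDeriv_eq]
  exact Filter.eventually_of_mem (ball_mem_nhds 0 one_pos) h

theorem taylorCoeff_const_mul (c : ℂ) (f : ℂ → ℂ) (n : ℕ) :
    taylorCoeff (fun z => c * f z) n = c * taylorCoeff f n := by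
  rw [taylorCoeff, taylorCoeff, iteratedDeriv_const_mul_field, mul_div_assoc]

theorem taylorCoeff_deriv (f : ℂ → ℂ) (n : ℕ) :
    taylorCoeff (deriv f) n = (n + 1) * taylorCoeff f (n + 1) := by
  rw [taylorCoeff, taylorCoeff, ← iteratedDeriv_succ', Nat.factorial_succ]
  have : (n.factorial : ℂ) ≠ 0 := by exact_mod_cast n.factorial_ne_zero
  have : (n + 1 : ℂ) ≠ 0 := by exact_mod_cast n.succ_ne_zero
  push_cast
  field_simp

theorem DifferentiableOn.contDiffAt_zero {f : ℂ → ℂ} (hf : DifferentiableOn ℂ f (ball 0 1))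
    (n : ℕ) : ContDiffAt ℂ n f 0 :=
  (hf.analyticAt (ball_mem_nhds 0 one_pos)).contDiffAt

theorem taylorCoeff_mul {f g : ℂ → ℂ} (hf : DifferentiableOn ℂ f (ball 0 1))
    (hg : DifferentiableOn ℂ g (ball 0 1)) (n : ℕ) :
    taylorCoeff (fun z => f z * g z) n
      = ∑ k ∈ Finset.range (n + 1), taylorCoeff f k * taylorCoeff g (n - k) := by
  rw [taylorCoeff, iteratedDeriv_fun_mul (hf.contDiffAt_zero n) (hg.contDiffAt_zero n),
    Finset.sum_div]
  refine Finset.sum_congr rfl fun k hk => ?_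
  have hk' : k ≤ n := Nat.lt_succ_iff.mp (Finset.mem_range.mp hk)
  rw [taylorCoeff, taylorCoeff, Nat.cast_choose ℂ hk']
  have h1 : (n.factorial : ℂ) ≠ 0 := by exact_mod_cast n.factorial_ne_zero
  field_simp

theorem taylorCoeff_zero (f : ℂ → ℂ) : taylorCoeff f 0 = f 0 := by
  simp [taylorCoeff]

theorem taylorCoeff_one (f : ℂ → ℂ) : taylorCoeff f 1 = deriv f 0 := by
  simp [taylorCoeff]

theorem taylorCoeff_id_mul {f : ℂ → ℂ} (hf : DifferentiableOn ℂ f (ball 0 1)) (n : ℕ) :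
    taylorCoeff (fun z => z * f z) (n + 1) = taylorCoeff f n := by
  rw [taylorCoeff_mul (f := fun z => z) differentiableOn_id hf,
    Finset.sum_eq_single 1 _ (by simp)]
  · rw [taylorCoeff_one, deriv_id'', one_mul, Nat.add_sub_cancel]
  · intro k _ hk
    have : taylorCoeff (fun z : ℂ => z) k = 0 := by
      rcases k with _ | _ | k
      · simp [taylorCoeff]
      · simp at hk
      · rw [taylorCoeff, iteratedDeriv_succ', iteratedDeriv_succ']
        simp
    rw [this, zero_mul]

theorem taylorCoeff_zDeriv {f : ℂ → ℂ} (hf : DifferentiableOn ℂ f (ball 0 1)) (n : ℕ) :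
    taylorCoeff (zDeriv f) n = n * taylorCoeff f n := by
  rcases n with _ | n
  · simp [taylorCoeff, zDeriv]
  · rw [show zDeriv f = fun z => z * deriv f z from rfl,
      taylorCoeff_id_mul (hf.deriv isOpen_ball), taylorCoeff_deriv]
    push_cast; ring

theorem hasSum_taylorCoeff {f : ℂ → ℂ} (hf : DifferentiableOn ℂ f (ball 0 1)) {z : ℂ}
    (hz : z ∈ ball (0 : ℂ) 1) : HasSum (fun n => taylorCoeff f n * z ^ n) (f z) := by
  convert! Complex.hasSum_taylorSeries_on_ball hf hz using 2 with n
  rw [taylorCoeff, sub_zero, smul_eq_mul, smul_eq_mul]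
  ring

/-- The Taylor coefficients of a normalized convex function are bounded by one. -/
theorem IsConvexFunction.norm_taylorCoeff_le {g : ℂ → ℂ} (hg : IsConvexFunction g)
    (hg1 : deriv g 0 = 1) (n : ℕ) : ‖taylorCoeff g n‖ ≤ 1 := by
  have hne := fun z hz => hg.deriv_ne_zero (z := z) hz
  set Q : ℂ → ℂ := fun z => deriv (zDeriv g) z / deriv g z with hQ
  have hgd := hg.analytic.deriv isOpen_ball
  have hQd : DifferentiableOn ℂ Q (ball 0 1) :=
    (hg.analytic.zDeriv.deriv isOpen_ball).div hgd hne
  have hQ0 : Q 0 = 1 := by simp [hQ, hg.deriv_zDeriv_zero, hg1]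
  have hQn : ∀ k, ‖taylorCoeff Q k‖ ≤ 2 := by
    intro k
    rcases eq_or_ne k 0 with rfl | hk
    · simp [taylorCoeff_zero, hQ0]
    · simpa [hQ0] using
        norm_taylorCoeff_le_of_re_pos hQd (fun z hz => hg.re_deriv_zDeriv_div_pos hz) hk
  have hrec : ∀ n : ℕ, (n + 1 : ℂ) * ((n + 1) * taylorCoeff g (n + 1))
      = ∑ k ∈ Finset.range (n + 1), ((k + 1) * taylorCoeff g (k + 1)) * taylorCoeff Q (n - k) := by
    intro n
    have h1 : taylorCoeff (deriv (zDeriv g)) n = taylorCoeff (fun z => deriv g z * Q z) n :=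
      taylorCoeff_congr (fun z hz => by
        have := hne z hz
        simp only [hQ]; field_simp) n
    rw [taylorCoeff_deriv, taylorCoeff_zDeriv hg.analytic, taylorCoeff_mul hgd hQd] at h1
    push_cast at h1
    rw [h1]
    simp only [taylorCoeff_deriv]
  induction n using Nat.strong_induction_on with
  | _ n ih =>
    rcases n with _ | n
    · simp [taylorCoeff_zero, hg.map_zero]
    rcases n with _ | m
    · simp [taylorCoeff_one, hg1]
    have h := hrec (m + 1)
    rw [Finset.sum_range_succ] at h
    simp only [Nat.sub_self, taylorCoeff_zero Q, hQ0, mul_one] at h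
    -- The last term has Q(0) = 1 and moves to the left: (m+2)² - (m+2) = (m+2)(m+1), which equals
    -- the sum of the bounds 2(k+1) on the right.
    have h2 : (((m + 1 : ℕ) : ℂ) + 1) * (m + 1) * taylorCoeff g (m + 1 + 1)
        = ∑ k ∈ Finset.range (m + 1),
          ((k + 1) * taylorCoeff g (k + 1)) * taylorCoeff Q (m + 1 - k) := by
      push_cast at h ⊢
      linear_combination h
    have h3 := congrArg norm h2
    have h4 : ‖∑ k ∈ Finset.range (m + 1),
        (((k : ℂ) + 1) * taylorCoeff g (k + 1)) * taylorCoeff Q (m + 1 - k)‖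
        ≤ ∑ k ∈ Finset.range (m + 1), ((k : ℝ) + 1) * 2 := by
      refine norm_sum_le_of_le _ fun k hk => ?_
      have hk' := Finset.mem_range.mp hk
      rw [norm_mul, norm_mul]
      have e : ‖(k : ℂ) + 1‖ = k + 1 := by
        rw [← Nat.cast_succ, Complex.norm_natCast]; push_cast; ring
      rw [e]
      have := ih (k + 1) (by omega)
      calc ((k : ℝ) + 1) * ‖taylorCoeff g (k + 1)‖ * ‖taylorCoeff Q (m + 1 - k)‖
          ≤ ((k : ℝ) + 1) * 1 * 2 := by gcongr; exact hQn _
        _ = _ := by ring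
    have h5 : ∑ k ∈ Finset.range (m + 1), ((k : ℝ) + 1) * 2 = (m + 1) * (m + 2) := by
      clear * -
      induction m with
      | zero => norm_num
      | succ m ih => rw [Finset.sum_range_succ, ih]; push_cast; ring
    rw [← h3, h5, norm_mul, norm_mul] at h4
    have e1 : ‖((m + 1 : ℕ) : ℂ) + 1‖ = m + 2 := by
      rw [← Nat.cast_succ, Complex.norm_natCast]; push_cast; ring
    have e2 : ‖(m : ℂ) + 1‖ = m + 1 := by
      rw [← Nat.cast_succ, Complex.norm_natCast]; push_cast; ring
    rw [e1, e2] at h4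
    refine le_of_mul_le_mul_left (a := ((m : ℝ) + 2) * (m + 1)) ?_ (by positivity)
    linarith

/-- The extremal coefficients `2/3 + 1/(3n²)`. -/
noncomputable def extremalCoeff (n : ℕ) : ℝ := 2 / 3 + 1 / (3 * (n : ℝ) ^ 2)

/-- The left side is the recurrence `taylorCoeff_recurrence` with every coefficient at its bound: 1
for g, 2 for P, and 1 for the constant term of P. -/
theorem sum_sq_eq_extremalCoeff (n : ℕ) :
    ∑ k ∈ Finset.range n, ((k : ℝ) + 1) ^ 2 * 2 + (n + 1) ^ 2
      = (n + 1) ^ 3 * extremalCoeff (n + 1) := by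
  have h : ∑ k ∈ Finset.range n, ((k : ℝ) + 1) ^ 2 * 2
      = (n : ℝ) * (n + 1) * (2 * n + 1) / 3 := by
    induction n with
    | zero => norm_num
    | succ m ih => rw [Finset.sum_range_succ, ih]; push_cast; ring
  rw [h, extremalCoeff]
  push_cast
  field_simp
  ring

theorem taylorCoeff_recurrence {f g P : ℂ → ℂ} (hf : DifferentiableOn ℂ f (ball 0 1))
    (hg : DifferentiableOn ℂ g (ball 0 1)) (hP : DifferentiableOn ℂ P (ball 0 1))
    (h : ∀ z ∈ ball (0 : ℂ) 1,
      deriv (zDeriv (zDeriv f)) z = P z * deriv (zDeriv g) z) (n : ℕ) :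
    ((n : ℂ) + 1) ^ 3 * taylorCoeff f (n + 1)
      = ∑ k ∈ Finset.range (n + 1),
        (((k : ℂ) + 1) ^ 2 * taylorCoeff g (k + 1)) * taylorCoeff P (n - k) := by
  have h1 : taylorCoeff (deriv (zDeriv (zDeriv f))) n
      = taylorCoeff (fun z => deriv (zDeriv g) z * P z) n :=
    taylorCoeff_congr (fun z hz => by rw [h z hz, mul_comm]) n
  rw [taylorCoeff_deriv, taylorCoeff_zDeriv hf.zDeriv, taylorCoeff_zDeriv hf,
    taylorCoeff_mul (hg.zDeriv.deriv isOpen_ball) hP] at h1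
  push_cast at h1
  rw [show ((n : ℂ) + 1) ^ 3 * taylorCoeff f (n + 1)
    = (n + 1) * ((n + 1) * ((n + 1) * taylorCoeff f (n + 1))) by ring, h1]
  refine Finset.sum_congr rfl fun k _ => ?_
  rw [taylorCoeff_deriv, taylorCoeff_zDeriv hg]
  push_cast; ring

theorem IsClassC3.norm_taylorCoeff_le {f : ℂ → ℂ} (hf : IsClassC3 f) (n : ℕ) :
    ‖taylorCoeff f (n + 1)‖ ≤ extremalCoeff (n + 1) := by
  obtain ⟨g, P, lam, hg, hg1, hlam, hx, hP, hP0, hFP, hre⟩ := hf.exists_normalized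
  -- Carathéodory's bound for λ̄P, whose value at 0 has real part Re λ ≤ 1.
  have hPn : ∀ k, k ≠ 0 → ‖taylorCoeff P k‖ ≤ 2 := by
    intro k hk
    have h1 := norm_taylorCoeff_le_of_re_pos (hP.const_mul ((starRingEnd ℂ) lam)) hre hk
    rw [taylorCoeff_const_mul, norm_mul, RCLike.norm_conj, hlam, one_mul, hP0, mul_one,
      Complex.conj_re] at h1
    linarith [hlam ▸ Complex.re_le_norm lam]
  have hrec := taylorCoeff_recurrence hf.analytic hg.analytic hP hFP n
  rw [Finset.sum_range_succ, Nat.sub_self, taylorCoeff_zero P, hP0, mul_one] at hrec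
  have e : ∀ k : ℕ, ‖(k : ℂ) + 1‖ = k + 1 := by
    intro k
    rw [← Nat.cast_succ, Complex.norm_natCast]; push_cast; ring
  have h3 := congrArg norm hrec
  rw [norm_mul, norm_pow, e] at h3
  refine le_of_mul_le_mul_left (a := ((n : ℝ) + 1) ^ 3) ?_ (by positivity)
  rw [h3, ← sum_sq_eq_extremalCoeff]
  refine (norm_add_le _ _).trans (add_le_add (norm_sum_le_of_le _ fun k hk => ?_) ?_)
  · have hk' := Finset.mem_range.mp hk
    rw [norm_mul, norm_mul, norm_pow, e]
    calc ((k : ℝ) + 1) ^ 2 * ‖taylorCoeff g (k + 1)‖ * ‖taylorCoeff P (n - k)‖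
        ≤ ((k : ℝ) + 1) ^ 2 * 1 * 2 := by
          gcongr
          · exact hg.norm_taylorCoeff_le hg1 _
          · exact hPn _ (by omega)
      _ = _ := by ring
  · rw [norm_mul, norm_pow, e]
    exact mul_le_of_le_one_right (by positivity) (hg.norm_taylorCoeff_le hg1 _)

/-! ### The extremal function. -/

theorem one_sub_ne_zero_of_mem_ball {z : ℂ} (hz : z ∈ ball (0 : ℂ) 1) : 1 - z ≠ 0 := by
  intro h
  rw [mem_ball_zero_iff, ← sub_eq_zero.mp h, norm_one] at hz
  exact lt_irrefl _ hz

theorem image_div_one_sub :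
    (fun z : ℂ => z / (1 - z)) '' ball 0 1 = {w : ℂ | -(1 / 2) < w.re} := by
  have key : ∀ w : ℂ, ‖w‖ < ‖1 + w‖ ↔ -(1 / 2) < w.re := by
    intro w
    rw [← sq_lt_sq₀ (norm_nonneg _) (norm_nonneg _), ← Complex.normSq_eq_norm_sq,
      ← Complex.normSq_eq_norm_sq, Complex.normSq_apply, Complex.normSq_apply]
    simp only [Complex.add_re, Complex.add_im, Complex.one_re, Complex.one_im]
    constructor <;> intro h <;> nlinarith
  ext w
  simp only [Set.mem_image, Set.mem_ofPred_eq]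
  rw [← key]
  constructor
  · rintro ⟨z, hz, rfl⟩
    have h1 := one_sub_ne_zero_of_mem_ball hz
    have h2 : 1 + z / (1 - z) = 1 / (1 - z) := by field_simp; ring
    rw [h2, norm_div, norm_div, norm_one]
    exact div_lt_div_of_pos_right (mem_ball_zero_iff.mp hz) (norm_pos_iff.mpr h1)
  · intro h
    have h0 : 0 < ‖1 + w‖ := (norm_nonneg w).trans_lt h
    have h1 : 1 + w ≠ 0 := norm_pos_iff.mp h0
    refine ⟨w / (1 + w), ?_, ?_⟩
    · rwa [mem_ball_zero_iff, norm_div, div_lt_one h0]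
    · have h2 : 1 - w / (1 + w) = 1 / (1 + w) := by field_simp; ring
      simp only [h2]
      field_simp

theorem hasDerivAt_div_one_sub {z : ℂ} (hz : z ∈ ball (0 : ℂ) 1) :
    HasDerivAt (fun z : ℂ => z / (1 - z)) (1 / (1 - z) ^ 2) z := by
  have h1 := one_sub_ne_zero_of_mem_ball hz
  convert! (hasDerivAt_id' z).fun_div ((hasDerivAt_id' z).const_sub 1) h1 using 1
  field_simp
  ring

theorem isConvexFunction_div_one_sub : IsConvexFunction fun z : ℂ => z / (1 - z) where
  analytic := fun z hz => (hasDerivAt_div_one_sub hz).differentiableAt.differentiableWithinAt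
  map_zero := by simp
  re_deriv_pos := by
    rw [(hasDerivAt_div_one_sub (mem_ball_self one_pos)).deriv]
    simp
  univalent := by
    intro z hz w hw h
    have h1 := one_sub_ne_zero_of_mem_ball hz
    have h2 := one_sub_ne_zero_of_mem_ball hw
    simp only at h
    rw [div_eq_div_iff h1 h2] at h
    linear_combination h
  convex_image := by
    rw [image_div_one_sub]
    exact convex_halfSpace_re_gt _

theorem deriv_zDeriv_div_one_sub {z : ℂ} (hz : z ∈ ball (0 : ℂ) 1) :
    deriv (zDeriv fun z : ℂ => z / (1 - z)) z = (1 + z) / (1 - z) ^ 3 := by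
  have h1 := one_sub_ne_zero_of_mem_ball hz
  have h2 : zDeriv (fun z : ℂ => z / (1 - z)) =ᶠ[nhds z] fun z => z / (1 - z) ^ 2 := by
    filter_upwards [isOpen_ball.mem_nhds hz] with w hw
    rw [zDeriv, (hasDerivAt_div_one_sub hw).deriv, mul_one_div]
  rw [h2.deriv_eq]
  refine HasDerivAt.deriv ?_
  convert! (hasDerivAt_id' z).fun_div (((hasDerivAt_id' z).const_sub 1).fun_pow 2)
    (pow_ne_zero 2 h1) using 1
  field_simp
  push_cast
  ring

theorem differentiableOn_inv_one_sub : DifferentiableOn ℂ (fun z : ℂ => (1 - z)⁻¹) (ball 0 1) :=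
  DifferentiableOn.inv (by fun_prop) fun _ hz => one_sub_ne_zero_of_mem_ball hz

theorem taylorCoeff_add {f g : ℂ → ℂ} (hf : DifferentiableOn ℂ f (ball 0 1))
    (hg : DifferentiableOn ℂ g (ball 0 1)) (n : ℕ) :
    taylorCoeff (fun z => f z + g z) n = taylorCoeff f n + taylorCoeff g n := by
  rw [taylorCoeff, iteratedDeriv_fun_add (hf.contDiffAt_zero n) (hg.contDiffAt_zero n), add_div]
  rfl

theorem taylorCoeff_inv_one_sub (n : ℕ) : taylorCoeff (fun z : ℂ => (1 - z)⁻¹) n = 1 := by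
  induction n with
  | zero => simp [taylorCoeff_zero]
  | succ n ih =>
    rw [taylorCoeff_congr (g := fun z => 1 + z * (1 - z)⁻¹), taylorCoeff_add
      (g := fun z => z * (1 - z)⁻¹) (differentiableOn_const 1)
      (differentiableOn_id.mul differentiableOn_inv_one_sub),
      taylorCoeff_id_mul differentiableOn_inv_one_sub, ih]
    · rw [taylorCoeff, iteratedDeriv_succ']
      simp
    · intro z hz
      have := one_sub_ne_zero_of_mem_ball hz
      field_simp
      ring

theorem taylorCoeff_div_one_sub (n : ℕ) : taylorCoeff (fun z : ℂ => z / (1 - z)) (n + 1) = 1 := by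
  simp only [div_eq_mul_inv]
  rw [taylorCoeff_id_mul differentiableOn_inv_one_sub, taylorCoeff_inv_one_sub]

theorem differentiableOn_cayley :
    DifferentiableOn ℂ (fun z : ℂ => (1 + z) / (1 - z)) (ball 0 1) :=
  DifferentiableOn.div (by fun_prop) (by fun_prop) fun _ hz => one_sub_ne_zero_of_mem_ball hz

theorem taylorCoeff_cayley (n : ℕ) :
    taylorCoeff (fun z : ℂ => (1 + z) / (1 - z)) (n + 1) = 2 := by
  rw [taylorCoeff_congr (g := fun z => (1 - z)⁻¹ + z * (1 - z)⁻¹), taylorCoeff_add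
    (g := fun z => z * (1 - z)⁻¹) differentiableOn_inv_one_sub
    (differentiableOn_id.mul differentiableOn_inv_one_sub),
    taylorCoeff_id_mul differentiableOn_inv_one_sub, taylorCoeff_inv_one_sub,
    taylorCoeff_inv_one_sub]
  · norm_num
  · intro z _
    rw [div_eq_mul_inv, add_mul, one_mul]

theorem re_cayley_pos {z : ℂ} (hz : z ∈ ball (0 : ℂ) 1) : 0 < ((1 + z) / (1 - z)).re := by
  have h1 := one_sub_ne_zero_of_mem_ball hz
  have h2 : z / (1 - z) ∈ {w : ℂ | -(1 / 2) < w.re} :=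
    image_div_one_sub ▸ Set.mem_image_of_mem (fun z : ℂ => z / (1 - z)) hz
  have h3 : (1 + z) / (1 - z) = 1 + 2 * (z / (1 - z)) := by field_simp; ring
  rw [h3]
  simp only [Set.mem_ofPred_eq] at h2
  simp only [Complex.add_re, Complex.one_re, Complex.mul_re, Complex.re_ofNat, Complex.im_ofNat]
  linarith

theorem hasDerivAt_extremal {z : ℂ} (hz : z ∈ ball (0 : ℂ) 1) :
    HasDerivAt (fun z : ℂ => z * (3 + z ^ 2) / (3 * (1 - z) ^ 3)) ((1 + z) ^ 2 / (1 - z) ^ 4) z := by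
  have h1 := one_sub_ne_zero_of_mem_ball hz
  convert! ((hasDerivAt_id' z).fun_mul (((hasDerivAt_id' z).fun_pow 2).const_add 3)).fun_div
    ((((hasDerivAt_id' z).const_sub 1).fun_pow 3).const_mul 3)
    (mul_ne_zero three_ne_zero (pow_ne_zero 3 h1)) using 1
  field_simp
  push_cast
  ring

/-- The function with `(z (z f')')' = (1 + z)² / (1 - z)⁴`, which is extremal for the class. -/
theorem exists_extremal : ∃ f : ℂ → ℂ, IsClassC3 f ∧
    (∀ n : ℕ, taylorCoeff f (n + 1) = extremalCoeff (n + 1)) ∧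
    ∀ z ∈ ball (0 : ℂ) 1, zDeriv (zDeriv f) z = z * (3 + z ^ 2) / (3 * (1 - z) ^ 3) := by
  -- F is the primitive of (1+z)²/(1-z)⁴, and f arises by inverting z d/dz twice. The data are g =
  -- z/(1-z) and P = (1+z)/(1-z).
  set F : ℂ → ℂ := fun z => z * (3 + z ^ 2) / (3 * (1 - z) ^ 3) with hF
  have hFd : DifferentiableOn ℂ F (ball 0 1) := fun z hz =>
    (hasDerivAt_extremal hz).differentiableAt.differentiableWithinAt
  obtain ⟨H, hH, hH0, hHF, hH1⟩ := exists_mul_deriv_eq hFd (by simp [hF])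
  obtain ⟨f, hf, hf0, hfH, hf1⟩ := exists_mul_deriv_eq hH hH0
  have e1 : ∀ z ∈ ball (0 : ℂ) 1, zDeriv f z = H z := hfH
  have e2 : ∀ z ∈ ball (0 : ℂ) 1, zDeriv (zDeriv f) z = F z := by
    intro z hz
    have : zDeriv f =ᶠ[nhds z] H := Filter.eventually_of_mem (isOpen_ball.mem_nhds hz) e1
    rw [zDeriv, this.deriv_eq, hHF z hz]
  have e3 : ∀ z ∈ ball (0 : ℂ) 1, deriv (zDeriv (zDeriv f)) z = (1 + z) ^ 2 / (1 - z) ^ 4 := by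
    intro z hz
    have : zDeriv (zDeriv f) =ᶠ[nhds z] F :=
      Filter.eventually_of_mem (isOpen_ball.mem_nhds hz) e2
    rw [this.deriv_eq, (hasDerivAt_extremal hz).deriv]
  have e4 : ∀ z ∈ ball (0 : ℂ) 1, deriv (zDeriv (zDeriv f)) z
      = (1 + z) / (1 - z) * deriv (zDeriv fun z : ℂ => z / (1 - z)) z := by
    intro z hz
    have h1 := one_sub_ne_zero_of_mem_ball hz
    rw [e3 z hz, deriv_zDeriv_div_one_sub hz]
    field_simp
  refine ⟨f, ⟨hf, hf0, ?_, _, isConvexFunction_div_one_sub, ?_⟩, ?_, e2⟩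
  · rw [hf1, hH1, (hasDerivAt_extremal (mem_ball_self one_pos)).deriv]
    simp
  · intro z hz
    rw [e4 z hz, mul_div_assoc, div_self, mul_one]
    · exact re_cayley_pos hz
    · rw [deriv_zDeriv_div_one_sub hz]
      have hre := re_cayley_pos hz
      refine div_ne_zero (fun h => ?_) (pow_ne_zero 3 (one_sub_ne_zero_of_mem_ball hz))
      simp [h] at hre
  · intro n
    have h := taylorCoeff_recurrence hf isConvexFunction_div_one_sub.analytic
      differentiableOn_cayley e4 n
    rw [Finset.sum_range_succ, Nat.sub_self, taylorCoeff_zero, taylorCoeff_div_one_sub] at h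
    have h2 : ∑ k ∈ Finset.range n, ((k : ℂ) + 1) ^ 2
          * taylorCoeff (fun z : ℂ => z / (1 - z)) (k + 1)
          * taylorCoeff (fun z : ℂ => (1 + z) / (1 - z)) (n - k)
        = ∑ k ∈ Finset.range n, ((k : ℂ) + 1) ^ 2 * 2 := by
      refine Finset.sum_congr rfl fun k hk => ?_
      obtain ⟨m, hm⟩ : ∃ m, n - k = m + 1 :=
        ⟨n - k - 1, by have := Finset.mem_range.mp hk; omega⟩
      rw [hm, taylorCoeff_cayley, taylorCoeff_div_one_sub, mul_one]
    have h3 := congrArg (fun x : ℝ => (x : ℂ)) (sum_sq_eq_extremalCoeff n)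
    push_cast at h3
    rw [h2] at h
    have hn : ((n : ℂ) + 1) ^ 3 ≠ 0 := pow_ne_zero 3 (by exact_mod_cast n.succ_ne_zero)
    refine mul_left_cancel₀ hn ?_
    rw [h, ← h3]
    simp

theorem extremalCoeff_nonneg (n : ℕ) : 0 ≤ extremalCoeff n := by
  rw [extremalCoeff]; positivity

theorem extremalCoeff_le_one {n : ℕ} (hn : n ≠ 0) : extremalCoeff n ≤ 1 := by
  have h : (1 : ℝ) ≤ n := by exact_mod_cast Nat.one_le_iff_ne_zero.mpr hn
  have : 1 / (3 * (n : ℝ) ^ 2) ≤ 1 / 3 :=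
    one_div_le_one_div_of_le (by norm_num) (by nlinarith)
  rw [extremalCoeff]
  linarith

/-! ### The boundary value of the extremal function at -1. -/

/-- The alternating series `∑ (-1)ⁿ / n²` sums to `-π² / 12`. -/
theorem hasSum_neg_one_pow_div_sq :
    HasSum (fun n : ℕ => (-1 : ℝ) ^ n / (n : ℝ) ^ 2) (-(Real.pi ^ 2 / 12)) := by
  have hz := hasSum_zeta_two
  have he : HasSum (fun k : ℕ => 1 / ((2 * k : ℕ) : ℝ) ^ 2) (1 / 4 * (Real.pi ^ 2 / 6)) := by
    convert! hz.mul_left (1 / 4) using 2 with k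
    push_cast
    rw [mul_pow, div_mul_div_comm]
    norm_num
  have ho : Summable (fun k : ℕ => 1 / ((2 * k + 1 : ℕ) : ℝ) ^ 2) :=
    hz.summable.comp_injective (i := fun k : ℕ => 2 * k + 1) fun a b h => by simpa using h
  have hs := (he.even_add_odd (f := fun n : ℕ => 1 / (n : ℝ) ^ 2) ho.hasSum).unique hz
  have h2 := HasSum.even_add_odd (f := fun n : ℕ => (-1 : ℝ) ^ n / (n : ℝ) ^ 2)
    (m := 1 / 4 * (Real.pi ^ 2 / 6)) (m' := -∑' k : ℕ, 1 / ((2 * k + 1 : ℕ) : ℝ) ^ 2)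
    (by convert! he using 2 with k; simp)
    (by convert! ho.hasSum.neg using 2 with k; simp [pow_succ, neg_div])
  convert! h2 using 1
  linarith

/-- The series diverges at r = 1 because the coefficients tend to 2/3. That part is summed in closed
form; the remaining 1/(3n²) part converges uniformly on [0,1]. -/
theorem tendsto_extremal_series :
    Filter.Tendsto (fun r : ℝ => ∑' n : ℕ, extremalCoeff (n + 1) * (-r) ^ (n + 1))
      (nhdsWithin 1 (Set.Iio 1)) (nhds (-(1 / 36 * (12 + Real.pi ^ 2)))) := by
  set S : ℝ → ℝ := fun r => ∑' n : ℕ, (-r) ^ (n + 1) / ((n + 1 : ℕ) : ℝ) ^ 2 with hS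
  have hb : Summable fun n : ℕ => 1 / ((n + 1 : ℕ) : ℝ) ^ 2 :=
    (summable_nat_add_iff 1).mpr hasSum_zeta_two.summable
  have hbound : ∀ (n : ℕ) (r : ℝ), r ∈ Set.Icc (0 : ℝ) 1 →
      ‖(-r) ^ (n + 1) / ((n + 1 : ℕ) : ℝ) ^ 2‖ ≤ 1 / ((n + 1 : ℕ) : ℝ) ^ 2 := by
    intro n r hr
    rw [norm_div, norm_pow, norm_neg, Real.norm_of_nonneg hr.1, norm_pow, Real.norm_natCast]
    gcongr
    exact pow_le_one₀ hr.1 hr.2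
  have hSc : ContinuousOn S (Set.Icc 0 1) :=
    continuousOn_tsum (fun n => by fun_prop) hb hbound
  have hS1 : S 1 = -(Real.pi ^ 2 / 12) := by
    -- The term of index 0 is 1/0 = 0, so dropping it does not change the sum.
    have h := (hasSum_nat_add_iff' 1).mpr hasSum_neg_one_pow_div_sq
    simp only [Finset.sum_range_one, Nat.cast_zero, ne_eq, OfNat.ofNat_ne_zero, not_false_eq_true,
      zero_pow, div_zero, sub_zero] at h
    exact h.tsum_eq
  have heq : ∀ r ∈ Set.Ioo (0 : ℝ) 1, 2 / 3 * (-r / (1 + r)) + 1 / 3 * S r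
      = ∑' n : ℕ, extremalCoeff (n + 1) * (-r) ^ (n + 1) := by
    rintro r ⟨h0, h1⟩
    have hg : HasSum (fun n : ℕ => (-r) ^ (n + 1)) (-r / (1 + r)) := by
      have h := (hasSum_geometric_of_norm_lt_one (ξ := -r)
        (by rwa [norm_neg, Real.norm_of_nonneg h0.le])).mul_left (-r)
      convert! h using 1
      · ext n; ring
      · rw [sub_neg_eq_add, div_eq_mul_inv]
    have hs : HasSum (fun n : ℕ => (-r) ^ (n + 1) / ((n + 1 : ℕ) : ℝ) ^ 2) (S r) :=
      (Summable.of_norm_bounded hb (hbound · r ⟨h0.le, h1.le⟩)).hasSum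
    have h := (hg.mul_left (2 / 3)).add (hs.mul_left (1 / 3))
    rw [← h.tsum_eq]
    refine tsum_congr fun n => ?_
    rw [extremalCoeff]
    field_simp
  have hlim : Filter.Tendsto (fun r : ℝ => 2 / 3 * (-r / (1 + r)) + 1 / 3 * S r)
      (nhdsWithin 1 (Set.Iio 1)) (nhds (2 / 3 * (-1 / (1 + 1)) + 1 / 3 * S 1)) := by
    refine Filter.Tendsto.add (Filter.Tendsto.mono_left (ContinuousAt.tendsto
      (f := fun r : ℝ => 2 / 3 * (-r / (1 + r))) ?_) nhdsWithin_le_nhds)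
      (Filter.Tendsto.const_mul _ ?_)
    · exact ContinuousAt.const_mul (by fun_prop (disch := norm_num)) _
    · exact (hSc 1 (Set.right_mem_Icc.mpr zero_le_one)).mono_left
        (nhdsWithin_le_of_mem (Filter.mem_of_superset (Ioo_mem_nhdsLT zero_lt_one)
          Set.Ioo_subset_Icc_self))
  rw [hS1] at hlim
  convert! hlim.congr' (Filter.eventually_of_mem (Ioo_mem_nhdsLT zero_lt_one) heq) using 2
  ring

theorem neg_ofReal_mem_ball {r : ℝ} (h0 : 0 ≤ r) (h1 : r < 1) : -(r : ℂ) ∈ ball (0 : ℂ) 1 := by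
  rw [mem_ball_zero_iff, norm_neg, Complex.norm_real, Real.norm_of_nonneg h0]
  exact h1

theorem hasDerivAt_neg_re_comp_neg {h : ℂ → ℂ} (hh : DifferentiableOn ℂ h (ball 0 1)) {r : ℝ}
    (h0 : 0 ≤ r) (h1 : r < 1) :
    HasDerivAt (fun r : ℝ => -(h (-(r : ℂ))).re) (deriv h (-(r : ℂ))).re r := by
  have hd := (hh.differentiableAt (isOpen_ball.mem_nhds (neg_ofReal_mem_ball h0 h1))).hasDerivAt
  have hl : HasDerivAt (fun r : ℝ => -(r : ℂ)) (-1) r := by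
    simpa using (hasDerivAt_id' r).ofReal_comp.fun_neg
  have hc := hd.comp_of_eq r hl rfl
  have := (Complex.reCLM.hasFDerivAt.comp_hasDerivAt r hc).neg
  simpa using! this

theorem continuousOn_neg_re_comp_neg {h : ℂ → ℂ} (hh : DifferentiableOn ℂ h (ball 0 1)) :
    ContinuousOn (fun r : ℝ => -(h (-(r : ℂ))).re) (Set.Ico 0 1) := fun _ hr =>
  (hasDerivAt_neg_re_comp_neg hh hr.1 hr.2).continuousAt.continuousWithinAt

/-- A boundary value of a univalent function at a boundary point of the disc lies on the frontier
of its image. -/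
theorem mem_frontier_of_tendsto {f : ℂ → ℂ} (hf : DifferentiableOn ℂ f (ball 0 1))
    (hinj : Set.InjOn f (ball 0 1)) {ι : Type*} {l : Filter ι} [l.NeBot] {u : ι → ℂ} {a w : ℂ}
    (hu : ∀ᶠ i in l, u i ∈ ball (0 : ℂ) 1) (ha : a ∉ ball (0 : ℂ) 1)
    (hua : Filter.Tendsto u l (nhds a)) (hfu : Filter.Tendsto (fun i => f (u i)) l (nhds w)) :
    w ∈ frontier (f '' ball 0 1) := by
  have hopen : IsOpen (f '' ball 0 1) :=
    isOpen_image_of_deriv_ne_zero isOpen_ball hf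
      fun z hz => deriv_ne_zero_of_injOn isOpen_ball hf hinj hz
  rw [hopen.frontier_eq]
  refine ⟨mem_closure_of_tendsto hfu (hu.mono fun i hi => Set.mem_image_of_mem f hi), ?_⟩
  rintro ⟨z, hz, rfl⟩
  obtain ⟨ψ, hψ, hψd⟩ := exists_leftInverse_hasDerivAt isOpen_ball hf hinj
  have h1 : Filter.Tendsto (fun i => ψ (f (u i))) l (nhds (ψ (f z))) :=
    (hψd z hz).continuousAt.tendsto.comp hfu
  rw [hψ z hz] at h1
  have h2 : Filter.Tendsto u l (nhds z) :=
    h1.congr' (hu.mono fun i hi => hψ _ hi)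
  exact ha (tendsto_nhds_unique hua h2 ▸ hz)

/-- The extremal function, and the sharp lower bound for the distance to the boundary. -/
theorem exists_extremal_boundaryDist : ∃ f : ℂ → ℂ, IsClassC3 f ∧
    (∀ n : ℕ, taylorCoeff f (n + 1) = extremalCoeff (n + 1)) ∧
    boundaryDist f = 1 / 36 * (12 + Real.pi ^ 2) ∧
    ∀ h : ℂ → ℂ, IsClassC3 h → 1 / 36 * (12 + Real.pi ^ 2) ≤ boundaryDist h := by
  obtain ⟨f, hf, hfn, hfF⟩ := exists_extremal
  -- The comparison functions are the extremal function itself on the negative axis; the relations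
  -- required of them follow from z(zf')' = -`koebeMinor t` at z = -t.
  set N₂ : ℝ → ℝ := fun r => -(zDeriv f (-(r : ℂ))).re with hN2
  set N₃ : ℝ → ℝ := fun r => -(f (-(r : ℂ))).re with hN3
  have h20 : N₂ 0 = 0 := by simp [hN2, zDeriv]
  have h30 : N₃ 0 = 0 := by simp [hN3, hf.map_zero]
  have h2 : ∀ t ∈ Set.Ioo (0 : ℝ) 1, HasDerivAt N₂ (koebeMinor t / t) t := by
    rintro t ⟨h0, h1⟩
    convert! hasDerivAt_neg_re_comp_neg hf.analytic.zDeriv h0.le h1 using 1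
    have ht : -(t : ℂ) ≠ 0 := neg_ne_zero.mpr (by exact_mod_cast h0.ne')
    rw [deriv_eq_div ht, hfF _ (neg_ofReal_mem_ball h0.le h1), ← Complex.ofReal_re (koebeMinor t / t)]
    congr 1
    rw [koebeMinor]
    push_cast
    rw [sub_neg_eq_add, neg_sq, neg_mul, neg_div, neg_div_neg_eq]
  have h3 : ∀ t ∈ Set.Ioo (0 : ℝ) 1, HasDerivAt N₃ (N₂ t / t) t := by
    rintro t ⟨h0, h1⟩
    convert! hasDerivAt_neg_re_comp_neg hf.analytic h0.le h1 using 1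
    have ht : -(t : ℂ) ≠ 0 := neg_ne_zero.mpr (by exact_mod_cast h0.ne')
    rw [deriv_eq_div ht, ← Complex.ofReal_neg, Complex.div_ofReal_re, Complex.ofReal_neg, hN2,
      div_neg, neg_div]
  have hgrow : ∀ h : ℂ → ℂ, IsClassC3 h →
      Set.InjOn h (ball 0 1) ∧ ∀ z ∈ ball (0 : ℂ) 1, N₃ ‖z‖ ≤ ‖h z‖ := fun h hh =>
    hh.injOn_and_growth h20 (continuousOn_neg_re_comp_neg hf.analytic.zDeriv) h2 h30
      (continuousOn_neg_re_comp_neg hf.analytic) h3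
  have hreal : ∀ r ∈ Set.Ioo (0 : ℝ) 1,
      ((∑' n : ℕ, extremalCoeff (n + 1) * (-r) ^ (n + 1) : ℝ) : ℂ) = f (-(r : ℂ)) := by
    rintro r ⟨h0, h1⟩
    have h := (hasSum_nat_add_iff' 1).mpr
      (hasSum_taylorCoeff hf.analytic (neg_ofReal_mem_ball h0.le h1))
    simp only [Finset.sum_range_one, taylorCoeff_zero, hf.map_zero, zero_mul, sub_zero, hfn] at h
    rw [Complex.ofReal_tsum, ← h.tsum_eq]
    push_cast
    rfl
  have hev : ∀ᶠ r in nhdsWithin (1 : ℝ) (Set.Iio 1), r ∈ Set.Ioo (0 : ℝ) 1 :=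
    Ioo_mem_nhdsLT zero_lt_one
  have hlim : Filter.Tendsto (fun r : ℝ => f (-(r : ℂ))) (nhdsWithin 1 (Set.Iio 1))
      (nhds ((-(1 / 36 * (12 + Real.pi ^ 2)) : ℝ) : ℂ)) :=
    ((Complex.continuous_ofReal.tendsto _).comp tendsto_extremal_series).congr'
      (hev.mono hreal)
  have hJ : Filter.Tendsto N₃ (nhdsWithin 1 (Set.Iio 1)) (nhds (1 / 36 * (12 + Real.pi ^ 2))) := by
    have := ((Complex.continuous_re.tendsto _).comp hlim).neg
    rwa [Complex.ofReal_re, neg_neg] at this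
  have hle : ∀ h : ℂ → ℂ, IsClassC3 h → 1 / 36 * (12 + Real.pi ^ 2) ≤ boundaryDist h :=
    fun h hh => le_boundaryDist_of_growth hh.analytic hh.map_zero (hgrow h hh).1 (hgrow h hh).2 hJ
  refine ⟨f, hf, hfn, le_antisymm ?_ (hle f hf), hle⟩
  have hmem : ((-(1 / 36 * (12 + Real.pi ^ 2)) : ℝ) : ℂ) ∈ frontier (f '' ball 0 1) := by
    refine mem_frontier_of_tendsto hf.analytic (hgrow f hf).1 (a := -((1 : ℝ) : ℂ))
      (hev.mono fun r hr => neg_ofReal_mem_ball hr.1.le hr.2) (by simp)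
      (Filter.Tendsto.mono_left (Continuous.tendsto (by fun_prop) 1) nhdsWithin_le_nhds) hlim
  have h := infDist_le_dist_of_mem (x := f 0) hmem
  rw [hf.map_zero, dist_zero_left, Complex.norm_real, norm_neg,
    Real.norm_of_nonneg (by positivity)] at h
  rwa [boundaryDist, hf.map_zero]

/-! ### The radius. -/

/-- The left-hand side of the inequality for the extremal function, as a function of `r = |z|`. -/
noncomputable def extremalSum (p r : ℝ) : ℝ :=
  r + ∑' n : ℕ, extremalCoeff (n + 2) * r ^ (n + 2)
    + ∑' n : ℕ, extremalCoeff (n + 2) ^ p * r ^ (((n + 2 : ℕ) : ℝ) * p)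

section Radius

variable {p : ℝ}

theorem summable_pow_add_two {r : ℝ} (h0 : 0 ≤ r) (h1 : r < 1) :
    Summable fun n : ℕ => r ^ (n + 2) :=
  (summable_nat_add_iff 2).mpr (summable_geometric_of_lt_one h0 h1)

theorem extremalCoeff_mul_pow_le {r : ℝ} (h0 : 0 ≤ r) (n : ℕ) :
    extremalCoeff (n + 2) * r ^ (n + 2) ≤ r ^ (n + 2) :=
  mul_le_of_le_one_left (by positivity) (extremalCoeff_le_one (by omega))

theorem extremalCoeff_rpow_mul_le (hp : 1 ≤ p) {r : ℝ} (h0 : 0 ≤ r) (h1 : r ≤ 1) (n : ℕ) :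
    extremalCoeff (n + 2) ^ p * r ^ (((n + 2 : ℕ) : ℝ) * p) ≤ r ^ (n + 2) := by
  have h2 : extremalCoeff (n + 2) ^ p ≤ 1 :=
    Real.rpow_le_one (extremalCoeff_nonneg _) (extremalCoeff_le_one (by omega)) (by linarith)
  have h3 : r ^ (((n + 2 : ℕ) : ℝ) * p) ≤ r ^ (n + 2) := by
    rw [Real.rpow_mul h0, Real.rpow_natCast]
    exact Real.rpow_le_self_of_le_one (by positivity) (pow_le_one₀ h0 h1) hp
  exact (mul_le_of_le_one_left (by positivity) h2).trans h3

theorem summable_extremalCoeff_mul_pow {r : ℝ} (h0 : 0 ≤ r) (h1 : r < 1) :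
    Summable fun n : ℕ => extremalCoeff (n + 2) * r ^ (n + 2) :=
  (summable_pow_add_two h0 h1).of_nonneg_of_le
    (fun n => mul_nonneg (extremalCoeff_nonneg _) (by positivity)) (extremalCoeff_mul_pow_le h0)

theorem summable_extremalCoeff_rpow_mul (hp : 1 ≤ p) {r : ℝ} (h0 : 0 ≤ r) (h1 : r < 1) :
    Summable fun n : ℕ => extremalCoeff (n + 2) ^ p * r ^ (((n + 2 : ℕ) : ℝ) * p) :=
  (summable_pow_add_two h0 h1).of_nonneg_of_le
    (fun n => mul_nonneg (Real.rpow_nonneg (extremalCoeff_nonneg _) _) (by positivity))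
    (extremalCoeff_rpow_mul_le hp h0 h1.le)

theorem extremalSum_lt (hp : 1 ≤ p) {r s : ℝ} (h0 : 0 ≤ r) (hrs : r < s) (h1 : s < 1) :
    extremalSum p r < extremalSum p s := by
  have hs0 := h0.trans hrs.le
  rw [extremalSum, extremalSum]
  refine add_lt_add_of_lt_of_le (add_lt_add_of_lt_of_le hrs ?_) ?_
  · refine (summable_extremalCoeff_mul_pow h0 (hrs.trans h1)).tsum_le_tsum (fun n => ?_)
      (summable_extremalCoeff_mul_pow hs0 h1)
    exact mul_le_mul_of_nonneg_left (pow_le_pow_left₀ h0 hrs.le _) (extremalCoeff_nonneg _)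
  · refine (summable_extremalCoeff_rpow_mul hp h0 (hrs.trans h1)).tsum_le_tsum (fun n => ?_)
      (summable_extremalCoeff_rpow_mul hp hs0 h1)
    exact mul_le_mul_of_nonneg_left (Real.rpow_le_rpow h0 hrs.le (by positivity))
      (Real.rpow_nonneg (extremalCoeff_nonneg _) _)

theorem continuousOn_extremalSum (hp : 1 ≤ p) :
    ContinuousOn (extremalSum p) (Set.Icc 0 (1 / 2)) := by
  have hb := summable_pow_add_two (r := 1 / 2) (by norm_num) (by norm_num)
  refine (continuousOn_id.add (continuousOn_tsum (fun n => by fun_prop) hb ?_)).add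
    (continuousOn_tsum (fun n => ?_) hb ?_)
  · intro n r hr
    have h0 := hr.1
    rw [Real.norm_of_nonneg (mul_nonneg (extremalCoeff_nonneg _) (by positivity))]
    exact (extremalCoeff_mul_pow_le h0 n).trans (pow_le_pow_left₀ h0 hr.2 _)
  · refine ContinuousOn.mul continuousOn_const (Continuous.continuousOn ?_)
    exact Real.continuous_rpow_const (by positivity)
  · intro n r hr
    have h0 := hr.1
    rw [Real.norm_of_nonneg (mul_nonneg (Real.rpow_nonneg (extremalCoeff_nonneg _) _)
      (by positivity))]
    exact (extremalCoeff_rpow_mul_le hp h0 (by linarith [hr.2]) n).trans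
      (pow_le_pow_left₀ h0 hr.2 _)

/-- The rational term of the equation is r plus the geometric series with the constant part 2/3 of
the coefficients. -/
theorem radiusEquation_eq {r : ℝ} (h0 : 0 ≤ r) (h1 : r < 1) :
    radiusEquation p r = extremalSum p r - 1 / 36 * (12 + Real.pi ^ 2) := by
  have hg : HasSum (fun n : ℕ => 2 / 3 * r ^ (n + 2)) (2 / 3 * (r ^ 2 * (1 - r)⁻¹)) := by
    have h := ((hasSum_geometric_of_lt_one h0 h1).mul_left (r ^ 2)).mul_left (2 / 3)
    convert! h using 3
    ring
  have hs : Summable fun n : ℕ => r ^ (n + 2) / (3 * ((n + 2 : ℕ) : ℝ) ^ 2) := by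
    refine ((summable_extremalCoeff_mul_pow h0 h1).sub hg.summable).congr fun n => ?_
    rw [extremalCoeff]; ring
  have h2 : ∑' n : ℕ, extremalCoeff (n + 2) * r ^ (n + 2)
      = 2 / 3 * (r ^ 2 * (1 - r)⁻¹) + ∑' n : ℕ, r ^ (n + 2) / (3 * ((n + 2 : ℕ) : ℝ) ^ 2) := by
    rw [← hg.tsum_eq, ← hg.summable.tsum_add hs]
    refine tsum_congr fun n => ?_
    rw [extremalCoeff]; ring
  have h3 : (3 - r) * r / (3 * (1 - r)) = r + 2 / 3 * (r ^ 2 * (1 - r)⁻¹) := by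
    have : 1 - r ≠ 0 := by linarith
    field_simp
    ring
  rw [radiusEquation, extremalSum, h2, h3]
  simp only [extremalCoeff]
  ring

theorem extremalSum_zero (hp : 1 ≤ p) : extremalSum p 0 = 0 := by
  have h (n : ℕ) : ((n + 2 : ℕ) : ℝ) * p ≠ 0 := by positivity
  simp only [extremalSum, Real.zero_rpow (h _)]
  simp

/-- The linear term and the 2/3 part of the first series already give 1/2 + 1/3 = 5/6, and π² < 18.
-/
theorem lt_extremalSum_half : 1 / 36 * (12 + Real.pi ^ 2) < extremalSum p (1 / 2) := by
  have h1 : ∑' n : ℕ, 2 / 3 * (1 / 2 : ℝ) ^ (n + 2)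
      ≤ ∑' n : ℕ, extremalCoeff (n + 2) * (1 / 2 : ℝ) ^ (n + 2) := by
    refine ((summable_pow_add_two (r := 1 / 2) (by norm_num) (by norm_num)).mul_left
      (2 / 3)).tsum_le_tsum (fun n => ?_)
      (summable_extremalCoeff_mul_pow (by norm_num) (by norm_num))
    rw [extremalCoeff]
    gcongr
    exact le_add_of_nonneg_right (by positivity)
  have h2 : ∑' n : ℕ, 2 / 3 * (1 / 2 : ℝ) ^ (n + 2) = 1 / 3 := by
    have h := (hasSum_geometric_of_lt_one (r := 1 / 2) (by norm_num) (by norm_num)).mul_left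
      (2 / 3 * (1 / 2) ^ 2)
    have h4 := h.tsum_eq
    norm_num at h4
    rw [← h4]
    exact tsum_congr fun n => by ring
  have h3 : 0 ≤ ∑' n : ℕ, extremalCoeff (n + 2) ^ p * (1 / 2 : ℝ) ^ (((n + 2 : ℕ) : ℝ) * p) :=
    tsum_nonneg fun n => mul_nonneg (Real.rpow_nonneg (extremalCoeff_nonneg _) _) (by positivity)
  rw [extremalSum]
  nlinarith [Real.pi_lt_d2, Real.pi_pos]

theorem exists_radius (hp : 1 ≤ p) : ∃ R ∈ Set.Ioo (0 : ℝ) (1 / 2),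
    extremalSum p R = 1 / 36 * (12 + Real.pi ^ 2) := by
  obtain ⟨R, hR, h⟩ := intermediate_value_Ioo (by norm_num) (continuousOn_extremalSum hp)
    (show 1 / 36 * (12 + Real.pi ^ 2) ∈ Set.Ioo (extremalSum p 0) (extremalSum p (1 / 2)) from
      ⟨by rw [extremalSum_zero hp]; positivity, lt_extremalSum_half⟩)
  exact ⟨R, hR, h⟩

theorem IsClassC3.bohrSum_le {f : ℂ → ℂ} (hf : IsClassC3 f) (hp : 1 ≤ p) {z : ℂ} (hz : ‖z‖ < 1) :
    Summable (fun n : ℕ => majorantTerm f z (n + 2)) ∧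
    Summable (fun n : ℕ => powerTerm p f z (n + 2)) ∧ bohrSum p f z ≤ extremalSum p ‖z‖ := by
  have hz0 := norm_nonneg z
  have a1 : ∀ n : ℕ, majorantTerm f z (n + 2) ≤ extremalCoeff (n + 2) * ‖z‖ ^ (n + 2) :=
    fun n => mul_le_mul_of_nonneg_right (hf.norm_taylorCoeff_le (n + 1)) (by positivity)
  have a2 : ∀ n : ℕ, powerTerm p f z (n + 2)
      ≤ extremalCoeff (n + 2) ^ p * ‖z‖ ^ (((n + 2 : ℕ) : ℝ) * p) := fun n =>
    mul_le_mul_of_nonneg_right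
      (Real.rpow_le_rpow (norm_nonneg _) (hf.norm_taylorCoeff_le (n + 1)) (by linarith))
      (by positivity)
  have s1 := summable_extremalCoeff_mul_pow hz0 hz
  have s2 := summable_extremalCoeff_rpow_mul hp hz0 hz
  have t1 : Summable fun n : ℕ => majorantTerm f z (n + 2) :=
    s1.of_nonneg_of_le (fun n => by rw [majorantTerm]; positivity) a1
  have t2 : Summable fun n : ℕ => powerTerm p f z (n + 2) :=
    s2.of_nonneg_of_le (fun n => by rw [powerTerm]; positivity) a2
  exact ⟨t1, t2, add_le_add (add_le_add le_rfl (t1.tsum_le_tsum a1 s1)) (t2.tsum_le_tsum a2 s2)⟩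

theorem bohrSum_eq_extremalSum {f : ℂ → ℂ}
    (hf : ∀ n : ℕ, taylorCoeff f (n + 1) = extremalCoeff (n + 1)) (z : ℂ) :
    bohrSum p f z = extremalSum p ‖z‖ := by
  have h : ∀ n : ℕ, ‖taylorCoeff f (n + 2)‖ = extremalCoeff (n + 2) := fun n => by
    rw [hf (n + 1), Complex.norm_real, Real.norm_of_nonneg (extremalCoeff_nonneg _)]
  simp only [bohrSum, extremalSum, majorantTerm, powerTerm, h]

end Radius

theorem mainTheorem10 (p : ℝ) (hp : 1 ≤ p) :
    ∃ R ∈ Set.Ioo (0 : ℝ) (1 / 2),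
      -- `R` is the root of the equation in `(0, 1/2)`
      radiusEquation p R = 0 ∧
      (∀ r ∈ Set.Ioo (0 : ℝ) (1 / 2), radiusEquation p r = 0 → r = R) ∧
      -- the inequality holds for the whole class in the disc `|z| ≤ R`
      (∀ f : ℂ → ℂ, IsClassC3 f → ∀ z : ℂ, ‖z‖ ≤ R →
        Summable (fun n : ℕ => majorantTerm f z (n + 2)) ∧
        Summable (fun n : ℕ => powerTerm p f z (n + 2)) ∧
        bohrSum p f z ≤ boundaryDist f) ∧
      -- sharpness: equality on `|z| = R` and failure at every larger `|z| < 1`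
      (∃ f : ℂ → ℂ, IsClassC3 f ∧
        (∀ z : ℂ, ‖z‖ = R → bohrSum p f z = boundaryDist f) ∧
        (∀ z : ℂ, R < ‖z‖ → ‖z‖ < 1 →
          Summable (fun n : ℕ => majorantTerm f z (n + 2)) ∧
          Summable (fun n : ℕ => powerTerm p f z (n + 2)) ∧
          boundaryDist f < bohrSum p f z)) := by
  obtain ⟨R, ⟨hR0, hR1⟩, hR⟩ := exists_radius hp
  obtain ⟨f, hf, hfn, hfJ, hJ⟩ := exists_extremal_boundaryDist
  have hmono : StrictMonoOn (extremalSum p) (Set.Ico 0 1) := fun r hr s hs hrs =>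
    extremalSum_lt hp hr.1 hrs hs.2
  have hR2 : R ∈ Set.Ico (0 : ℝ) 1 := ⟨hR0.le, by linarith⟩
  refine ⟨R, ⟨hR0, hR1⟩, ?_, ?_, ?_, f, hf, ?_, ?_⟩
  · rw [radiusEquation_eq hR2.1 hR2.2, hR, sub_self]
  · intro r hr h
    have hr2 : r ∈ Set.Ico (0 : ℝ) 1 := ⟨hr.1.le, by linarith [hr.2]⟩
    rw [radiusEquation_eq hr2.1 hr2.2, sub_eq_zero, ← hR] at h
    exact hmono.injOn hr2 hR2 h
  · intro h hh z hz
    have hz1 := hz.trans_lt hR2.2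
    obtain ⟨h1, h2, h3⟩ := hh.bohrSum_le hp hz1
    refine ⟨h1, h2, h3.trans (le_trans ?_ (hJ h hh))⟩
    rw [← hR]
    exact hmono.monotoneOn ⟨norm_nonneg z, hz1⟩ hR2 hz
  · intro z hz
    rw [bohrSum_eq_extremalSum hfn, hz, hR, hfJ]
  · intro z hz hz1
    obtain ⟨h1, h2, -⟩ := hf.bohrSum_le hp hz1
    refine ⟨h1, h2, ?_⟩
    rw [bohrSum_eq_extremalSum hfn, hfJ, ← hR]
    exact hmono hR2 ⟨norm_nonneg z, hz1⟩ hz
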